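/- Let $d,m\in\mathbb N$, $T>0$, $K>0$, $\varrho\in(0,1]$, $r\in[2,\infty)$. Vectors carry the Euclidean norm and matrices the Frobenius norm, both written $\|\cdot\|$, and $\|Y\|_r=(\mathbb E\|Y\|^r)^{1/r}$ for random $Y$. Admissible data. $\mathcal F(\varrho,K)$ is the set of triples $(a,b,\eta)$ such that: $a:[0,T]\times\mathbb R^d\to\mathbb R^d$ is Borel measurable with $\|a(t,0)\|\le K$ and $\|a(t,x)-a(t,y)\|\le K\|x-y\|$; $b:[0,T]\times\mathbb R^d\to\mathbb R^{d\times m}$ satisfies $\|b(0,0)\|\le K$, $\|b(t,x)-b(t,y)\|\le K\|x-y\|$ and $\|b(t,x)-b(s,x)\|\le K(1+\|x\|)|t-s|^{\varrho}$; and $\eta\in\mathbb R^d$, $\|\eta\|\le K$ (for all $s,t\in[0,T]$ and $x,y\in\mathbb R^d$). Noisy data. For $\delta\in[0,1]$, $V_a(\delta)$ is the set of functions $\tilde a=a+\delta p$ with $p:[0,T]\times\mathbb R^d\to\mathbb R^d$ Borel measurable and $\|p(t,y)\|\le 1+\|y\|$ for all $t,y$; $V_b(\delta)$ is defined in the same way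 from $b$ with $p$ valued in $\mathbb R^{d\times m}$. Let $W$ be a standard $m$-dimensional Wiener process with respect to a filtration $(\Sigma_t)_{t\ge0}$ on a probability space $(\Omega,\Sigma,\mathbb P)$, and let $\Sigma_\infty=\sigma(\bigcup_{t\ge 0}\Sigma_t)$. For a class $\mathcal K$ of functions $p:[0,T]\times\mathbb R^m\to\mathbb R^m$, consider the processes $\tilde W(t)=W(t)+\delta\,p(t,W(t))$, $t\in[0,T]$, with $p\in\mathcal K$. They form the class $\mathcal W_0(\delta)$ if $\mathcal K=\mathcal K_0$, the set of $p$ each of whose components $p^j$ is in $C^{1,2}([0,T]\times\mathbb R^m;\mathbb R)$ with $|p^j(0,0)|\le 1$ and $|\partial_t p^j|$, $\|\partial_y p^j\|$, $\|\partial^2_{y} p^j\|$ all bounded by $1$ on $[0,T]\times\mathbb R^m$ (time derivative, space gradient, space Hessian). They form the class $\mathcal W_{\alpha,\beta}(\delta)$ if $\mathcal K=\mathcal K_{\alpha,\beta}$, the set of $p$ with $\|p(t,x)-p(s,y)\|\le|t-s|^\alpha+\|x-y\|^\beta$ for all $s,t\in[0,T]$, $x,y\in\mathbb R^m$. The scheme.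 For $n\in\mathbb N$, $n\ge1$, let $t_i=iT/n$, and let $\xi_0,\dots,\xi_{n-1}$ be independent $[0,T]$-valued random variables, $\xi_i$ uniformly distributed on $[t_i,t_{i+1}]$, such that $\sigma(\xi_0,\dots,\xi_{n-1})$ is independent of $\Sigma_\infty$. Given $(\tilde a,\tilde b,\tilde W,\eta)$, put $\bar X_n(t_0)=\eta$ and $$\bar X_n(t_{i+1})=\bar X_n(t_i)+\tilde a(\xi_i,\bar X_n(t_i))\frac Tn+\tilde b(t_i,\bar X_n(t_i))\,(\tilde W(t_{i+1})-\tilde W(t_i)),\quad 0\le i<n.$$ Let $X_n$ be the same scheme, with the same $\xi_i$ and $\eta$, run with the exact data $(a,b,W)$. (i) There is $C\in(0,\infty)$, depending only on $d,m,T,K,\varrho,r$, such that for all such $(\Omega,\Sigma,\mathbb P)$, $(\Sigma_t)$, $W$, all $n\ge1$ and $(\xi_i)$, all $\delta_1,\delta_2,\delta_3\in[0,1]$, $(a,b,\eta)\in\mathcal F(\varrho,K)$ and $(\tilde a,\tilde b,\tilde W)\in V_a(\delta_1)\times V_b(\delta_2)\times\mathcal W_0(\delta_3)$, the random variable $\max_{0\le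 i\le n}\|X_n(t_i)-\bar X_n(t_i)\|$ is in $L^r(\Omega)$ and $$\Bigl\|\max_{0\le i\le n}\|X_n(t_i)-\bar X_n(t_i)\|\Bigr\|_r\le C(\delta_1+\delta_2+\delta_3).$$ (ii) Let $\alpha,\beta\in(0,1]$ and $\gamma=\min\{\alpha,\beta/2\}$. There is $C\in(0,\infty)$, depending only on $d,m,T,K,\varrho,r,\alpha,\beta$, such that for all such $(\Omega,\Sigma,\mathbb P)$, $(\Sigma_t)$, $W$, all $n\ge1$ and $(\xi_i)$, all $\delta_1,\delta_2,\delta_3\in[0,1]$, $(a,b,\eta)\in\mathcal F(\varrho,K)$ and $(\tilde a,\tilde b,\tilde W)\in V_a(\delta_1)\times V_b(\delta_2)\times\mathcal W_{\alpha,\beta}(\delta_3)$, the same random variable is in $L^r(\Omega)$ and $$\Bigl\|\max_{0\le i\le n}\|X_n(t_i)-\bar X_n(t_i)\|\Bigr\|_r\le C(\delta_1+\delta_2+\delta_3n^{1-\gamma})(1+\delta_3n^{1-\gamma})\,e^{C(1+(\delta_3n^{1-\gamma})^r)}.$$ -/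

import Mathlib

open MeasureTheory ProbabilityTheory Set
open scoped NNReal ENNReal Matrix Matrix.Norms.Frobenius

universe u

namespace NoisyEuler

/-- `ℝᵏ` with the Euclidean norm. -/
abbrev Vec (k : ℕ) : Type := EuclideanSpace ℝ (Fin k)

/-- Real `d × m` matrices; the norm in force is the Frobenius norm. -/
abbrev Mat (d m : ℕ) : Type := Matrix (Fin d) (Fin m) ℝ

/-- Matrix-by-vector multiplication `ℝ^{d×m} × ℝᵐ → ℝᵈ`. -/
noncomputable def matVec {d m : ℕ} (A : Mat d m) (v : Vec m) : Vec d :=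
  WithLp.toLp 2 (A *ᵥ WithLp.ofLp v)

/- Functions on `[0,T] × ℝᵏ` are represented by functions on `ℝ × ℝᵏ` of which only the values
at times in `[0,T]` matter. -/

/-- The class `𝒜_K` of drift coefficients. -/
structure IsDrift {d : ℕ} (T : ℝ≥0) (K : ℝ) (a : ℝ → Vec d → Vec d) : Prop where
  measurable : Measurable (fun q : Icc (0 : ℝ) T × Vec d => a q.1 q.2)
  bound : ∀ t ∈ Icc (0 : ℝ) T, ‖a t 0‖ ≤ K
  lipschitz : ∀ t ∈ Icc (0 : ℝ) T, ∀ x y, ‖a t x - a t y‖ ≤ K * ‖x - y‖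

/-- The class `ℬ^ϱ_K` of diffusion coefficients. -/
structure IsDiffusion {d m : ℕ} (T : ℝ≥0) (ϱ K : ℝ) (b : ℝ → Vec d → Mat d m) : Prop where
  bound : ‖b 0 0‖ ≤ K
  lipschitz : ∀ t ∈ Icc (0 : ℝ) T, ∀ x y, ‖b t x - b t y‖ ≤ K * ‖x - y‖
  holder : ∀ t ∈ Icc (0 : ℝ) T, ∀ s ∈ Icc (0 : ℝ) T, ∀ x,
    ‖b t x - b s x‖ ≤ K * (1 + ‖x‖) * |t - s| ^ ϱ

/-- The class `ℱ(ϱ,K) = 𝒜_K × ℬ^ϱ_K × 𝒥_K` of admissible tuples `(a, b, η)`. -/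
structure IsAdmissible {d m : ℕ} (T : ℝ≥0) (ϱ K : ℝ) (a : ℝ → Vec d → Vec d)
    (b : ℝ → Vec d → Mat d m) (η : Vec d) : Prop where
  drift : IsDrift T K a
  diffusion : IsDiffusion T ϱ K b
  initial : ‖η‖ ≤ K

/-- The class `𝒦¹` of corrupting functions for the drift. -/
structure IsDriftNoise {d : ℕ} (T : ℝ≥0) (p : ℝ → Vec d → Vec d) : Prop where
  measurable : Measurable (fun q : Icc (0 : ℝ) T × Vec d => p q.1 q.2)
  growth : ∀ t ∈ Icc (0 : ℝ) T, ∀ y, ‖p t y‖ ≤ 1 + ‖y‖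

/-- The class `𝒦ᵐ` of corrupting functions for the diffusion (Borel measurability of a matrix
valued map is that of its entries). -/
structure IsDiffusionNoise {d m : ℕ} (T : ℝ≥0) (p : ℝ → Vec d → Mat d m) : Prop where
  measurable : ∀ i j, Measurable (fun q : Icc (0 : ℝ) T × Vec d => p q.1 q.2 i j)
  growth : ∀ t ∈ Icc (0 : ℝ) T, ∀ y, ‖p t y‖ ≤ 1 + ‖y‖

/-- `V_a(δ)`. -/
def VDrift {d : ℕ} (T : ℝ≥0) (a : ℝ → Vec d → Vec d) (δ : ℝ) : Set (ℝ → Vec d → Vec d) :=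
  {a' | ∃ p, IsDriftNoise T p ∧ ∀ t ∈ Icc (0 : ℝ) T, ∀ y, a' t y = a t y + δ • p t y}

/-- `V_b(δ)`. -/
def VDiffusion {d m : ℕ} (T : ℝ≥0) (b : ℝ → Vec d → Mat d m) (δ : ℝ) :
    Set (ℝ → Vec d → Mat d m) :=
  {b' | ∃ p, IsDiffusionNoise T p ∧ ∀ t ∈ Icc (0 : ℝ) T, ∀ y, b' t y = b t y + δ • p t y}

/-- The partial derivative `∂f/∂t` of a function on `[0,T] × ℝᵐ` (one-sided at `0` and `T`). -/
noncomputable def timeDeriv {m : ℕ} (T : ℝ≥0) (f : ℝ → Vec m → ℝ) (t : ℝ) (y : Vec m) : ℝ :=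
  derivWithin (fun s => f s y) (Icc (0 : ℝ) T) t

/-- The gradient `∂f/∂y`. -/
noncomputable def spaceGrad {m : ℕ} (f : ℝ → Vec m → ℝ) (t : ℝ) (y : Vec m) : Vec m :=
  gradient (f t) y

/-- The Hessian matrix `∂²f/∂y²`. -/
noncomputable def spaceHess {m : ℕ} (f : ℝ → Vec m → ℝ) (t : ℝ) (y : Vec m) : Mat m m :=
  Matrix.of fun k l => fderiv ℝ (fun z => fderiv ℝ (f t) z (EuclideanSpace.single l 1)) y
    (EuclideanSpace.single k 1)

/-- `f ∈ C^{1,2}([0,T] × ℝᵐ; ℝ)`: once differentiable in time, twice in space, and `f` and these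
derivatives are jointly continuous on `[0,T] × ℝᵐ`. -/
structure IsC12 {m : ℕ} (T : ℝ≥0) (f : ℝ → Vec m → ℝ) : Prop where
  cont : ContinuousOn (fun q : ℝ × Vec m => f q.1 q.2) (Icc (0 : ℝ) T ×ˢ univ)
  diff_time : ∀ t ∈ Icc (0 : ℝ) T, ∀ y,
    DifferentiableWithinAt ℝ (fun s => f s y) (Icc (0 : ℝ) T) t
  diff_space : ∀ t ∈ Icc (0 : ℝ) T, ContDiff ℝ 2 (f t)
  cont_time : ContinuousOn (fun q : ℝ × Vec m => timeDeriv T f q.1 q.2) (Icc (0 : ℝ) T ×ˢ univ)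
  cont_grad : ContinuousOn (fun q : ℝ × Vec m => spaceGrad f q.1 q.2) (Icc (0 : ℝ) T ×ˢ univ)
  cont_hess : ∀ k l,
    ContinuousOn (fun q : ℝ × Vec m => spaceHess f q.1 q.2 k l) (Icc (0 : ℝ) T ×ˢ univ)

/-- The class `𝒦₀` of smooth corrupting functions for the Wiener process. -/
structure IsSmoothNoise {m : ℕ} (T : ℝ≥0) (p : ℝ → Vec m → Vec m) : Prop where
  c12 : ∀ j, IsC12 T (fun t y => p t y j)
  zero : ∀ j, |p 0 0 j| ≤ 1
  time_le : ∀ j, ∀ t ∈ Icc (0 : ℝ) T, ∀ y, |timeDeriv T (fun t y => p t y j) t y| ≤ 1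
  grad_le : ∀ j, ∀ t ∈ Icc (0 : ℝ) T, ∀ y, ‖spaceGrad (fun t y => p t y j) t y‖ ≤ 1
  hess_le : ∀ j, ∀ t ∈ Icc (0 : ℝ) T, ∀ y, ‖spaceHess (fun t y => p t y j) t y‖ ≤ 1

/-- The class `𝒦_{α,β}` of Hölder continuous corrupting functions for the Wiener process. -/
def IsHolderNoise {m : ℕ} (T : ℝ≥0) (α β : ℝ) (p : ℝ → Vec m → Vec m) : Prop :=
  ∀ t ∈ Icc (0 : ℝ) T, ∀ s ∈ Icc (0 : ℝ) T, ∀ x y,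
    ‖p t x - p s y‖ ≤ |t - s| ^ α + ‖x - y‖ ^ β

/-- The class `𝒲₀(δ)` of disturbed Wiener processes. -/
def WSmooth {m : ℕ} {Ω : Type u} (T : ℝ≥0) (W : ℝ≥0 → Ω → Vec m) (δ : ℝ) :
    Set (ℝ≥0 → Ω → Vec m) :=
  {W' | ∃ p, IsSmoothNoise T p ∧ ∀ t ≤ T, ∀ ω, W' t ω = W t ω + δ • p t (W t ω)}

/-- The class `𝒲_{α,β}(δ)` of disturbed Wiener processes. -/
def WHolder {m : ℕ} {Ω : Type u} (T : ℝ≥0) (α β : ℝ) (W : ℝ≥0 → Ω → Vec m) (δ : ℝ) :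
    Set (ℝ≥0 → Ω → Vec m) :=
  {W' | ∃ p, IsHolderNoise T α β p ∧ ∀ t ≤ T, ∀ ω, W' t ω = W t ω + δ • p t (W t ω)}

/-- `W` is a standard `m`-dimensional Wiener process with respect to the filtration `𝓕`. -/
structure IsWiener {m : ℕ} {Ω : Type u} {mΩ : MeasurableSpace Ω} (P : Measure Ω)
    (𝓕 : Filtration ℝ≥0 mΩ) (W : ℝ≥0 → Ω → Vec m) : Prop where
  adapted : ∀ t, Measurable[𝓕 t] (W t)
  start : ∀ᵐ ω ∂P, W 0 ω = 0
  continuous : ∀ᵐ ω ∂P, Continuous (fun t => W t ω)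
  indep : ∀ s t, s ≤ t →
    Indep (MeasurableSpace.comap (fun ω => W t ω - W s ω) inferInstance) (𝓕 s) P
  law : ∀ s t, s ≤ t → HasLaw (fun ω => W t ω - W s ω)
    (multivariateGaussian 0 (((t : ℝ) - (s : ℝ)) • (1 : Matrix (Fin m) (Fin m) ℝ))) P

/-- The grid point `tᵢ = iT/n`. -/
noncomputable def grid (T : ℝ≥0) (n i : ℕ) : ℝ≥0 := (i : ℝ≥0) * T / (n : ℝ≥0)

/-- The random points `ξ₀,…,ξₙ₋₁` used by the scheme: `[0,T]`-valued, independent, `ξᵢ` uniform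
on `[tᵢ,tᵢ₊₁]`, and jointly independent of `Σ_∞`. Only `ξ i` with `i < n` matter. -/
structure IsRandomization {Ω : Type u} {mΩ : MeasurableSpace Ω} (P : Measure Ω)
    (𝓕 : Filtration ℝ≥0 mΩ) (T : ℝ≥0) (n : ℕ) (ξ : ℕ → Ω → ℝ) : Prop where
  measurable : ∀ i < n, Measurable (ξ i)
  mem : ∀ i < n, ∀ ω, ξ i ω ∈ Icc (0 : ℝ) T
  uniform : ∀ i < n, pdf.IsUniform (ξ i) (Icc (grid T n i : ℝ) (grid T n (i + 1) : ℝ)) P volume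
  indep : iIndepFun (fun i : Fin n => ξ i) P
  indep_filtration :
    Indep (⨆ i : Fin n, MeasurableSpace.comap (ξ i) inferInstance) (⨆ t, 𝓕 t) P

/-- The randomized Euler scheme along one realization: from coefficients `a, b`, an initial value
`η`, a driving path `w` and evaluation points `ξ`, the value at `tᵢ` (for `i ≤ n`). -/
noncomputable def euler {d m : ℕ} (T : ℝ≥0) (n : ℕ) (a : ℝ → Vec d → Vec d)
    (b : ℝ → Vec d → Mat d m) (η : Vec d) (w : ℝ≥0 → Vec m) (ξ : ℕ → ℝ) : ℕ → Vec d
  | 0 => η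
  | i + 1 =>
    euler T n a b η w ξ i + ((T : ℝ) / n) • a (ξ i) (euler T n a b η w ξ i)
      + matVec (b (grid T n i) (euler T n a b η w ξ i)) (w (grid T n (i + 1)) - w (grid T n i))

/-- `max_{0 ≤ i ≤ n} ‖X(tᵢ) - X̄(tᵢ)‖`, where `X` is the scheme run with `(a, b, W)`, and `X̄` the
scheme run with `(a', b', W')`, both from `η` and with the same random points `ξ`. -/
noncomputable def maxGap {d m : ℕ} {Ω : Type u} (T : ℝ≥0) (n : ℕ)
    (a : ℝ → Vec d → Vec d) (b : ℝ → Vec d → Mat d m) (W : ℝ≥0 → Ω → Vec m)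
    (a' : ℝ → Vec d → Vec d) (b' : ℝ → Vec d → Mat d m) (W' : ℝ≥0 → Ω → Vec m)
    (η : Vec d) (ξ : ℕ → Ω → ℝ) (ω : Ω) : ℝ :=
  (Finset.range (n + 1)).sup' Finset.nonempty_range_add_one fun i =>
    ‖euler T n a b η (fun t => W t ω) (fun k => ξ k ω) i
      - euler T n a' b' η (fun t => W' t ω) (fun k => ξ k ω) i‖

end NoisyEuler

/-!
Subtracting the two schemes gives a recursion `Z_{k+1} = Z_k + U_k + B_k ΔW_k`, where `B_k` is known
at time `t_k`, and everything follows from moment bounds for such recursions.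

The increments of the disturbed process are written as
`ΔW̃_k = ΔW_k + δ (G_k ΔW_k + R_k)` with `G_k` bounded and known at time `t_k`, and `‖R_k‖` bounded by
a function of `ΔW_k` alone whose `r`-th moment is of order `n ^ (-γ r)` (`IsPerturbedIncrement`). For
smooth noise `G_k` is the Jacobian at `(t_{k+1}, W(t_k))`, `R_k` is a Taylor remainder and `γ = 1`; no
stochastic calculus is needed. For Hölder noise `G_k = 0`, `R_k` is the full increment and
`γ = min α (β / 2)`. In both cases the remainders, summed over `n` steps, contribute at most a
multiple of `ε = δ n ^ (1 - γ)`, because `R_k` is controlled by a variable independent of the past.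

The evaluation points `ξ` are independent of the Wiener process, so they may all be revealed at the
start: `ΔW_k` stays independent of the past (`indep_sup_right`), and nothing about the law of `ξ`
matters.

The martingale part is bounded by a discrete Burkholder-Davis-Gundy inequality
(`exists_integral_partialSups_transform_le`). Its proof combines the second-order expansion of
`‖x + y‖ ^ r` (`exists_norm_add_rpow_le`), whose linear term integrates to zero, with the pathwise form
of Doob's maximal inequality (`partialSups_rpow_add_sum_le`). With the power-mean inequality for the
sum of the `U_k` and the discrete Gronwall lemma this yields `exists_integral_partialSups_le_exp`,
which is applied twice: to the disturbed scheme itself, where the growth constant is of order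
`1 + ε ^ r` and produces the exponential factor, and to the difference of the schemes, where the growth
constant comes from the Lipschitz bounds of the exact coefficients and the source terms are of size
`δ₁ + δ₂ + ε` times the moments of the disturbed scheme.
-/

namespace NoisyEuler

/-! ### Elementary inequalities for real powers -/

/-- A power `x ^ p` is Lipschitz, relative to the larger argument, with constant `1 + p`; in this
form the bound needs no case distinction between `p ≤ 1` and `p ≥ 1`. -/
lemma rpow_sub_rpow_mul_le {p x M : ℝ} (hp : 0 ≤ p) (hx : 0 ≤ x) (hxM : x ≤ M) :
    (M ^ p - x ^ p) * M ≤ (1 + p) * M ^ p * (M - x) := by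
  rcases hx.trans hxM |>.eq_or_lt with hM | hM
  · subst hM
    obtain rfl : x = 0 := le_antisymm hxM hx
    simp
  obtain ⟨s, rfl⟩ : ∃ s, x = s * M := ⟨x / M, by field_simp⟩
  have hs0 : 0 ≤ s := nonneg_of_mul_nonneg_left hx hM
  have hs1 : s ≤ 1 := by
    by_contra hcon
    push Not at hcon
    nlinarith
  have key : 1 - s ^ p ≤ (1 + p) * (1 - s) := by
    rcases le_total 1 p with h1 | h1
    · have := one_add_mul_self_le_rpow_one_add (s := s - 1) (by linarith) h1
      rw [add_sub_cancel] at this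
      nlinarith
    · have : s ≤ s ^ p := by
        simpa using Real.rpow_le_rpow_of_exponent_ge' hs0 hs1 hp h1
      nlinarith
  rw [Real.mul_rpow hs0 hM.le]
  have hMp : 0 ≤ M ^ p * M := by positivity
  nlinarith [mul_le_mul_of_nonneg_left key hMp]

/-- Young's inequality with exponents `r / (r - 1)` and `r`. -/
lemma mul_rpow_sub_one_mul_le {r x y : ℝ} (hr : 1 ≤ r) (hx : 0 ≤ x) (hy : 0 ≤ y) :
    r * (x ^ (r - 1) * y) ≤ y ^ r + (r - 1) * x ^ r := by
  have hr0 : 0 < r := by linarith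
  have h := Real.geom_mean_le_arith_mean2_weighted (w₁ := (r - 1) / r) (w₂ := 1 / r)
    (p₁ := x ^ r) (p₂ := y ^ r) (by apply div_nonneg <;> linarith) (by positivity) (by positivity)
    (by positivity) (by field_simp; ring)
  rw [← Real.rpow_mul hx, ← Real.rpow_mul hy, mul_div_cancel₀ _ hr0.ne', mul_one_div_cancel hr0.ne',
    Real.rpow_one] at h
  calc _ ≤ r * ((r - 1) / r * x ^ r + 1 / r * y ^ r) := by gcongr
    _ = _ := by field_simp; ring

lemma rpow_sub_mul_rpow_le {r p x y : ℝ} (hp : 0 ≤ p) (hpr : p ≤ r) (hx : 0 ≤ x) (hy : 0 ≤ y) :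
    x ^ (r - p) * y ^ p ≤ x ^ r + y ^ r := by
  have hr : 0 ≤ r := hp.trans hpr
  have hM : 0 ≤ max x y := le_max_of_le_left hx
  calc x ^ (r - p) * y ^ p ≤ max x y ^ (r - p) * max x y ^ p := by
        gcongr
        · exact le_max_left ..
        · exact le_max_right ..
    _ = max x y ^ r := by
        rw [← Real.rpow_add_of_nonneg hM (by linarith) hp]; simp
    _ ≤ x ^ r + y ^ r := by
        have := Real.rpow_nonneg hx r
        have := Real.rpow_nonneg hy r
        rcases max_choice x y with h | h <;> rw [h] <;> linarith

lemma rpow_sub_one_mul_le {r x y : ℝ} (hr : 1 ≤ r) (hx : 0 ≤ x) (hy : 0 ≤ y) :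
    x ^ (r - 1) * y ≤ x ^ r + y ^ r := by
  simpa using rpow_sub_mul_rpow_le zero_le_one hr hx hy

lemma rpow_sub_two_mul_sq_le {r x y : ℝ} (hr : 2 ≤ r) (hx : 0 ≤ x) (hy : 0 ≤ y) :
    x ^ (r - 2) * y ^ 2 ≤ x ^ r + y ^ r := by
  simpa using rpow_sub_mul_rpow_le zero_le_two hr hx hy

lemma rpow_sub_one_mul_self {r x : ℝ} (hr : 1 ≤ r) (hx : 0 ≤ x) : x ^ (r - 1) * x = x ^ r := by
  conv_lhs => rw [← Real.rpow_one x, ← Real.rpow_mul hx, one_mul]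
  rw [← Real.rpow_add_of_nonneg hx (by linarith) zero_le_one, sub_add_cancel]

lemma rpow_sub_two_mul_sq {r x : ℝ} (hr : 2 ≤ r) (hx : 0 ≤ x) : x ^ (r - 2) * x ^ 2 = x ^ r := by
  rw [← Real.rpow_two, ← Real.rpow_add_of_nonneg hx (by linarith) zero_le_two, sub_add_cancel]

lemma add_rpow_le_two_rpow_mul {p x y : ℝ} (hp : 0 ≤ p) (hx : 0 ≤ x) (hy : 0 ≤ y) :
    (x + y) ^ p ≤ 2 ^ p * (x ^ p + y ^ p) := by
  calc (x + y) ^ p ≤ (2 * max x y) ^ p := by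
        gcongr
        linarith [le_max_left x y, le_max_right x y]
    _ = 2 ^ p * max x y ^ p := Real.mul_rpow zero_le_two (le_max_of_le_left hx)
    _ ≤ _ := by
        have := Real.rpow_nonneg hx p
        have := Real.rpow_nonneg hy p
        gcongr
        rcases max_choice x y with h | h <;> rw [h] <;> linarith

lemma add_add_rpow_le_three_rpow_mul {p x y z : ℝ} (hp : 0 ≤ p) (hx : 0 ≤ x) (hy : 0 ≤ y)
    (hz : 0 ≤ z) : (x + y + z) ^ p ≤ 3 ^ p * (x ^ p + y ^ p + z ^ p) := by
  have hM : 0 ≤ max (max x y) z := le_max_of_le_right hz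
  calc (x + y + z) ^ p ≤ (3 * max (max x y) z) ^ p := by
        gcongr
        linarith [le_max_left x y, le_max_right x y, le_max_left (max x y) z,
          le_max_right (max x y) z]
    _ = 3 ^ p * max (max x y) z ^ p := Real.mul_rpow (by norm_num) hM
    _ ≤ _ := by
        have := Real.rpow_nonneg hx p
        have := Real.rpow_nonneg hy p
        have := Real.rpow_nonneg hz p
        gcongr
        rcases max_choice (max x y) z with h | h <;> rw [h]
        · rcases max_choice x y with h' | h' <;> rw [h'] <;> linarith
        · linarith

/-- Convexity of `t ↦ t ^ (r / 2)`: the graph lies above its tangent at `x ^ 2`, evaluated at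
`y ^ 2`. -/
lemma rpow_sub_rpow_le_tangent {r x y : ℝ} (hr : 2 ≤ r) (hx : 0 ≤ x) (hy : 0 ≤ y) :
    x ^ r - y ^ r ≤ r / 2 * (x ^ (r - 2) * (x ^ 2 - y ^ 2)) := by
  have hr0 : 0 < r := by linarith
  have h := Real.geom_mean_le_arith_mean2_weighted (w₁ := (r - 2) / r) (w₂ := 2 / r)
    (p₁ := x ^ r) (p₂ := y ^ r) (by apply div_nonneg <;> linarith) (by positivity) (by positivity)
    (by positivity) (by field_simp; ring)
  rw [← Real.rpow_mul hx, ← Real.rpow_mul hy, mul_div_cancel₀ _ hr0.ne', mul_div_cancel₀ _ hr0.ne',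
    Real.rpow_two] at h
  have h2 : r / 2 * (x ^ (r - 2) * y ^ 2) ≤ r / 2 * ((r - 2) / r * x ^ r + 2 / r * y ^ r) := by
    gcongr
  have h3 : r / 2 * ((r - 2) / r * x ^ r + 2 / r * y ^ r) = (r / 2 - 1) * x ^ r + y ^ r := by
    field_simp
  have h4 := rpow_sub_two_mul_sq hr hx
  nlinarith

/-- Second-order expansion of the power `‖·‖ ^ r`, `r ≥ 2`, in an inner product space. -/
lemma exists_norm_add_rpow_le {r : ℝ} (hr : 2 ≤ r) : ∃ C : ℝ, 0 < C ∧
    ∀ {E : Type} [NormedAddCommGroup E] [InnerProductSpace ℝ E] (x y : E),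
      ‖x + y‖ ^ r ≤ ‖x‖ ^ r + r * (‖x‖ ^ (r - 2) * inner ℝ x y)
        + C * (‖x‖ ^ (r - 2) * ‖y‖ ^ 2 + ‖y‖ ^ r) := by
  have hp : 0 ≤ r - 2 := by linarith
  refine ⟨r / 2 * (1 + 2 * (1 + (r - 2)) * 2 ^ (r - 2)), ?_, fun {E} _ _ x y => ?_⟩
  · have : 0 < r := by linarith
    positivity
  set p := r - 2 with hpdef
  set A := ‖x + y‖
  set B := ‖x‖
  have hA : 0 ≤ A := norm_nonneg _
  have hB : 0 ≤ B := norm_nonneg _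
  have hy : 0 ≤ ‖y‖ := norm_nonneg _
  have hAB : A ^ 2 - B ^ 2 = 2 * inner ℝ x y + ‖y‖ ^ 2 := by
    have := norm_add_sq_real x y
    simp only [A, B]; linarith
  have habs : |A - B| ≤ ‖y‖ := by
    simpa [A, B] using abs_norm_sub_norm_le (x + y) x
  have hM : max A B ≤ B + ‖y‖ := by
    apply max_le
    · exact norm_add_le _ _
    · linarith
  have hMp : max A B ^ p ≤ 2 ^ p * (B ^ p + ‖y‖ ^ p) :=
    (Real.rpow_le_rpow (le_max_of_le_left hA) hM hp).trans (add_rpow_le_two_rpow_mul hp hB hy)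
  have hdiff : (A ^ p - B ^ p) * (A ^ 2 - B ^ 2) ≤ 2 * (1 + p) * max A B ^ p * ‖y‖ ^ 2 := by
    have hsq : (A - B) ^ 2 ≤ ‖y‖ ^ 2 := by
      rw [← sq_abs]; gcongr
    have hn : 0 ≤ max A B ^ p := Real.rpow_nonneg (le_max_of_le_left hA) _
    have : (A ^ p - B ^ p) * (A ^ 2 - B ^ 2) ≤ 2 * (1 + p) * max A B ^ p * (A - B) ^ 2 := by
      rcases le_total A B with h | h
      · rw [max_eq_right h]
        have h1 := rpow_sub_rpow_mul_le hp hA h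
        have h2 : 0 ≤ B ^ p - A ^ p := sub_nonneg.2 (Real.rpow_le_rpow hA h hp)
        calc (A ^ p - B ^ p) * (A ^ 2 - B ^ 2) = (B ^ p - A ^ p) * (B - A) * (B + A) := by ring
          _ ≤ (B ^ p - A ^ p) * (B - A) * (2 * B) := by
              have := mul_nonneg h2 (sub_nonneg.2 h)
              gcongr; linarith
          _ = 2 * (B - A) * ((B ^ p - A ^ p) * B) := by ring
          _ ≤ 2 * (B - A) * ((1 + p) * B ^ p * (B - A)) := by
              have := sub_nonneg.2 h
              gcongr
          _ = _ := by ring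
      · rw [max_eq_left h]
        have h1 := rpow_sub_rpow_mul_le hp hB h
        have h2 : 0 ≤ A ^ p - B ^ p := sub_nonneg.2 (Real.rpow_le_rpow hB h hp)
        calc (A ^ p - B ^ p) * (A ^ 2 - B ^ 2) = (A ^ p - B ^ p) * (A - B) * (A + B) := by ring
          _ ≤ (A ^ p - B ^ p) * (A - B) * (2 * A) := by
              have := mul_nonneg h2 (sub_nonneg.2 h)
              gcongr; linarith
          _ = 2 * (A - B) * ((A ^ p - B ^ p) * A) := by ring
          _ ≤ 2 * (A - B) * ((1 + p) * A ^ p * (A - B)) := by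
              have := sub_nonneg.2 h
              gcongr
          _ = _ := by ring
    refine this.trans ?_
    gcongr
  have hmain := rpow_sub_rpow_le_tangent hr hA hB
  rw [← hpdef] at hmain
  have hyr : ‖y‖ ^ p * ‖y‖ ^ 2 = ‖y‖ ^ r := rpow_sub_two_mul_sq hr hy
  have hyr0 : 0 ≤ ‖y‖ ^ r := by positivity
  have hr0 : 0 ≤ r / 2 := by linarith
  calc A ^ r ≤ B ^ r + r / 2 * (A ^ p * (A ^ 2 - B ^ 2)) := by linarith
    _ = B ^ r + r / 2 * (B ^ p * (A ^ 2 - B ^ 2)) +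
        r / 2 * ((A ^ p - B ^ p) * (A ^ 2 - B ^ 2)) := by ring
    _ ≤ B ^ r + r / 2 * (B ^ p * (2 * inner ℝ x y + ‖y‖ ^ 2)) +
        r / 2 * (2 * (1 + p) * (2 ^ p * (B ^ p + ‖y‖ ^ p)) * ‖y‖ ^ 2) := by
        refine add_le_add (by rw [hAB]) (mul_le_mul_of_nonneg_left (hdiff.trans ?_) hr0)
        gcongr
    _ = B ^ r + r * (B ^ p * inner ℝ x y) + r / 2 * (B ^ p * ‖y‖ ^ 2) +
        r / 2 * (2 * (1 + p) * 2 ^ p) * (B ^ p * ‖y‖ ^ 2 + ‖y‖ ^ p * ‖y‖ ^ 2) := by ring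
    _ ≤ B ^ r + r * (B ^ p * inner ℝ x y) + r / 2 * (B ^ p * ‖y‖ ^ 2 + ‖y‖ ^ r) +
        r / 2 * (2 * (1 + p) * 2 ^ p) * (B ^ p * ‖y‖ ^ 2 + ‖y‖ ^ r) := by
        rw [hyr]
        gcongr
        linarith
    _ = _ := by ring

/-- The pathwise form of Doob's `L^r` maximal inequality: the last sum is a discrete stochastic
integral, which has nonnegative expectation when `s` is a submartingale. -/
lemma partialSups_rpow_add_sum_le {r : ℝ} (hr : 1 ≤ r) {s : ℕ → ℝ} (hs : ∀ k, 0 ≤ s k) (N : ℕ) :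
    (r - 1) * partialSups s N ^ r
      + r * ∑ i ∈ Finset.range N, partialSups s i ^ (r - 1) * (s (i + 1) - s i)
      ≤ r * (partialSups s N ^ (r - 1) * s N) := by
  have hnn : ∀ k, 0 ≤ partialSups s k := fun k => (hs k).trans (le_partialSups s k)
  induction N with
  | zero =>
    have h := rpow_sub_one_mul_self hr (hs 0)
    have h' := Real.rpow_nonneg (hs 0) r
    simp only [partialSups_zero, Finset.range_zero, Finset.sum_empty]
    nlinarith
  | succ N ih =>
    rw [Finset.sum_range_succ]
    rcases le_total (s (N + 1)) (partialSups s N) with h | h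
    · have heq : partialSups s (N + 1) = partialSups s N := by
        rw [partialSups_add_one, sup_eq_left.2 h]
      rw [heq]
      linarith
    · have heq : partialSups s (N + 1) = s (N + 1) := by
        rw [partialSups_add_one, sup_eq_right.2 h]
      rw [heq]
      have hy := mul_rpow_sub_one_mul_le hr (hnn N) (hs (N + 1))
      have h' := rpow_sub_one_mul_self hr (hs (N + 1))
      nlinarith

/-- The pathwise Doob inequality with the right-hand side reduced to the `r`-th power of the last
value, at the cost of half of the left-hand side. -/
lemma exists_partialSups_rpow_le {r : ℝ} (hr : 2 ≤ r) : ∃ C : ℝ, 0 < C ∧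
    ∀ s : ℕ → ℝ, (∀ k, 0 ≤ s k) → ∀ N,
      partialSups s N ^ r
        + r * ∑ i ∈ Finset.range N, partialSups s i ^ (r - 1) * (s (i + 1) - s i)
        ≤ C * s N ^ r + partialSups s N ^ r / 2 := by
  have hr0 : 0 < r := by linarith
  have hr1 : 1 ≤ r := by linarith
  refine ⟨4 ^ (r - 1) * r, by positivity, fun s hs N => ?_⟩
  have h := partialSups_rpow_add_sum_le hr1 hs N
  have hM : 0 ≤ partialSups s N := (hs N).trans (le_partialSups s N)
  have hMr := Real.rpow_nonneg hM r
  have hsr := Real.rpow_nonneg (hs N) r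
  have hsN := hs N
  -- Either `s N` is so small that the product is absorbed, or it is comparable to the maximum.
  rcases le_total (4 * s N) (partialSups s N) with h4 | h4
  · have h1 : partialSups s N ^ (r - 1) * s N ≤ partialSups s N ^ r / 4 := by
      calc _ ≤ partialSups s N ^ (r - 1) * (partialSups s N / 4) := by gcongr; linarith
        _ = _ := by rw [← rpow_sub_one_mul_self hr1 hM]; ring
    have h2 : 0 ≤ 4 ^ (r - 1) * r * s N ^ r := by positivity
    nlinarith
  · have h1 : partialSups s N ^ (r - 1) * s N ≤ 4 ^ (r - 1) * s N ^ r := by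
      calc _ ≤ (4 * s N) ^ (r - 1) * s N := by gcongr
        _ = _ := by
          rw [Real.mul_rpow (by norm_num) hsN, mul_assoc, rpow_sub_one_mul_self hr1 hsN]
    nlinarith

/-- Discrete Gronwall inequality in summed form. -/
lemma le_mul_one_add_pow_of_le_sum {n : ℕ} {A L : ℝ} (hL : 0 ≤ L) {g : ℕ → ℝ}
    (h : ∀ k ≤ n, g k ≤ A + L * ∑ i ∈ Finset.range k, g i) :
    ∀ k ≤ n, g k ≤ A * (1 + L) ^ k := by
  have geom : ∀ k, A + L * ∑ i ∈ Finset.range k, A * (1 + L) ^ i = A * (1 + L) ^ k := by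
    intro k
    induction k with
    | zero => simp
    | succ k ih => rw [Finset.sum_range_succ, mul_add, ← add_assoc, ih]; ring
  intro k
  induction k using Nat.strong_induction_on with
  | _ k ih =>
    intro hk
    refine (h k hk).trans ?_
    rw [← geom k]
    gcongr with i hi
    have := Finset.mem_range.1 hi
    exact ih i this (by omega)

lemma one_add_div_pow_le_exp {L : ℝ} (hL : 0 ≤ L) {n k : ℕ} (hn : 1 ≤ n) (hk : k ≤ n) :
    (1 + L / n) ^ k ≤ Real.exp L := by
  have hn' : (0 : ℝ) < n := by exact_mod_cast hn
  calc (1 + L / n) ^ k ≤ (1 + L / n) ^ n := by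
        gcongr
        linarith [div_nonneg hL hn'.le]
    _ ≤ Real.exp (L / n) ^ n := by
        gcongr
        rw [add_comm]; exact Real.add_one_le_exp _
    _ = Real.exp L := by rw [← Real.exp_nat_mul]; congr 1; field_simp

/-! ### Matrices acting on vectors -/

section MatVec

variable {d m : ℕ}

lemma norm_matVec_le (A : Mat d m) (v : Vec m) : ‖matVec A v‖ ≤ ‖A‖ * ‖v‖ := by
  have h := Matrix.frobenius_norm_mul A (Matrix.replicateCol Unit (WithLp.ofLp v))
  rw [← Matrix.replicateCol_mulVec, Matrix.frobenius_norm_replicateCol,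
    Matrix.frobenius_norm_replicateCol] at h
  exact h

lemma inner_matVec (A : Mat d m) (w : Vec d) (v : Vec m) :
    inner ℝ w (matVec A v) = inner ℝ (matVec Aᵀ w) v := by
  simp only [matVec, EuclideanSpace.inner_eq_star_dotProduct, star_trivial]
  rw [Matrix.mulVec_transpose, dotProduct_comm, Matrix.dotProduct_mulVec, dotProduct_comm]

lemma matVec_add (A : Mat d m) (v w : Vec m) : matVec A (v + w) = matVec A v + matVec A w := by
  ext i; simp [matVec, Matrix.mulVec_add]

lemma matVec_smul (A : Mat d m) (c : ℝ) (v : Vec m) : matVec A (c • v) = c • matVec A v := by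
  ext i; simp [matVec, Matrix.mulVec_smul]

lemma sub_matVec (A B : Mat d m) (v : Vec m) : matVec (A - B) v = matVec A v - matVec B v := by
  ext i; simp [matVec, Matrix.sub_mulVec]

lemma add_matVec (A B : Mat d m) (v : Vec m) : matVec (A + B) v = matVec A v + matVec B v := by
  ext i; simp [matVec, Matrix.add_mulVec]

lemma smul_matVec (c : ℝ) (A : Mat d m) (v : Vec m) : matVec (c • A) v = c • matVec A v := by
  ext i; simp [matVec, Matrix.smul_mulVec]

lemma matVec_mul {k : ℕ} (A : Mat d m) (B : Mat m k) (v : Vec k) :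
    matVec (A * B) v = matVec A (matVec B v) := by
  ext i; simp [matVec, Matrix.mulVec_mulVec]

lemma frobenius_norm_sq (A : Mat d m) : ‖A‖ ^ 2 = ∑ i, ∑ j, A i j ^ 2 := by
  rw [Matrix.frobenius_norm_def, ← Real.sqrt_eq_rpow, Real.sq_sqrt (by positivity)]
  simp

lemma abs_entry_le_norm (A : Mat d m) (i : Fin d) (j : Fin m) : |A i j| ≤ ‖A‖ := by
  refine abs_le_of_sq_le_sq ?_ (norm_nonneg _)
  rw [frobenius_norm_sq]
  refine (Finset.single_le_sum (f := fun j => A i j ^ 2) (fun _ _ => sq_nonneg _)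
    (Finset.mem_univ j)).trans ?_
  exact Finset.single_le_sum (f := fun i => ∑ j, A i j ^ 2)
    (fun _ _ => Finset.sum_nonneg fun _ _ => sq_nonneg _) (Finset.mem_univ i)

/-- Measurability of a random matrix, expressed through its entries: the type of matrices carries
no `MeasurableSpace` instance. -/
def EntryMeasurable {Ω : Type u} (𝒢 : MeasurableSpace Ω) (B : Ω → Mat d m) : Prop :=
  ∀ i j, Measurable[𝒢] fun ω => B ω i j

variable {Ω : Type u} {𝒢 : MeasurableSpace Ω}

lemma EntryMeasurable.mono {𝒢' : MeasurableSpace Ω} {B : Ω → Mat d m} (h : EntryMeasurable 𝒢 B)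
    (hle : 𝒢 ≤ 𝒢') : EntryMeasurable 𝒢' B := fun i j => (h i j).mono hle le_rfl

lemma EntryMeasurable.norm {B : Ω → Mat d m} (h : EntryMeasurable 𝒢 B) :
    Measurable[𝒢] fun ω => ‖B ω‖ := by
  have heq : (fun ω => ‖B ω‖) = fun ω => √(∑ i, ∑ j, B ω i j ^ 2) := by
    ext ω
    rw [← frobenius_norm_sq, Real.sqrt_sq (norm_nonneg _)]
  rw [heq]
  have := fun i j => h i j
  fun_prop

lemma EntryMeasurable.matVec {B : Ω → Mat d m} (h : EntryMeasurable 𝒢 B) {v : Ω → Vec m}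
    (hv : Measurable[𝒢] v) : Measurable[𝒢] fun ω => matVec (B ω) (v ω) := by
  have := fun i j => h i j
  refine (WithLp.measurable_toLp 2 _).comp (measurable_pi_lambda _ fun i => ?_)
  simp only [Matrix.mulVec, dotProduct]
  fun_prop

lemma EntryMeasurable.transpose {B : Ω → Mat d m} (h : EntryMeasurable 𝒢 B) :
    EntryMeasurable 𝒢 fun ω => (B ω)ᵀ := fun i j => h j i

/- The following restate Mathlib's measurability rules with the `σ`-algebra as a variable: when a
space carries several `σ`-algebras, instance resolution picks the ambient one. -/

lemma measurable_add_vec {f g : Ω → Vec d} (hf : Measurable[𝒢] f)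
    (hg : Measurable[𝒢] g) : Measurable[𝒢] fun ω => f ω + g ω := hf.add hg

lemma measurable_sub_vec {f g : Ω → Vec d} (hf : Measurable[𝒢] f)
    (hg : Measurable[𝒢] g) : Measurable[𝒢] fun ω => f ω - g ω := hf.sub hg

lemma measurable_const_smul_vec (c : ℝ) {f : Ω → Vec d}
    (hf : Measurable[𝒢] f) : Measurable[𝒢] fun ω => c • f ω := hf.const_smul c

lemma measurable_smul_vec {f : Ω → ℝ} (hf : Measurable[𝒢] f) {w : Ω → Vec d}
    (hw : Measurable[𝒢] w) : Measurable[𝒢] fun ω => f ω • w ω := hf.smul hw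

lemma measurable_norm_vec {w : Ω → Vec d} (hw : Measurable[𝒢] w) :
    Measurable[𝒢] fun ω => ‖w ω‖ := hw.norm

end MatVec

/-! ### Martingale transforms -/

section Martingale

variable {d m : ℕ} {Ω : Type u}

/-- `Δ` is a centred random vector independent of `𝒢`, with a finite `r`-th moment. -/
structure IsCentredIncrement (𝒢 : MeasurableSpace Ω) {mΩ : MeasurableSpace Ω} (P : Measure Ω)
    (r : ℝ) (Δ : Ω → Vec m) : Prop where
  measurable : Measurable Δ
  indep : Indep (MeasurableSpace.comap Δ inferInstance) 𝒢 P
  integrable_rpow : Integrable (fun ω => ‖Δ ω‖ ^ r) P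
  mean_zero : ∫ ω, Δ ω ∂P = 0

variable {𝒢 : MeasurableSpace Ω} {mΩ : MeasurableSpace Ω} {P : Measure Ω} [IsProbabilityMeasure P]

lemma integrable_rpow_of_le {r q : ℝ} (hq : 0 ≤ q) (hqr : q ≤ r) {f : Ω → ℝ} (hf0 : ∀ ω, 0 ≤ f ω)
    (hf : Measurable f) (hfr : Integrable (fun ω => f ω ^ r) P) :
    Integrable (fun ω => f ω ^ q) P := by
  refine Integrable.mono' ((integrable_const (1 : ℝ)).add hfr) (by fun_prop) (ae_of_all _ fun ω => ?_)
  have h0 := hf0 ω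
  rw [Real.norm_of_nonneg (by positivity)]
  simpa using rpow_sub_mul_rpow_le (x := 1) hq hqr zero_le_one h0

section OneStep

variable {r : ℝ} {Δ : Ω → Vec m}

lemma IsCentredIncrement.integrable (h : IsCentredIncrement 𝒢 P r Δ) (hr : 2 ≤ r) :
    Integrable Δ P := by
  rw [← integrable_norm_iff h.measurable.aestronglyMeasurable]
  simpa using integrable_rpow_of_le zero_le_one (by linarith) (fun ω => norm_nonneg (Δ ω))
    h.measurable.norm h.integrable_rpow

lemma IsCentredIncrement.integrable_sq (h : IsCentredIncrement 𝒢 P r Δ) (hr : 2 ≤ r) :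
    Integrable (fun ω => ‖Δ ω‖ ^ 2) P := by
  simpa using integrable_rpow_of_le zero_le_two hr (fun ω => norm_nonneg (Δ ω))
    h.measurable.norm h.integrable_rpow

omit [IsProbabilityMeasure P] in
lemma indepFun_comp {β γ : Type*} [MeasurableSpace β] [MeasurableSpace γ]
    (hind : Indep (MeasurableSpace.comap Δ inferInstance) 𝒢 P) {f : Ω → β} (hf : Measurable[𝒢] f)
    {φ : Vec m → γ} (hφ : Measurable φ) : IndepFun f (fun ω => φ (Δ ω)) P := by
  have h1 : IndepFun f Δ P := by
    rw [IndepFun_iff_Indep]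
    exact indep_of_indep_of_le_left hind.symm hf.comap_le
  exact h1.comp measurable_id hφ

/-- A martingale increment integrates to zero against past quantities. -/
lemma IsCentredIncrement.integral_inner (h : IsCentredIncrement 𝒢 P r Δ) (hr : 2 ≤ r)
    (h𝒢 : 𝒢 ≤ mΩ) {w : Ω → Vec d} (hw : Measurable[𝒢] w) {B : Ω → Mat d m}
    (hB : EntryMeasurable 𝒢 B) (hint : Integrable (fun ω => ‖w ω‖ * ‖B ω‖) P) :
    Integrable (fun ω => inner ℝ (w ω) (matVec (B ω) (Δ ω))) P ∧
      ∫ ω, inner ℝ (w ω) (matVec (B ω) (Δ ω)) ∂P = 0 := by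
  have hH : Measurable[𝒢] fun ω => matVec (B ω)ᵀ (w ω) := hB.transpose.matVec hw
  have hHint : Integrable (fun ω => matVec (B ω)ᵀ (w ω)) P := by
    refine hint.mono' (hH.mono h𝒢 le_rfl).aestronglyMeasurable (ae_of_all _ fun ω => ?_)
    refine (norm_matVec_le _ _).trans ?_
    rw [Matrix.frobenius_norm_transpose, mul_comm]
  have hI := indepFun_comp h.indep hH measurable_id
  simp only [inner_matVec]
  refine ⟨?_, ?_⟩
  · exact hI.integrable_bilin hHint (h.integrable hr) (innerSL ℝ)
  · have := hI.integral_bilin hHint (h.integrable hr) (innerSL ℝ)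
    refine this.trans ?_
    simp only [id]
    rw [h.mean_zero, map_zero]

omit [IsProbabilityMeasure P] in
lemma integral_mul_comp (hind : Indep (MeasurableSpace.comap Δ inferInstance) 𝒢 P) {f : Ω → ℝ}
    (hf : Measurable[𝒢] f) (hfi : Integrable f P) {φ : Vec m → ℝ} (hφ : Measurable φ)
    (hφi : Integrable (fun ω => φ (Δ ω)) P) :
    Integrable (fun ω => f ω * φ (Δ ω)) P ∧
      ∫ ω, f ω * φ (Δ ω) ∂P = (∫ ω, f ω ∂P) * ∫ ω, φ (Δ ω) ∂P := by
  have hI := indepFun_comp hind hf hφ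
  exact ⟨hI.integrable_mul hfi hφi,
    hI.integral_fun_mul_eq_mul_integral hfi.aestronglyMeasurable hφi.aestronglyMeasurable⟩

/-- One step of the `r`-th moment recursion of a martingale transform: the term of first order in
`Δ` of the expansion of `‖S + B Δ‖ ^ r` has expectation zero. -/
lemma exists_integral_norm_add_matVec_rpow_le (hr : 2 ≤ r) : ∃ C : ℝ, 0 < C ∧
    ∀ {d m : ℕ} {Ω : Type u} {𝒢 mΩ : MeasurableSpace Ω} {P : Measure Ω}
      [IsProbabilityMeasure P] {Δ : Ω → Vec m} (_ : IsCentredIncrement 𝒢 P r Δ) (_ : 𝒢 ≤ mΩ)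
      {S : Ω → Vec d} (_ : Measurable[𝒢] S) (_ : Integrable (fun ω => ‖S ω‖ ^ r) P)
      {B : Ω → Mat d m} (_ : EntryMeasurable 𝒢 B) (_ : Integrable (fun ω => ‖B ω‖ ^ r) P),
      Integrable (fun ω => ‖S ω + matVec (B ω) (Δ ω)‖ ^ r) P ∧
      ∫ ω, ‖S ω + matVec (B ω) (Δ ω)‖ ^ r ∂P ≤ ∫ ω, ‖S ω‖ ^ r ∂P
        + C * ((∫ ω, ‖S ω‖ ^ r ∂P + ∫ ω, ‖B ω‖ ^ r ∂P) * ∫ ω, ‖Δ ω‖ ^ 2 ∂P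
          + (∫ ω, ‖B ω‖ ^ r ∂P) * ∫ ω, ‖Δ ω‖ ^ r ∂P) := by
  obtain ⟨C, hC, hexp⟩ := exists_norm_add_rpow_le hr
  refine ⟨C, hC, fun {d m Ω 𝒢 mΩ P _ Δ} h h𝒢 {S} hS hSr {B} hB hBr => ?_⟩
  have hr0 : 0 ≤ r := by linarith
  have hr1 : 1 ≤ r := by linarith
  have hSn : Measurable[𝒢] fun ω => ‖S ω‖ := measurable_norm_vec hS
  have hBn := hB.norm
  obtain ⟨hi1, hv1⟩ := h.integral_inner hr h𝒢 (w := fun ω => ‖S ω‖ ^ (r - 2) • S ω)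
    (measurable_smul_vec (hSn.pow_const _) hS) hB (by
      refine Integrable.mono' (hSr.add hBr) ?_ (ae_of_all _ fun ω => ?_)
      · refine Measurable.aestronglyMeasurable ?_
        have h1 := hSn.mono h𝒢 le_rfl
        have h2 := hBn.mono h𝒢 le_rfl
        have h3 := hS.mono h𝒢 le_rfl
        fun_prop
      · rw [Real.norm_of_nonneg (by positivity), norm_smul, Real.norm_of_nonneg (by positivity)]
        have : ‖S ω‖ ^ (r - 2) * ‖S ω‖ = ‖S ω‖ ^ (r - 1) := by
          have h2 := Real.rpow_add_of_nonneg (norm_nonneg (S ω)) (by linarith : 0 ≤ r - 2)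
            zero_le_one
          rw [Real.rpow_one] at h2
          rw [← h2]; congr 1; ring
        rw [this]
        exact rpow_sub_one_mul_le hr1 (norm_nonneg _) (norm_nonneg _))
  have hSB : Measurable[𝒢] fun ω => ‖S ω‖ ^ (r - 2) * ‖B ω‖ ^ 2 :=
    (hSn.pow_const _).mul (hBn.pow_const 2)
  have hSBi : Integrable (fun ω => ‖S ω‖ ^ (r - 2) * ‖B ω‖ ^ 2) P := by
    refine Integrable.mono' (hSr.add hBr) (hSB.mono h𝒢 le_rfl).aestronglyMeasurable
      (ae_of_all _ fun ω => ?_)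
    rw [Real.norm_of_nonneg (by positivity)]
    exact rpow_sub_two_mul_sq_le hr (norm_nonneg _) (norm_nonneg _)
  obtain ⟨hi2, hv2⟩ := integral_mul_comp h.indep hSB hSBi (φ := fun x => ‖x‖ ^ 2) (by fun_prop)
    (h.integrable_sq hr)
  obtain ⟨hi3, hv3⟩ := integral_mul_comp h.indep (hBn.pow_const r) hBr (φ := fun x => ‖x‖ ^ r)
    (by fun_prop) h.integrable_rpow
  have hbound : ∀ ω, ‖S ω + matVec (B ω) (Δ ω)‖ ^ r ≤ ‖S ω‖ ^ r
      + r * inner ℝ (‖S ω‖ ^ (r - 2) • S ω) (matVec (B ω) (Δ ω))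
      + C * (‖S ω‖ ^ (r - 2) * ‖B ω‖ ^ 2 * ‖Δ ω‖ ^ 2 + ‖B ω‖ ^ r * ‖Δ ω‖ ^ r) := by
    intro ω
    refine (hexp (S ω) (matVec (B ω) (Δ ω))).trans ?_
    rw [real_inner_smul_left]
    have h1 := norm_matVec_le (B ω) (Δ ω)
    have h2 : ‖matVec (B ω) (Δ ω)‖ ^ 2 ≤ ‖B ω‖ ^ 2 * ‖Δ ω‖ ^ 2 := by
      rw [← mul_pow]; gcongr
    have h3 : ‖matVec (B ω) (Δ ω)‖ ^ r ≤ ‖B ω‖ ^ r * ‖Δ ω‖ ^ r := by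
      rw [← Real.mul_rpow (norm_nonneg _) (norm_nonneg _)]; gcongr
    rw [mul_assoc (‖S ω‖ ^ (r - 2))]
    gcongr
  have hrhs : Integrable (fun ω => ‖S ω‖ ^ r
      + r * inner ℝ (‖S ω‖ ^ (r - 2) • S ω) (matVec (B ω) (Δ ω))
      + C * (‖S ω‖ ^ (r - 2) * ‖B ω‖ ^ 2 * ‖Δ ω‖ ^ 2 + ‖B ω‖ ^ r * ‖Δ ω‖ ^ r)) P :=
    (hSr.add (hi1.const_mul r)).add ((hi2.add hi3).const_mul C)
  have hlhs : Integrable (fun ω => ‖S ω + matVec (B ω) (Δ ω)‖ ^ r) P := by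
    refine hrhs.mono' ?_ (ae_of_all _ fun ω => ?_)
    · have h1 := (hB.mono h𝒢).matVec h.measurable
      have h2 := hS.mono h𝒢 le_rfl
      exact (by fun_prop : Measurable fun ω => ‖S ω + matVec (B ω) (Δ ω)‖ ^ r).aestronglyMeasurable
    · rw [Real.norm_of_nonneg (by positivity)]
      exact hbound ω
  refine ⟨hlhs, (integral_mono hlhs hrhs hbound).trans ?_⟩
  have hi4 := hi1.const_mul r
  have hi5 : Integrable (fun ω => C * (‖S ω‖ ^ (r - 2) * ‖B ω‖ ^ 2 * ‖Δ ω‖ ^ 2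
      + ‖B ω‖ ^ r * ‖Δ ω‖ ^ r)) P := (hi2.add hi3).const_mul C
  have hi6 : Integrable (fun ω => ‖S ω‖ ^ r
      + r * inner ℝ (‖S ω‖ ^ (r - 2) • S ω) (matVec (B ω) (Δ ω))) P := hSr.add hi4
  rw [integral_add hi6 hi5,
    integral_add hSr hi4, integral_const_mul, integral_const_mul, hv1,
    integral_add hi2 hi3, hv2, hv3, mul_zero, add_zero]
  have hle : ∫ ω, ‖S ω‖ ^ (r - 2) * ‖B ω‖ ^ 2 ∂P ≤ ∫ ω, ‖S ω‖ ^ r ∂P + ∫ ω, ‖B ω‖ ^ r ∂P := by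
    rw [← integral_add hSr hBr]
    exact integral_mono hSBi (hSr.add hBr)
      fun ω => rpow_sub_two_mul_sq_le hr (norm_nonneg _) (norm_nonneg _)
  have : 0 ≤ ∫ ω, ‖Δ ω‖ ^ 2 ∂P := integral_nonneg fun ω => by positivity
  gcongr

/-- The norm of a martingale is a submartingale, tested against a past weight `M ^ (r - 1)`. -/
lemma IsCentredIncrement.integral_weight_mul_sub_nonneg (h : IsCentredIncrement 𝒢 P r Δ)
    (hr : 2 ≤ r) (h𝒢 : 𝒢 ≤ mΩ) {S : Ω → Vec d} (hS : Measurable[𝒢] S)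
    (hSr : Integrable (fun ω => ‖S ω‖ ^ r) P) {B : Ω → Mat d m} (hB : EntryMeasurable 𝒢 B)
    (hBr : Integrable (fun ω => ‖B ω‖ ^ r) P)
    (hSBr : Integrable (fun ω => ‖S ω + matVec (B ω) (Δ ω)‖ ^ r) P)
    {M : Ω → ℝ} (hM : Measurable[𝒢] M) (hM0 : ∀ ω, 0 ≤ M ω)
    (hMr : Integrable (fun ω => M ω ^ r) P) :
    Integrable (fun ω => M ω ^ (r - 1) * (‖S ω + matVec (B ω) (Δ ω)‖ - ‖S ω‖)) P ∧
      0 ≤ ∫ ω, M ω ^ (r - 1) * (‖S ω + matVec (B ω) (Δ ω)‖ - ‖S ω‖) ∂P := by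
  have hr1 : 1 ≤ r := by linarith
  have hSn : Measurable[𝒢] fun ω => ‖S ω‖ := measurable_norm_vec hS
  have hBn := hB.norm
  have mM := hM.mono h𝒢 le_rfl
  have mS := hS.mono h𝒢 le_rfl
  have mBΔ := (hB.mono h𝒢).matVec h.measurable
  have mBn := hBn.mono h𝒢 le_rfl
  have hMpos : ∀ ω, 0 ≤ M ω ^ (r - 1) := fun ω => Real.rpow_nonneg (hM0 ω) _
  have hint : Integrable (fun ω => M ω ^ (r - 1) * (‖S ω + matVec (B ω) (Δ ω)‖ - ‖S ω‖)) P := by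
    refine Integrable.mono' ((hMr.add hSBr).add (hMr.add hSr))
      (by fun_prop : Measurable fun ω =>
        M ω ^ (r - 1) * (‖S ω + matVec (B ω) (Δ ω)‖ - ‖S ω‖)).aestronglyMeasurable
      (ae_of_all _ fun ω => ?_)
    have h1 := rpow_sub_one_mul_le hr1 (hM0 ω) (norm_nonneg (S ω + matVec (B ω) (Δ ω)))
    have h2 := rpow_sub_one_mul_le hr1 (hM0 ω) (norm_nonneg (S ω))
    have h3 := mul_nonneg (hMpos ω) (norm_nonneg (S ω + matVec (B ω) (Δ ω)))
    have h4 := mul_nonneg (hMpos ω) (norm_nonneg (S ω))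
    simp only [Pi.add_apply, Real.norm_eq_abs, mul_sub]
    exact abs_le.2 ⟨by linarith, by linarith⟩
  obtain ⟨hi, hv⟩ := h.integral_inner hr h𝒢
    (w := fun ω => M ω ^ (r - 1) • (‖S ω‖⁻¹ • S ω))
    (measurable_smul_vec (hM.pow_const _) (measurable_smul_vec hSn.inv hS)) hB (by
      refine Integrable.mono' (hMr.add hBr) ?_ (ae_of_all _ fun ω => ?_)
      · exact (by fun_prop : Measurable fun ω =>
          ‖M ω ^ (r - 1) • (‖S ω‖⁻¹ • S ω)‖ * ‖B ω‖).aestronglyMeasurable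
      · rw [Real.norm_of_nonneg (by positivity), norm_smul, norm_smul, norm_inv, norm_norm,
          Real.norm_of_nonneg (hMpos ω)]
        have h1 : ‖S ω‖⁻¹ * ‖S ω‖ ≤ 1 := inv_mul_le_one
        have h2 := rpow_sub_one_mul_le hr1 (hM0 ω) (norm_nonneg (B ω))
        refine le_trans ?_ h2
        have := hMpos ω
        gcongr
        exact mul_le_of_le_one_right this h1)
  refine ⟨hint, hv ▸ integral_mono hi hint fun ω => ?_⟩
  simp only [real_inner_smul_left]
  refine mul_le_mul_of_nonneg_left ?_ (hMpos ω)
  rcases (norm_nonneg (S ω)).eq_or_lt with h0 | h0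
  · rw [← h0]; simp
  · have h1 := real_inner_le_norm (S ω) (S ω + matVec (B ω) (Δ ω))
    rw [inner_add_right, real_inner_self_eq_norm_sq] at h1
    rw [inv_mul_le_iff₀ h0]
    nlinarith

end OneStep

end Martingale

section Transform

variable {d m : ℕ} {Ω : Type u}

/-- `Δ₀, …, Δₙ₋₁` are adapted to `𝒢` and centred given the past, and their second and `r`-th moments
are of the order of the step size `1 / n`. -/
structure IsDrivingNoise (𝒢 : ℕ → MeasurableSpace Ω) {mΩ : MeasurableSpace Ω} (P : Measure Ω)
    (n : ℕ) (r v : ℝ) (Δ : ℕ → Ω → Vec m) : Prop where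
  le : ∀ k, 𝒢 k ≤ mΩ
  mono : Monotone 𝒢
  adapted : ∀ k < n, Measurable[𝒢 (k + 1)] (Δ k)
  centred : ∀ k < n, IsCentredIncrement (𝒢 k) P r (Δ k)
  sq_le : ∀ k < n, ∫ ω, ‖Δ k ω‖ ^ 2 ∂P ≤ v / n
  rpow_le : ∀ k < n, ∫ ω, ‖Δ k ω‖ ^ r ∂P ≤ v / n

/-- The martingale transform `∑_{i < k} Bᵢ Δᵢ`. -/
noncomputable def transform (B : ℕ → Ω → Mat d m) (Δ : ℕ → Ω → Vec m) (k : ℕ) (ω : Ω) : Vec d :=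
  ∑ i ∈ Finset.range k, matVec (B i ω) (Δ i ω)

lemma transform_succ (B : ℕ → Ω → Mat d m) (Δ : ℕ → Ω → Vec m) (k : ℕ) (ω : Ω) :
    transform B Δ (k + 1) ω = transform B Δ k ω + matVec (B k ω) (Δ k ω) :=
  Finset.sum_range_succ _ _

variable {𝒢 : ℕ → MeasurableSpace Ω} {mΩ : MeasurableSpace Ω} {P : Measure Ω} {n : ℕ} {r v : ℝ}
  {Δ : ℕ → Ω → Vec m}

lemma IsDrivingNoise.measurable_transform (h : IsDrivingNoise 𝒢 P n r v Δ)
    {B : ℕ → Ω → Mat d m} (hB : ∀ k < n, EntryMeasurable (𝒢 k) (B k)) :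
    ∀ k ≤ n, Measurable[𝒢 k] (transform B Δ k) := by
  intro k
  induction k with
  | zero =>
    intro _
    have : transform B Δ 0 = fun _ => (0 : Vec d) := by ext ω; simp [transform]
    rw [this]
    exact measurable_const
  | succ k ih =>
    intro hk
    have heq : transform B Δ (k + 1) = fun ω => transform B Δ k ω + matVec (B k ω) (Δ k ω) := by
      ext1 ω; exact transform_succ ..
    rw [heq]
    exact measurable_add_vec ((ih (by omega)).mono (h.mono (Nat.le_succ k)) le_rfl)
      (((hB k hk).mono (h.mono (Nat.le_succ k))).matVec (h.adapted k hk))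

/-- The `L^r` bound for a martingale transform, without the maximum. -/
lemma exists_integral_transform_rpow_le (hr : 2 ≤ r) (hv : 0 ≤ v) : ∃ C : ℝ, 0 < C ∧
    ∀ {d m : ℕ} {Ω : Type u} {𝒢 : ℕ → MeasurableSpace Ω} {_mΩ : MeasurableSpace Ω} {P : Measure Ω}
      [IsProbabilityMeasure P] {n : ℕ} {Δ : ℕ → Ω → Vec m} (_ : IsDrivingNoise 𝒢 P n r v Δ)
      {B : ℕ → Ω → Mat d m} (_ : ∀ k < n, EntryMeasurable (𝒢 k) (B k)),
      ∀ k ≤ n, (∀ i < k, Integrable (fun ω => ‖B i ω‖ ^ r) P) →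
        Integrable (fun ω => ‖transform B Δ k ω‖ ^ r) P ∧
        ∫ ω, ‖transform B Δ k ω‖ ^ r ∂P ≤
          C / n * ∑ i ∈ Finset.range k, ∫ ω, ‖B i ω‖ ^ r ∂P := by
  obtain ⟨c, hc, hstep⟩ := exists_integral_norm_add_matVec_rpow_le.{u} hr
  refine ⟨Real.exp (c * v) * (2 * (c * v)) + 1, by positivity,
    fun {d m Ω 𝒢 mΩ P _ n Δ} h {B} hB => ?_⟩
  have hr0 : r ≠ 0 := by linarith
  have main : ∀ k ≤ n, (∀ i < k, Integrable (fun ω => ‖B i ω‖ ^ r) P) →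
        Integrable (fun ω => ‖transform B Δ k ω‖ ^ r) P ∧
        ∫ ω, ‖transform B Δ k ω‖ ^ r ∂P ≤ (1 + c * v / n) ^ k *
          (2 * (c * v) / n * ∑ i ∈ Finset.range k, ∫ ω, ‖B i ω‖ ^ r ∂P) := by
    intro k
    induction k with
    | zero => intro _ _; simp [transform, Real.zero_rpow hr0]
    | succ k ih =>
      intro hk hBi
      obtain ⟨hi, hle⟩ := ih (by omega) fun i hi => hBi i (by omega)
      have hBk := hBi k (by omega)
      obtain ⟨hi', hle'⟩ := hstep (h.centred k hk) (h.le k)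
        (h.measurable_transform hB k (by omega)) hi (hB k hk) hBk
      simp only [transform_succ]
      refine ⟨hi', hle'.trans ?_⟩
      rw [Finset.sum_range_succ]
      set a := ∫ ω, ‖transform B Δ k ω‖ ^ r ∂P
      set β := ∫ ω, ‖B k ω‖ ^ r ∂P
      set s := ∑ i ∈ Finset.range k, ∫ ω, ‖B i ω‖ ^ r ∂P
      have ha : 0 ≤ a := integral_nonneg fun ω => by positivity
      have hβ : 0 ≤ β := integral_nonneg fun ω => by positivity
      have hs : 0 ≤ s := Finset.sum_nonneg fun i _ => integral_nonneg fun ω => by positivity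
      have h1 : 1 ≤ (1 + c * v / n) ^ (k + 1) :=
        one_le_pow₀ (by linarith [show 0 ≤ c * v / n by positivity])
      calc a + c * ((a + β) * ∫ ω, ‖Δ k ω‖ ^ 2 ∂P + β * ∫ ω, ‖Δ k ω‖ ^ r ∂P)
          ≤ a + c * ((a + β) * (v / n) + β * (v / n)) := by
            have h2 := h.sq_le k hk
            have h3 := h.rpow_le k hk
            gcongr
        _ = (1 + c * v / n) * a + 1 * (2 * (c * v) / n * β) := by ring
        _ ≤ (1 + c * v / n) * ((1 + c * v / n) ^ k * (2 * (c * v) / n * s))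
            + (1 + c * v / n) ^ (k + 1) * (2 * (c * v) / n * β) := by gcongr
        _ = _ := by ring
  intro k hk hBi
  obtain ⟨hi, hle⟩ := main k hk hBi
  refine ⟨hi, hle.trans ?_⟩
  have hs : 0 ≤ ∑ i ∈ Finset.range k, ∫ ω, ‖B i ω‖ ^ r ∂P :=
    Finset.sum_nonneg fun i _ => integral_nonneg fun ω => by positivity
  rcases Nat.eq_zero_or_pos n with hn | hn
  · subst hn
    simp
  have := one_add_div_pow_le_exp (show 0 ≤ c * v by positivity) hn hk
  calc _ ≤ Real.exp (c * v) * (2 * (c * v) / n * ∑ i ∈ Finset.range k, ∫ ω, ‖B i ω‖ ^ r ∂P) := by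
        gcongr
    _ = (Real.exp (c * v) * (2 * (c * v))) / n * ∑ i ∈ Finset.range k, ∫ ω, ‖B i ω‖ ^ r ∂P := by
        ring
    _ ≤ _ := by
        gcongr
        linarith

lemma partialSups_rpow_le_sum {s : ℕ → ℝ} (hs : ∀ k, 0 ≤ s k) (N : ℕ) :
    partialSups s N ^ r ≤ ∑ i ∈ Finset.range (N + 1), s i ^ r := by
  obtain ⟨i, hi, h⟩ := exists_partialSups_eq s N
  rw [h]
  exact Finset.single_le_sum (f := fun i => s i ^ r) (fun i _ => Real.rpow_nonneg (hs i) r)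
    (Finset.mem_range.2 (by omega))

lemma measurable_partialSups {𝒢 : MeasurableSpace Ω} {s : ℕ → Ω → ℝ} {k : ℕ}
    (hs : ∀ i ≤ k, Measurable[𝒢] (s i)) : Measurable[𝒢] fun ω => partialSups (fun i => s i ω) k := by
  induction k with
  | zero => simpa using hs 0 le_rfl
  | succ k ih =>
    simp only [partialSups_add_one]
    exact (ih fun i hi => hs i (by omega)).sup (hs (k + 1) le_rfl)

lemma partialSups_nonneg {s : ℕ → ℝ} (hs : ∀ k, 0 ≤ s k) (k : ℕ) : 0 ≤ partialSups s k :=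
  (hs k).trans (le_partialSups s k)

lemma integrable_partialSups_rpow {s : ℕ → Ω → ℝ} (hs0 : ∀ i ω, 0 ≤ s i ω) {k : ℕ}
    (hs : ∀ i ≤ k, Measurable (s i)) (hi : ∀ i ≤ k, Integrable (fun ω => s i ω ^ r) P) :
    Integrable (fun ω => partialSups (fun i => s i ω) k ^ r) P := by
  refine Integrable.mono' (integrable_finsetSum (Finset.range (k + 1)) (f := fun i ω => s i ω ^ r)
    fun i hik => hi i ?_) ((measurable_partialSups hs).pow_const r).aestronglyMeasurable
    (ae_of_all _ fun ω => ?_)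
  · have := Finset.mem_range.1 hik
    omega
  · rw [Real.norm_of_nonneg (Real.rpow_nonneg (partialSups_nonneg (fun k => hs0 k ω) k) r)]
    exact partialSups_rpow_le_sum (fun i => hs0 i ω) k

/-- The maximal inequality for martingale transforms: a discrete Burkholder-Davis-Gundy bound. -/
lemma exists_integral_partialSups_transform_le (hr : 2 ≤ r) (hv : 0 ≤ v) : ∃ C : ℝ, 0 < C ∧
    ∀ {d m : ℕ} {Ω : Type u} {𝒢 : ℕ → MeasurableSpace Ω} {_mΩ : MeasurableSpace Ω} {P : Measure Ω}
      [IsProbabilityMeasure P] {n : ℕ} {Δ : ℕ → Ω → Vec m} (_ : IsDrivingNoise 𝒢 P n r v Δ)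
      {B : ℕ → Ω → Mat d m} (_ : ∀ k < n, EntryMeasurable (𝒢 k) (B k)),
      ∀ k ≤ n, (∀ i < k, Integrable (fun ω => ‖B i ω‖ ^ r) P) →
        Integrable (fun ω => partialSups (fun i => ‖transform B Δ i ω‖) k ^ r) P ∧
        ∫ ω, partialSups (fun i => ‖transform B Δ i ω‖) k ^ r ∂P ≤
          C / n * ∑ i ∈ Finset.range k, ∫ ω, ‖B i ω‖ ^ r ∂P := by
  obtain ⟨c₁, hc₁, hmom⟩ := exists_integral_transform_rpow_le.{u} hr hv
  obtain ⟨c₂, hc₂, hdoob⟩ := exists_partialSups_rpow_le hr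
  refine ⟨2 * c₂ * c₁, by positivity, fun {d m Ω 𝒢 mΩ P _ n Δ} h {B} hB k hk hBi => ?_⟩
  have hr0 : 0 ≤ r := by linarith
  have hSm : ∀ i ≤ k, Measurable[𝒢 i] (transform B Δ i) :=
    fun i hi => h.measurable_transform hB i (hi.trans hk)
  have hSi : ∀ i ≤ k, Integrable (fun ω => ‖transform B Δ i ω‖ ^ r) P := fun i hi =>
    (hmom h hB i (hi.trans hk) fun j hj => hBi j (by omega)).1
  have hMi : ∀ i ≤ k, Integrable (fun ω => partialSups (fun j => ‖transform B Δ j ω‖) i ^ r) P :=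
    fun i hi => integrable_partialSups_rpow (fun _ _ => norm_nonneg _)
      (fun j hj => ((hSm j (by omega)).mono (h.le j) le_rfl).norm) fun j hj => hSi j (by omega)
  have hMm : ∀ i ≤ k, Measurable[𝒢 i] fun ω => partialSups (fun j => ‖transform B Δ j ω‖) i :=
    fun i hi => measurable_partialSups fun j hj =>
      (measurable_norm_vec (hSm j (by omega))).mono (h.mono hj) le_rfl
  have hM0 : ∀ i ω, 0 ≤ partialSups (fun j => ‖transform B Δ j ω‖) i := fun i ω =>
    partialSups_nonneg (fun _ => norm_nonneg _) i
  have hweight : ∀ i < k,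
      Integrable (fun ω => partialSups (fun j => ‖transform B Δ j ω‖) i ^ (r - 1) *
        (‖transform B Δ (i + 1) ω‖ - ‖transform B Δ i ω‖)) P ∧
      0 ≤ ∫ ω, partialSups (fun j => ‖transform B Δ j ω‖) i ^ (r - 1) *
        (‖transform B Δ (i + 1) ω‖ - ‖transform B Δ i ω‖) ∂P := by
    intro i hi
    have hSi' := hSi (i + 1) hi
    simp only [transform_succ] at hSi' ⊢
    exact (h.centred i (by omega)).integral_weight_mul_sub_nonneg hr (h.le i) (hSm i hi.le)
      (hSi i hi.le) (hB i (by omega)) (hBi i hi) hSi' (hMm i hi.le) (hM0 i) (hMi i hi.le)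
  refine ⟨hMi k le_rfl, ?_⟩
  have hsumi : Integrable (fun ω => ∑ i ∈ Finset.range k,
      partialSups (fun j => ‖transform B Δ j ω‖) i ^ (r - 1) *
        (‖transform B Δ (i + 1) ω‖ - ‖transform B Δ i ω‖)) P :=
    integrable_finsetSum _ fun i hi => (hweight i (Finset.mem_range.1 hi)).1
  have hsum0 : 0 ≤ ∫ ω, ∑ i ∈ Finset.range k,
      partialSups (fun j => ‖transform B Δ j ω‖) i ^ (r - 1) *
        (‖transform B Δ (i + 1) ω‖ - ‖transform B Δ i ω‖) ∂P := by
    rw [integral_finsetSum _ fun i hi => (hweight i (Finset.mem_range.1 hi)).1]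
    exact Finset.sum_nonneg fun i hi => (hweight i (Finset.mem_range.1 hi)).2
  have hint := integral_mono ((hMi k le_rfl).add (hsumi.const_mul r))
    (((hSi k le_rfl).const_mul c₂).add ((hMi k le_rfl).div_const 2))
    fun ω => hdoob (fun i => ‖transform B Δ i ω‖) (fun _ => norm_nonneg _) k
  simp only [Pi.add_apply] at hint
  rw [integral_add (hMi k le_rfl) (hsumi.const_mul r),
    integral_add ((hSi k le_rfl).const_mul c₂) ((hMi k le_rfl).div_const 2), integral_const_mul,
    integral_const_mul, integral_div] at hint
  have hfin := (hmom h hB k hk hBi).2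
  have := mul_nonneg hr0 hsum0
  calc _ ≤ 2 * c₂ * ∫ ω, ‖transform B Δ k ω‖ ^ r ∂P := by linarith
    _ ≤ 2 * c₂ * (c₁ / n * ∑ i ∈ Finset.range k, ∫ ω, ‖B i ω‖ ^ r ∂P) := by gcongr
    _ = _ := by ring

/-! ### Moment bounds for recursions driven by noise -/

lemma sum_rpow_le_pow_mul_sum (hr : 1 ≤ r) (k : ℕ) {s : ℕ → ℝ} (hs : ∀ i, 0 ≤ s i) :
    (∑ i ∈ Finset.range k, s i) ^ r ≤ (k : ℝ) ^ (r - 1) * ∑ i ∈ Finset.range k, s i ^ r := by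
  have := Real.rpow_sum_le_const_mul_sum_rpow_of_nonneg (Finset.range k) (f := s) hr
    fun i _ => hs i
  simpa using this

/-- The moment bound for `Z_{k+1} = Z_k + U_k + B_k Δ_k`. -/
lemma exists_integral_partialSups_recursion_le (hr : 2 ≤ r) (hv : 0 ≤ v) : ∃ C : ℝ, 0 < C ∧
    ∀ {d m : ℕ} {Ω : Type u} {𝒢 : ℕ → MeasurableSpace Ω} {_mΩ : MeasurableSpace Ω} {P : Measure Ω}
      [IsProbabilityMeasure P] {n : ℕ} {Δ : ℕ → Ω → Vec m} (_ : IsDrivingNoise 𝒢 P n r v Δ)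
      {B : ℕ → Ω → Mat d m} (_ : ∀ k < n, EntryMeasurable (𝒢 k) (B k))
      {Z U : ℕ → Ω → Vec d} (_ : ∀ k ≤ n, Measurable (Z k))
      (_ : ∀ k < n, ∀ ω, Z (k + 1) ω = Z k ω + U k ω + matVec (B k ω) (Δ k ω))
      {ζ : ℝ} (_ : ∀ ω, ‖Z 0 ω‖ ≤ ζ),
      ∀ k ≤ n, (∀ i < k, Integrable (fun ω => ‖U i ω‖ ^ r) P) →
        (∀ i < k, Integrable (fun ω => ‖B i ω‖ ^ r) P) →
        Integrable (fun ω => partialSups (fun i => ‖Z i ω‖) k ^ r) P ∧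
        ∫ ω, partialSups (fun i => ‖Z i ω‖) k ^ r ∂P ≤
          C * (ζ ^ r + 1 / n * ∑ i ∈ Finset.range k,
            ((n : ℝ) ^ r * ∫ ω, ‖U i ω‖ ^ r ∂P + ∫ ω, ‖B i ω‖ ^ r ∂P)) := by
  obtain ⟨c, hc, hmax⟩ := exists_integral_partialSups_transform_le.{u} hr hv
  refine ⟨3 ^ r * (1 + c), by positivity,
    fun {d m Ω 𝒢 mΩ P _ n Δ} h {B} hB {Z U} hZ hrec {ζ} hζ k hk hU hBi => ?_⟩
  have hr0 : 0 ≤ r := by linarith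
  have hr1 : 1 ≤ r := by linarith
  obtain ⟨hTi, hTle⟩ := hmax h hB k hk hBi
  have hform : ∀ ω, ∀ j ≤ n,
      Z j ω = Z 0 ω + ∑ i ∈ Finset.range j, U i ω + transform B Δ j ω := by
    intro ω j
    induction j with
    | zero => intro _; simp [transform]
    | succ j ih =>
      intro hj
      rw [hrec j hj, ih (by omega), Finset.sum_range_succ, transform_succ]
      abel
  have hpt : ∀ ω, partialSups (fun i => ‖Z i ω‖) k ^ r ≤
      3 ^ r * (ζ ^ r + (n : ℝ) ^ (r - 1) * ∑ i ∈ Finset.range k, ‖U i ω‖ ^ r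
        + partialSups (fun i => ‖transform B Δ i ω‖) k ^ r) := by
    intro ω
    have hζ0 : 0 ≤ ζ := (norm_nonneg _).trans (hζ ω)
    have hT0 : 0 ≤ partialSups (fun i => ‖transform B Δ i ω‖) k :=
      partialSups_nonneg (fun _ => norm_nonneg _) k
    have hle : partialSups (fun i => ‖Z i ω‖) k ≤
        ζ + ∑ i ∈ Finset.range k, ‖U i ω‖ + partialSups (fun i => ‖transform B Δ i ω‖) k := by
      obtain ⟨j, hj, hj'⟩ := exists_partialSups_eq (fun i => ‖Z i ω‖) k
      rw [hj', hform ω j (hj.trans hk)]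
      refine (norm_add₃_le).trans ?_
      gcongr
      · exact hζ ω
      · refine (norm_sum_le _ _).trans ?_
        exact Finset.sum_le_sum_of_subset_of_nonneg
          (Finset.range_subset_range.2 hj) fun _ _ _ => norm_nonneg _
      · exact le_partialSups_of_le (fun i => ‖transform B Δ i ω‖) hj
    refine (Real.rpow_le_rpow (partialSups_nonneg (fun _ => norm_nonneg _) k) hle hr0).trans ?_
    refine (add_add_rpow_le_three_rpow_mul hr0 hζ0 (Finset.sum_nonneg fun _ _ => norm_nonneg _)
      hT0).trans ?_
    gcongr
    refine (sum_rpow_le_pow_mul_sum hr1 k fun i => norm_nonneg (U i ω)).trans ?_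
    have : 0 ≤ r - 1 := by linarith
    gcongr
  have hsumU : Integrable (fun ω => (n : ℝ) ^ (r - 1) * ∑ i ∈ Finset.range k, ‖U i ω‖ ^ r) P :=
    (integrable_finsetSum _ fun i hi => hU i (Finset.mem_range.1 hi)).const_mul _
  have hrhs1 : Integrable (fun ω => ζ ^ r + (n : ℝ) ^ (r - 1) * ∑ i ∈ Finset.range k, ‖U i ω‖ ^ r)
      P := (integrable_const _).add hsumU
  have hrhs := (hrhs1.add hTi).const_mul (3 ^ r)
  have hlhs : Integrable (fun ω => partialSups (fun i => ‖Z i ω‖) k ^ r) P := by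
    refine hrhs.mono' ((measurable_partialSups fun i hi => ?_).pow_const r).aestronglyMeasurable
      (ae_of_all _ fun ω => ?_)
    · exact (hZ i (hi.trans hk)).norm
    · rw [Real.norm_of_nonneg
        (Real.rpow_nonneg (partialSups_nonneg (fun _ => norm_nonneg _) k) r)]
      exact hpt ω
  refine ⟨hlhs, (integral_mono hlhs hrhs hpt).trans ?_⟩
  simp only [Pi.add_apply]
  rw [integral_const_mul, integral_add hrhs1 hTi, integral_add (integrable_const _) hsumU,
    integral_const_mul, integral_finsetSum _ fun i hi => hU i (Finset.mem_range.1 hi),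
    integral_const, probReal_univ, one_smul, Finset.sum_add_distrib, ← Finset.mul_sum]
  set su := ∑ i ∈ Finset.range k, ∫ ω, ‖U i ω‖ ^ r ∂P with hsu
  set sb := ∑ i ∈ Finset.range k, ∫ ω, ‖B i ω‖ ^ r ∂P with hsb
  have hsu0 : 0 ≤ su := Finset.sum_nonneg fun i _ => integral_nonneg fun ω => by positivity
  have hsb0 : 0 ≤ sb := Finset.sum_nonneg fun i _ => integral_nonneg fun ω => by positivity
  have hζr : 0 ≤ ζ ^ r := by
    have : Nonempty Ω := P.nonempty_of_neZero
    have hζ0 : 0 ≤ ζ := (norm_nonneg _).trans (hζ (Classical.arbitrary Ω))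
    positivity
  rw [mul_assoc]
  refine mul_le_mul_of_nonneg_left ?_ (by positivity)
  have hpow : (n : ℝ) ^ (r - 1) * su = 1 / n * ((n : ℝ) ^ r * su) := by
    rcases Nat.eq_zero_or_pos n with hn | hn
    · obtain rfl : k = 0 := by omega
      simp [hsu]
    · have hn' : (0 : ℝ) < n := by exact_mod_cast hn
      rw [Real.rpow_sub_one hn'.ne']
      field_simp
  rw [hpow]
  have h1 : 0 ≤ 1 / (n : ℝ) * ((n : ℝ) ^ r * su) := by positivity
  have h2 : 0 ≤ 1 / (n : ℝ) * sb := by positivity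
  have h3 : c / n * sb = c * (1 / n * sb) := by ring
  rw [h3] at hTle
  nlinarith [mul_nonneg hc.le hζr, mul_nonneg hc.le h1]

/-- The moment bound for `Z_{k+1} = Z_k + U_k + B_k Δ_k` when `U_k` and `B_k` grow at most linearly
in `Z_k`, in the `L^r` sense. -/
lemma exists_integral_partialSups_le_exp (hr : 2 ≤ r) (hv : 0 ≤ v) : ∃ C : ℝ, 0 < C ∧
    ∀ {d m : ℕ} {Ω : Type u} {𝒢 : ℕ → MeasurableSpace Ω} {_mΩ : MeasurableSpace Ω} {P : Measure Ω}
      [IsProbabilityMeasure P] {n : ℕ} (_ : 1 ≤ n) {Δ : ℕ → Ω → Vec m}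
      (_ : IsDrivingNoise 𝒢 P n r v Δ)
      {B : ℕ → Ω → Mat d m} (_ : ∀ k < n, EntryMeasurable (𝒢 k) (B k))
      {Z U : ℕ → Ω → Vec d} (_ : ∀ k ≤ n, Measurable (Z k))
      (_ : ∀ k < n, ∀ ω, Z (k + 1) ω = Z k ω + U k ω + matVec (B k ω) (Δ k ω))
      {ζ : ℝ} (_ : ∀ ω, ‖Z 0 ω‖ ≤ ζ) {A L : ℝ} (_ : 0 ≤ A) (_ : 0 ≤ L)
      (_ : ∀ k < n, Integrable (fun ω => ‖Z k ω‖ ^ r) P →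
        Integrable (fun ω => ‖U k ω‖ ^ r) P ∧ Integrable (fun ω => ‖B k ω‖ ^ r) P ∧
        (n : ℝ) ^ r * ∫ ω, ‖U k ω‖ ^ r ∂P + ∫ ω, ‖B k ω‖ ^ r ∂P
          ≤ A + L * ∫ ω, ‖Z k ω‖ ^ r ∂P),
      Integrable (fun ω => partialSups (fun i => ‖Z i ω‖) n ^ r) P ∧
      (∀ k ≤ n, Integrable (fun ω => ‖Z k ω‖ ^ r) P) ∧
      ∫ ω, partialSups (fun i => ‖Z i ω‖) n ^ r ∂P ≤ C * (ζ ^ r + A) * Real.exp (C * L) := by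
  obtain ⟨c, hc, hrecur⟩ := exists_integral_partialSups_recursion_le.{u} hr hv
  refine ⟨c, hc, fun {d m Ω 𝒢 mΩ P _ n} hn {Δ} h {B} hB {Z U} hZ hrec {ζ} hζ {A L} hA hL hlin => ?_⟩
  have hr0 : 0 ≤ r := by linarith
  have hn' : (0 : ℝ) < n := by exact_mod_cast hn
  have hZM : ∀ k ≤ n, Integrable (fun ω => partialSups (fun i => ‖Z i ω‖) k ^ r) P →
      Integrable (fun ω => ‖Z k ω‖ ^ r) P ∧
      ∫ ω, ‖Z k ω‖ ^ r ∂P ≤ ∫ ω, partialSups (fun i => ‖Z i ω‖) k ^ r ∂P := by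
    intro k hk hint
    have hle : ∀ ω, ‖Z k ω‖ ^ r ≤ partialSups (fun i => ‖Z i ω‖) k ^ r := fun ω =>
      Real.rpow_le_rpow (norm_nonneg _) (le_partialSups (fun i => ‖Z i ω‖) k) hr0
    have hi : Integrable (fun ω => ‖Z k ω‖ ^ r) P := by
      refine hint.mono' ((hZ k hk).norm.pow_const r).aestronglyMeasurable (ae_of_all _ fun ω => ?_)
      rw [Real.norm_of_nonneg (by positivity)]
      exact hle ω
    exact ⟨hi, integral_mono hi hint hle⟩
  have hint : ∀ k ≤ n, Integrable (fun ω => partialSups (fun i => ‖Z i ω‖) k ^ r) P := by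
    intro k
    induction k using Nat.strong_induction_on with
    | _ k ih =>
      intro hk
      have hstep := fun i (hi : i < k) =>
        hlin i (hi.trans_le hk) (hZM i (by omega) (ih i hi (by omega))).1
      exact (hrecur h hB hZ hrec hζ k hk (fun i hi => (hstep i hi).1)
        fun i hi => (hstep i hi).2.1).1
  have hbound : ∀ k ≤ n, ∫ ω, partialSups (fun i => ‖Z i ω‖) k ^ r ∂P ≤
      c * (ζ ^ r + A) + c * L / n *
        ∑ i ∈ Finset.range k, ∫ ω, partialSups (fun j => ‖Z j ω‖) i ^ r ∂P := by
    intro k hk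
    have hstep := fun i (hi : i < k) =>
      hlin i (hi.trans_le hk) (hZM i (by omega) (hint i (by omega))).1
    refine (hrecur h hB hZ hrec hζ k hk (fun i hi => (hstep i hi).1)
      fun i hi => (hstep i hi).2.1).2.trans ?_
    have hsum : ∑ i ∈ Finset.range k,
        ((n : ℝ) ^ r * ∫ ω, ‖U i ω‖ ^ r ∂P + ∫ ω, ‖B i ω‖ ^ r ∂P) ≤
        n * A + L * ∑ i ∈ Finset.range k, ∫ ω, partialSups (fun j => ‖Z j ω‖) i ^ r ∂P := by
      calc _ ≤ ∑ i ∈ Finset.range k, (A + L * ∫ ω, partialSups (fun j => ‖Z j ω‖) i ^ r ∂P) := by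
            refine Finset.sum_le_sum fun i hi => ?_
            have hi' := Finset.mem_range.1 hi
            refine (hstep i hi').2.2.trans ?_
            have := (hZM i (by omega) (hint i (by omega))).2
            gcongr
        _ = k * A + L * ∑ i ∈ Finset.range k, ∫ ω, partialSups (fun j => ‖Z j ω‖) i ^ r ∂P := by
            rw [Finset.sum_add_distrib, ← Finset.mul_sum]; simp
        _ ≤ _ := by gcongr
    calc _ ≤ c * (ζ ^ r + 1 / n * (n * A + L * ∑ i ∈ Finset.range k,
          ∫ ω, partialSups (fun j => ‖Z j ω‖) i ^ r ∂P)) := by gcongr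
      _ = _ := by field_simp; ring
  refine ⟨hint n le_rfl, fun k hk => (hZM k hk (hint k hk)).1, ?_⟩
  have hζr : 0 ≤ ζ ^ r := by
    have : Nonempty Ω := P.nonempty_of_neZero
    have hζ0 : 0 ≤ ζ := (norm_nonneg _).trans (hζ (Classical.arbitrary Ω))
    positivity
  refine (le_mul_one_add_pow_of_le_sum (by positivity) hbound n le_rfl).trans ?_
  have := one_add_div_pow_le_exp (show 0 ≤ c * L by positivity) hn le_rfl
  gcongr

end Transform

/-! ### Wiener increments -/

section Wiener

variable {m : ℕ} {Ω : Type u} {mΩ : MeasurableSpace Ω} {P : Measure Ω}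

lemma multivariateGaussian_zero_smul_one (m : ℕ) {h : ℝ} (hh : 0 ≤ h) :
    multivariateGaussian 0 (h • (1 : Matrix (Fin m) (Fin m) ℝ)) =
      (stdGaussian (Vec m)).map (fun x => √h • x) := by
  have : IsProbabilityMeasure ((stdGaussian (Vec m)).map (fun x => √h • x)) :=
    Measure.isProbabilityMeasure_map (by fun_prop)
  apply Measure.ext_of_charFun
  ext t
  rw [charFun_map_smul, charFun_stdGaussian,
    charFun_multivariateGaussian (Matrix.PosSemidef.one.smul hh)]
  congr 1
  have h1 : (WithLp.ofLp t) ⬝ᵥ (h • (1 : Matrix (Fin m) (Fin m) ℝ)) *ᵥ (WithLp.ofLp t)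
      = h * ‖t‖ ^ 2 := by
    rw [Matrix.smul_mulVec, Matrix.one_mulVec, dotProduct_smul, EuclideanSpace.real_norm_sq_eq]
    simp [dotProduct, sq]
  have h2 : ‖√h • t‖ ^ 2 = h * ‖t‖ ^ 2 := by
    rw [norm_smul, mul_pow, Real.norm_eq_abs, sq_abs, Real.sq_sqrt hh]
  rw [h1, inner_zero_right, ← Complex.ofReal_pow ‖√h • t‖, h2]
  simp [neg_div]

/-- The absolute moment of order `q` of the standard Gaussian law on `ℝᵐ`. -/
noncomputable def gaussianMoment (m : ℕ) (q : ℝ) : ℝ := ∫ x, ‖x‖ ^ q ∂(stdGaussian (Vec m))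

lemma gaussianMoment_nonneg (m : ℕ) (q : ℝ) : 0 ≤ gaussianMoment m q :=
  integral_nonneg fun x => by positivity

lemma integrable_norm_rpow_stdGaussian (m : ℕ) {q : ℝ} (hq : 0 < q) :
    Integrable (fun x => ‖x‖ ^ q) (stdGaussian (Vec m)) := by
  have h := (IsGaussian.memLp_id (stdGaussian (Vec m)) (ENNReal.ofReal q)
    ENNReal.ofReal_ne_top).integrable_norm_rpow (by simpa using hq) ENNReal.ofReal_ne_top
  simpa [ENNReal.toReal_ofReal hq.le] using h

lemma IsWiener.moment {𝓕 : Filtration ℝ≥0 mΩ} {W : ℝ≥0 → Ω → Vec m} (hW : IsWiener P 𝓕 W)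
    {s t : ℝ≥0} (hst : s ≤ t) {q : ℝ} (hq : 0 < q) :
    Integrable (fun ω => ‖W t ω - W s ω‖ ^ q) P ∧
      ∫ ω, ‖W t ω - W s ω‖ ^ q ∂P = ((t : ℝ) - s) ^ (q / 2) * gaussianMoment m q := by
  have hq0 : 0 ≤ q := hq.le
  have hh : 0 ≤ (t : ℝ) - s := sub_nonneg.2 (by exact_mod_cast hst)
  have hlaw := hW.law s t hst
  rw [multivariateGaussian_zero_smul_one m hh] at hlaw
  have hpow : ∀ x : Vec m, ‖√((t : ℝ) - s) • x‖ ^ q = ((t : ℝ) - s) ^ (q / 2) * ‖x‖ ^ q := by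
    intro x
    rw [norm_smul, Real.norm_of_nonneg (Real.sqrt_nonneg _),
      Real.mul_rpow (Real.sqrt_nonneg _) (norm_nonneg _), Real.sqrt_eq_rpow, ← Real.rpow_mul hh]
    congr 2; ring
  have hi : Integrable (fun x : Vec m => ‖x‖ ^ q)
      ((stdGaussian (Vec m)).map (fun x => √((t : ℝ) - s) • x)) := by
    rw [integrable_map_measure (by fun_prop) (by fun_prop)]
    simp only [Function.comp_def, hpow]
    exact (integrable_norm_rpow_stdGaussian m hq).const_mul _
  constructor
  · rw [← hlaw.map_eq, integrable_map_measure (by fun_prop) hlaw.aemeasurable] at hi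
    exact hi
  · have h1 := hlaw.integral_comp (f := fun x : Vec m => ‖x‖ ^ q) (by fun_prop)
    simp only [Function.comp_def] at h1
    rw [h1, integral_map (by fun_prop) (by fun_prop)]
    simp only [hpow]
    rw [integral_const_mul, gaussianMoment]

lemma IsWiener.integral_increment {𝓕 : Filtration ℝ≥0 mΩ} {W : ℝ≥0 → Ω → Vec m}
    (hW : IsWiener P 𝓕 W) {s t : ℝ≥0} (hst : s ≤ t) : ∫ ω, (W t ω - W s ω) ∂P = 0 := by
  rw [(hW.law s t hst).integral_eq]
  exact integral_id_multivariateGaussian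

/-- If `𝒜` is independent of `𝓑`, and `𝒞` is independent of both jointly, then `𝒜` is independent of
`𝓑` and `𝒞` jointly. -/
lemma indep_sup_right [IsProbabilityMeasure P] {𝒜 𝓑 𝒞 𝒟 : MeasurableSpace Ω}
    (h𝒟 : 𝒟 ≤ mΩ) (h𝒞 : 𝒞 ≤ mΩ) (hA𝒟 : 𝒜 ≤ 𝒟) (hB𝒟 : 𝓑 ≤ 𝒟) (hAB : Indep 𝒜 𝓑 P)
    (hCD : Indep 𝒞 𝒟 P) : Indep 𝒜 (𝓑 ⊔ 𝒞) P := by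
  refine IndepSets.indep (p1 := {s | MeasurableSet[𝒜] s})
    (p2 := {s | ∃ b c, MeasurableSet[𝓑] b ∧ MeasurableSet[𝒞] c ∧ b ∩ c = s}) (hA𝒟.trans h𝒟)
    (sup_le (hB𝒟.trans h𝒟) h𝒞) (@MeasurableSpace.isPiSystem_measurableSet _ 𝒜) ?_
    (@MeasurableSpace.generateFrom_measurableSet _ 𝒜).symm ?_ ?_
  · rintro _ ⟨b, c, hb, hc, rfl⟩ _ ⟨b', c', hb', hc', rfl⟩ _
    refine ⟨b ∩ b', c ∩ c', MeasurableSet.inter hb hb', MeasurableSet.inter hc hc', ?_⟩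
    exact Set.inter_inter_inter_comm ..
  · refine le_antisymm (sup_le (fun b hb => ?_) fun c hc => ?_) ?_
    · exact MeasurableSpace.measurableSet_generateFrom ⟨b, univ, hb, MeasurableSet.univ, by simp⟩
    · exact MeasurableSpace.measurableSet_generateFrom ⟨univ, c, MeasurableSet.univ, hc, by simp⟩
    · refine MeasurableSpace.generateFrom_le ?_
      rintro _ ⟨b, c, hb, hc, rfl⟩
      exact MeasurableSet.inter ((le_sup_left : 𝓑 ≤ 𝓑 ⊔ 𝒞) b hb)
        ((le_sup_right : 𝒞 ≤ 𝓑 ⊔ 𝒞) c hc)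
  · rw [IndepSets_iff]
    rintro a _ ha ⟨b, c, hb, hc, rfl⟩
    have h := (Indep_iff _ _ _).1 hCD
    have h1 := h c (a ∩ b) hc (MeasurableSet.inter (hA𝒟 a ha) (hB𝒟 b hb))
    have h2 := h c b hc (hB𝒟 b hb)
    have h3 := (Indep_iff _ _ _).1 hAB a b ha hb
    rw [← Set.inter_assoc, Set.inter_comm (a ∩ b), h1, h3, Set.inter_comm b, h2]
    ring

lemma grid_mono (T : ℝ≥0) (n : ℕ) : Monotone (grid T n) := by
  intro i j hij
  unfold grid
  gcongr

lemma grid_le {T : ℝ≥0} {n i : ℕ} (hn : 1 ≤ n) (hi : i ≤ n) : grid T n i ≤ T := by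
  have hn' : (0 : ℝ≥0) < n := by exact_mod_cast hn
  unfold grid
  rw [div_le_iff₀ hn', mul_comm]
  gcongr

lemma grid_mem_Icc {T : ℝ≥0} {n i : ℕ} (hn : 1 ≤ n) (hi : i ≤ n) :
    (grid T n i : ℝ) ∈ Icc (0 : ℝ) T := ⟨NNReal.coe_nonneg _, by exact_mod_cast grid_le hn hi⟩

lemma grid_succ_sub (T : ℝ≥0) (n i : ℕ) : (grid T n (i + 1) : ℝ) - grid T n i = T / n := by
  unfold grid
  push_cast
  ring

/-- The `i`-th increment of a process along the grid. -/
noncomputable def increment (T : ℝ≥0) (n : ℕ) (W : ℝ≥0 → Ω → Vec m) (i : ℕ) (ω : Ω) : Vec m :=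
  W (grid T n (i + 1)) ω - W (grid T n i) ω

/-- What is known at the grid point `tₖ` when all the random evaluation points are revealed at the
start. -/
noncomputable abbrev gridFiltration (𝓕 : Filtration ℝ≥0 mΩ) (T : ℝ≥0) (n : ℕ) (ξ : ℕ → Ω → ℝ) (k : ℕ) :
    MeasurableSpace Ω :=
  𝓕 (grid T n k) ⊔ ⨆ i : Fin n, MeasurableSpace.comap (ξ i) inferInstance

lemma div_rpow_le_div_rpow {T : ℝ} (hT : 0 ≤ T) {n : ℕ} (hn : 1 ≤ n) {p q : ℝ} (hqp : q ≤ p) :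
    (T / n) ^ p ≤ T ^ p / (n : ℝ) ^ q := by
  have hn' : (1 : ℝ) ≤ n := by exact_mod_cast hn
  rw [Real.div_rpow hT (by positivity)]
  gcongr

variable {𝓕 : Filtration ℝ≥0 mΩ} {W : ℝ≥0 → Ω → Vec m} {T : ℝ≥0} {n : ℕ} {ξ : ℕ → Ω → ℝ}

lemma IsWiener.increment_moment (hW : IsWiener P 𝓕 W) (T : ℝ≥0) (n k : ℕ) {q : ℝ} (hq : 0 < q) :
    Integrable (fun ω => ‖increment T n W k ω‖ ^ q) P ∧
      ∫ ω, ‖increment T n W k ω‖ ^ q ∂P = ((T : ℝ) / n) ^ (q / 2) * gaussianMoment m q := by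
  have := hW.moment (grid_mono T n (Nat.le_succ k)) hq
  rwa [grid_succ_sub] at this

lemma gridFiltration_mono : Monotone (gridFiltration 𝓕 T n ξ) := fun _ _ h =>
  sup_le_sup_right (𝓕.mono (grid_mono T n h)) _

lemma IsWiener.measurable_grid (hW : IsWiener P 𝓕 W) (k : ℕ) :
    Measurable[gridFiltration 𝓕 T n ξ k] (W (grid T n k)) :=
  (hW.adapted (grid T n k)).mono le_sup_left le_rfl

lemma IsWiener.isDrivingNoise [IsProbabilityMeasure P] (hW : IsWiener P 𝓕 W)
    (hξ : IsRandomization P 𝓕 T n ξ) (hn : 1 ≤ n) {r : ℝ} (hr : 2 ≤ r) :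
    IsDrivingNoise (gridFiltration 𝓕 T n ξ) P n r
      (T * gaussianMoment m 2 + (T : ℝ) ^ (r / 2) * gaussianMoment m r) (increment T n W) := by
  have hξle : (⨆ i : Fin n, MeasurableSpace.comap (ξ i) inferInstance) ≤ mΩ :=
    iSup_le fun i => (hξ.measurable i i.2).comap_le
  have hle : ∀ k, gridFiltration 𝓕 T n ξ k ≤ mΩ := fun k => sup_le (𝓕.le _) hξle
  have hmeas : ∀ k, Measurable[𝓕 (grid T n (k + 1))] (increment T n W k) := fun k =>
    measurable_sub_vec (hW.adapted _)
      ((hW.adapted _).mono (𝓕.mono (grid_mono T n (Nat.le_succ k))) le_rfl)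
  have h2 : 0 ≤ (T : ℝ) * gaussianMoment m 2 :=
    mul_nonneg T.coe_nonneg (gaussianMoment_nonneg m 2)
  have h3 : 0 ≤ (T : ℝ) ^ (r / 2) * gaussianMoment m r :=
    mul_nonneg (Real.rpow_nonneg T.coe_nonneg _) (gaussianMoment_nonneg m r)
  refine ⟨hle, gridFiltration_mono, fun k _ => (hmeas k).mono le_sup_left le_rfl,
    fun k _ => ⟨(hmeas k).mono (𝓕.le _) le_rfl, ?_, ?_, ?_⟩, fun k _ => ?_, fun k _ => ?_⟩
  · exact indep_sup_right (iSup_le fun t => 𝓕.le t) hξle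
      ((hmeas k).comap_le.trans (le_iSup (fun t => 𝓕 t) _)) (le_iSup (fun t => 𝓕 t) _)
      (hW.indep _ _ (grid_mono T n (Nat.le_succ k))) hξ.indep_filtration
  · exact (hW.increment_moment T n k (by linarith)).1
  · exact hW.integral_increment (grid_mono T n (Nat.le_succ k))
  · have h := (hW.increment_moment T n k zero_lt_two).2
    simp only [Real.rpow_two, div_self (two_ne_zero' ℝ), Real.rpow_one] at h
    rw [h, add_div, div_mul_eq_mul_div]
    have : 0 ≤ (T : ℝ) ^ (r / 2) * gaussianMoment m r / n := by positivity
    linarith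
  · rw [(hW.increment_moment T n k (by linarith)).2, add_div]
    have h1 := div_rpow_le_div_rpow T.coe_nonneg hn (q := 1) (p := r / 2) (by linarith)
    rw [Real.rpow_one] at h1
    have : 0 ≤ (T : ℝ) * gaussianMoment m 2 / n := by positivity
    calc _ ≤ (T : ℝ) ^ (r / 2) / n * gaussianMoment m r := by
          gcongr
          exact gaussianMoment_nonneg m r
      _ = (T : ℝ) ^ (r / 2) * gaussianMoment m r / n := by ring
      _ ≤ _ := by linarith

end Wiener

/-! ### Increments of the disturbed Wiener process -/

section Perturbation

/-- The increments `Δ'` of the disturbed process are those of `Δ`, up to `δ` times a bounded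
predictable matrix `G` applied to `Δ`, and `δ` times a remainder `R` whose size is controlled by a
function `q` of `Δ` with `r`-th moment of order `n ^ (-γ r)`. -/
structure IsPerturbedIncrement {m : ℕ} {Ω : Type u} (𝒢 : ℕ → MeasurableSpace Ω)
    {mΩ : MeasurableSpace Ω} (P : Measure Ω) (n : ℕ) (r γ c δ : ℝ) (Δ Δ' : ℕ → Ω → Vec m)
    (G : ℕ → Ω → Mat m m) (R : ℕ → Ω → Vec m) (q : Vec m → ℝ) : Prop where
  eq : ∀ k < n, ∀ ω, Δ' k ω = Δ k ω + δ • (matVec (G k ω) (Δ k ω) + R k ω)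
  predictable : ∀ k < n, EntryMeasurable (𝒢 k) (G k)
  norm_le : ∀ k < n, ∀ ω, ‖G k ω‖ ≤ c
  adapted : ∀ k < n, Measurable[𝒢 (k + 1)] (R k)
  remainder_le : ∀ k < n, ∀ ω, ‖R k ω‖ ≤ q (Δ k ω)
  measurable_bound : Measurable q
  integrable : ∀ k < n, Integrable (fun ω => q (Δ k ω) ^ r) P
  integral_le : ∀ k < n, ∫ ω, q (Δ k ω) ^ r ∂P ≤ c / (n : ℝ) ^ (γ * r)

lemma norm_le_card_mul {m : ℕ} {v : Vec m} {c : ℝ} (h : ∀ j, |v j| ≤ c) : ‖v‖ ≤ m * c := by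
  have hv : v = ∑ j, v j • EuclideanSpace.single j (1 : ℝ) := by
    have := (EuclideanSpace.basisFun (Fin m) ℝ).sum_repr v
    simpa using this.symm
  calc ‖v‖ = ‖∑ j, v j • EuclideanSpace.single j (1 : ℝ)‖ := congrArg _ hv
    _ ≤ ∑ j : Fin m, c := norm_sum_le_of_le _ fun j _ => by simpa [norm_smul] using h j
    _ = m * c := by simp

lemma opNorm_le_card_mul {m : ℕ} {L : Vec m →L[ℝ] ℝ} {c : ℝ} (hc : 0 ≤ c)
    (h : ∀ j, |L (EuclideanSpace.single j 1)| ≤ c) : ‖L‖ ≤ m * c := by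
  refine L.opNorm_le_bound (by positivity) fun v => ?_
  have hv : v = ∑ j, v j • EuclideanSpace.single j (1 : ℝ) := by
    have := (EuclideanSpace.basisFun (Fin m) ℝ).sum_repr v
    simpa using this.symm
  calc ‖L v‖ = ‖∑ j, v j * L (EuclideanSpace.single j (1 : ℝ))‖ := by
        conv_lhs => rw [hv, map_sum]
        simp
    _ ≤ ∑ j : Fin m, ‖v‖ * c := norm_sum_le_of_le _ fun j _ => by
        rw [norm_mul]
        exact mul_le_mul (PiLp.norm_apply_le v j) (h j) (norm_nonneg _) (norm_nonneg _)
    _ = m * c * ‖v‖ := by simp; ring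

/-- Second-order Taylor estimate from entrywise bounds on the Hessian. -/
lemma abs_sub_sub_fderiv_le {m : ℕ} {f : Vec m → ℝ} (hf : ContDiff ℝ 2 f)
    (hess : ∀ y k l, |fderiv ℝ (fun z => fderiv ℝ f z (EuclideanSpace.single l 1)) y
      (EuclideanSpace.single k 1)| ≤ 1) (y v : Vec m) :
    |f (y + v) - f y - fderiv ℝ f y v| ≤ (m : ℝ) ^ 2 * ‖v‖ ^ 2 := by
  have hd1 : Differentiable ℝ f := hf.differentiable (by norm_num)
  have hd2 : Differentiable ℝ (fderiv ℝ f) :=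
    (hf.fderiv_right (m := 1) (by norm_num)).differentiable (by norm_num)
  have hpart : ∀ l z w, |fderiv ℝ f z (EuclideanSpace.single l 1)
      - fderiv ℝ f w (EuclideanSpace.single l 1)| ≤ m * ‖z - w‖ := by
    intro l z w
    refine convex_univ.norm_image_sub_le_of_norm_fderiv_le (𝕜 := ℝ)
      (f := fun z => fderiv ℝ f z (EuclideanSpace.single l 1)) (fun x _ => ?_) (fun x _ => ?_)
      (mem_univ w) (mem_univ z)
    · exact (hd2 x).clm_apply (differentiableAt_const _)
    · simpa using opNorm_le_card_mul zero_le_one fun k => hess x k l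
  have hlip : ∀ z, ‖fderiv ℝ f z - fderiv ℝ f y‖ ≤ m * (m * ‖z - y‖) := fun z =>
    opNorm_le_card_mul (by positivity) fun l => hpart l z y
  have h := (convex_closedBall y ‖v‖).norm_image_sub_le_of_norm_fderiv_le' (𝕜 := ℝ) (f := f)
    (φ := fderiv ℝ f y) (C := m * (m * ‖v‖)) (fun x _ => hd1 x) (fun x hx => ?_)
    (Metric.mem_closedBall_self (norm_nonneg v)) (y := y + v) (by simp)
  · rw [add_sub_cancel_left] at h
    refine h.trans (le_of_eq ?_)
    ring
  · refine (hlip x).trans ?_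
    gcongr
    simpa [dist_eq_norm] using hx

variable {m : ℕ} {T : ℝ≥0}

lemma inner_spaceGrad (f : ℝ → Vec m → ℝ) (t : ℝ) (y v : Vec m) :
    inner ℝ (spaceGrad f t y) v = fderiv ℝ (f t) y v := by
  simp [spaceGrad, gradient]

lemma IsSmoothNoise.continuous {p : ℝ → Vec m → Vec m} (hp : IsSmoothNoise T p) {t : ℝ}
    (ht : t ∈ Icc (0 : ℝ) T) : Continuous (p t) := by
  have h : ∀ j, Continuous fun y => p t y j := fun j => ((hp.c12 j).diff_space t ht).continuous
  exact (PiLp.continuous_toLp 2 _).comp (continuous_pi h)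

/-- The Jacobian is taken at the later time and the earlier position. -/
lemma IsSmoothNoise.remainder_le {p : ℝ → Vec m → Vec m} (hp : IsSmoothNoise T p) {s t : ℝ}
    (hs : s ∈ Icc (0 : ℝ) T) (ht : t ∈ Icc (0 : ℝ) T) (y v : Vec m) :
    ‖p t (y + v) - p s y
      - matVec (Matrix.of fun j l => spaceGrad (fun t y => p t y j) t y l) v‖
      ≤ m * ((m : ℝ) ^ 2 * ‖v‖ ^ 2 + |t - s|) := by
  refine norm_le_card_mul fun j => ?_
  have h1 := abs_sub_sub_fderiv_le ((hp.c12 j).diff_space t ht) (fun z k l =>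
    (abs_entry_le_norm (spaceHess (fun t y => p t y j) t z) k l).trans (hp.hess_le j t ht z)) y v
  have h2 : |p t y j - p s y j| ≤ 1 * |t - s| :=
    (convex_Icc (0 : ℝ) T).norm_image_sub_le_of_norm_derivWithin_le (𝕜 := ℝ)
      (f := fun s => p s y j) (fun x hx => (hp.c12 j).diff_time x hx y)
      (fun x hx => hp.time_le j x hx y) hs ht
  have h3 : (matVec (Matrix.of fun j l => spaceGrad (fun t y => p t y j) t y l) v) j
      = fderiv ℝ (fun y => p t y j) y v := by
    rw [← inner_spaceGrad (fun t y => p t y j)]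
    simp [matVec, Matrix.mulVec, dotProduct, PiLp.inner_apply, mul_comm]
  have heq : (p t (y + v) - p s y
      - matVec (Matrix.of fun j l => spaceGrad (fun t y => p t y j) t y l) v) j
      = (p t (y + v) j - p t y j - fderiv ℝ (fun y => p t y j) y v) + (p t y j - p s y j) := by
    rw [← h3]; simp only [PiLp.sub_apply]; ring
  rw [heq]
  refine (abs_add_le _ _).trans ?_
  linarith

lemma IsSmoothNoise.norm_jacobian_le {p : ℝ → Vec m → Vec m} (hp : IsSmoothNoise T p) {t : ℝ}
    (ht : t ∈ Icc (0 : ℝ) T) (y : Vec m) :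
    ‖(Matrix.of fun j l => spaceGrad (fun t y => p t y j) t y l : Mat m m)‖ ≤ m := by
  refine abs_le_of_sq_le_sq' ?_ (by positivity) |>.2
  rw [frobenius_norm_sq]
  have : ∀ j : Fin m, ∑ l, (spaceGrad (fun t y => p t y j) t y l) ^ 2 ≤ 1 := fun j => by
    rw [← EuclideanSpace.real_norm_sq_eq]
    exact pow_le_one₀ (norm_nonneg _) (hp.grad_le j t ht y)
  calc _ ≤ ∑ j : Fin m, (1 : ℝ) := Finset.sum_le_sum fun j _ => by simpa using this j
    _ = m := by simp
    _ ≤ (m : ℝ) ^ 2 := by exact_mod_cast Nat.le_self_pow two_ne_zero m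

/-- For a smooth perturbation `p`, the predictable matrix is the Jacobian of `p` at
`(t_{k+1}, W(t_k))`; what remains is a time increment and a second-order Taylor remainder, both of
the order of the step size, so that `γ = 1`. -/
lemma exists_isPerturbedIncrement_smooth (m : ℕ) (T : ℝ≥0) {r : ℝ} (hr : 2 ≤ r) :
    ∃ c : ℝ, 0 < c ∧ ∀ {Ω : Type u} {_mΩ : MeasurableSpace Ω} {P : Measure Ω}
      [IsProbabilityMeasure P] {𝓕 : Filtration ℝ≥0 _mΩ} {W W' : ℝ≥0 → Ω → Vec m}
      (_ : IsWiener P 𝓕 W) {n : ℕ} (_ : 1 ≤ n) {ξ : ℕ → Ω → ℝ} (_ : IsRandomization P 𝓕 T n ξ)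
      {δ : ℝ} (_ : W' ∈ WSmooth T W δ), ∃ G R q,
        IsPerturbedIncrement (gridFiltration 𝓕 T n ξ) P n r 1 c δ (increment T n W)
          (increment T n W') G R q := by
  have hr0 : 0 < r := by linarith
  set M := gaussianMoment m (2 * r) with hM
  have hM0 : 0 ≤ M := gaussianMoment_nonneg m _
  refine ⟨(m : ℝ) ^ r * 2 ^ r * (((m : ℝ) ^ 2) ^ r * M + 1) * (T : ℝ) ^ r + m + 1, by positivity,
    fun {Ω mΩ P _ 𝓕 W W'} hW {n} hn {ξ} hξ {δ} ⟨p, hp, hp'⟩ => ?_⟩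
  have hn' : (0 : ℝ) < n := by exact_mod_cast hn
  have hT0 : (0 : ℝ) ≤ T := T.coe_nonneg
  have hdrive := hW.isDrivingNoise hξ hn hr
  have hc1 : 0 ≤ (m : ℝ) ^ r * 2 ^ r * (((m : ℝ) ^ 2) ^ r * M + 1) * (T : ℝ) ^ r := by positivity
  have hGmeas : ∀ k < n, EntryMeasurable (gridFiltration 𝓕 T n ξ k) fun ω =>
      (Matrix.of fun j l => spaceGrad (fun t y => p t y j) (grid T n (k + 1))
        (W (grid T n k) ω) l : Mat m m) := by
    intro k hk j l
    have hcont : Continuous fun y => spaceGrad (fun t y => p t y j) (grid T n (k + 1)) y l := by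
      have h1 : Continuous fun y => spaceGrad (fun t y => p t y j) (grid T n (k + 1)) y :=
        (hp.c12 j).cont_grad.comp_continuous (f := fun y => ((grid T n (k + 1) : ℝ), y))
          (by fun_prop) fun y => ⟨grid_mem_Icc hn hk, mem_univ _⟩
      fun_prop
    exact hcont.measurable.comp (hW.measurable_grid k)
  have hRmeas : ∀ k < n, Measurable[gridFiltration 𝓕 T n ξ (k + 1)] fun ω =>
      p (grid T n (k + 1)) (W (grid T n (k + 1)) ω) - p (grid T n k) (W (grid T n k) ω)
        - matVec (Matrix.of fun j l => spaceGrad (fun t y => p t y j) (grid T n (k + 1))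
          (W (grid T n k) ω) l : Mat m m) (increment T n W k ω) := by
    intro k hk
    have hle := gridFiltration_mono (𝓕 := 𝓕) (T := T) (n := n) (ξ := ξ) (Nat.le_succ k)
    refine measurable_sub_vec (measurable_sub_vec
      ((hp.continuous (grid_mem_Icc hn hk)).measurable.comp (hW.measurable_grid _)) ?_) ?_
    · exact (hp.continuous (grid_mem_Icc hn hk.le)).measurable.comp
        ((hW.measurable_grid k).mono hle le_rfl)
    · exact ((hGmeas k hk).mono hle).matVec (hdrive.adapted k hk)
  refine ⟨_, fun k ω => p (grid T n (k + 1)) (W (grid T n (k + 1)) ω)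
      - p (grid T n k) (W (grid T n k) ω)
      - matVec (Matrix.of fun j l => spaceGrad (fun t y => p t y j) (grid T n (k + 1))
        (W (grid T n k) ω) l : Mat m m) (increment T n W k ω),
    fun x => m * ((m : ℝ) ^ 2 * ‖x‖ ^ 2 + T / n), ?_, hGmeas, ?_,
    hRmeas, ?_, by fun_prop, ?_, ?_⟩
  · intro k hk ω
    simp only [increment]
    rw [hp' _ (grid_le hn hk) ω, hp' _ (grid_le hn hk.le) ω, add_sub_cancel, smul_sub]
    abel
  · intro k hk ω
    refine (hp.norm_jacobian_le (grid_mem_Icc hn hk) _).trans ?_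
    linarith
  · intro k hk ω
    have h := hp.remainder_le (grid_mem_Icc hn hk.le) (grid_mem_Icc hn hk) (W (grid T n k) ω)
      (increment T n W k ω)
    rw [grid_succ_sub, abs_of_nonneg (by positivity)] at h
    have hadd : W (grid T n k) ω + increment T n W k ω = W (grid T n (k + 1)) ω := by
      simp [increment]
    rwa [hadd] at h
  all_goals
    intro k hk
    obtain ⟨hi, hv⟩ := hW.increment_moment T n k (q := 2 * r) (by linarith)
    have hpt : ∀ ω, (m * ((m : ℝ) ^ 2 * ‖increment T n W k ω‖ ^ 2 + T / n)) ^ r ≤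
        (m : ℝ) ^ r * (2 ^ r * (((m : ℝ) ^ 2) ^ r * ‖increment T n W k ω‖ ^ (2 * r)
          + ((T : ℝ) / n) ^ r)) := by
      intro ω
      rw [Real.mul_rpow (by positivity) (by positivity)]
      refine mul_le_mul_of_nonneg_left ?_ (by positivity)
      refine (add_rpow_le_two_rpow_mul hr0.le (by positivity) (by positivity)).trans ?_
      rw [Real.mul_rpow (by positivity) (by positivity), Real.rpow_mul (norm_nonneg _),
        Real.rpow_two]
    have hri : Integrable (fun ω => (m : ℝ) ^ r * (2 ^ r * (((m : ℝ) ^ 2) ^ r *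
        ‖increment T n W k ω‖ ^ (2 * r) + ((T : ℝ) / n) ^ r))) P :=
      (((hi.const_mul _).add (integrable_const _)).const_mul _).const_mul _
    have hqi : Integrable
        (fun ω => (m * ((m : ℝ) ^ 2 * ‖increment T n W k ω‖ ^ 2 + T / n)) ^ r) P := by
      refine hri.mono' ?_ (ae_of_all _ fun ω => ?_)
      · have := (hdrive.centred k hk).measurable
        exact (by fun_prop : Measurable fun ω =>
          (m * ((m : ℝ) ^ 2 * ‖increment T n W k ω‖ ^ 2 + T / n)) ^ r).aestronglyMeasurable
      · rw [Real.norm_of_nonneg (by positivity)]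
        exact hpt ω
  · exact hqi
  · refine (integral_mono hqi hri hpt).trans ?_
    rw [integral_const_mul, integral_const_mul, integral_add (hi.const_mul _) (integrable_const _),
      integral_const_mul, hv, integral_const, probReal_univ, one_smul,
      mul_div_cancel_left₀ r two_ne_zero, one_mul, Real.div_rpow hT0 hn'.le, ← hM]
    rw [le_div_iff₀ (by positivity)]
    field_simp
    linarith

/-- A Hölder perturbation is treated entirely as a remainder. -/
lemma exists_isPerturbedIncrement_holder (m : ℕ) (T : ℝ≥0) {r : ℝ} (hr : 2 ≤ r) {α β : ℝ}
    (hα : 0 < α) (hβ : 0 < β) :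
    ∃ c : ℝ, 0 < c ∧ ∀ {Ω : Type u} {_mΩ : MeasurableSpace Ω} {P : Measure Ω}
      [IsProbabilityMeasure P] {𝓕 : Filtration ℝ≥0 _mΩ} {W W' : ℝ≥0 → Ω → Vec m}
      (_ : IsWiener P 𝓕 W) {n : ℕ} (_ : 1 ≤ n) {ξ : ℕ → Ω → ℝ} (_ : IsRandomization P 𝓕 T n ξ)
      {δ : ℝ} (_ : W' ∈ WHolder T α β W δ), ∃ G R q,
        IsPerturbedIncrement (gridFiltration 𝓕 T n ξ) P n r (min α (β / 2)) c δ (increment T n W)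
          (increment T n W') G R q := by
  have hr0 : 0 < r := by linarith
  set M := gaussianMoment m (β * r) with hM
  have hM0 : 0 ≤ M := gaussianMoment_nonneg m _
  have hT0 : (0 : ℝ) ≤ T := T.coe_nonneg
  refine ⟨2 ^ r * ((T : ℝ) ^ (α * r) + (T : ℝ) ^ (β * r / 2) * M) + 1, by positivity,
    fun {Ω mΩ P _ 𝓕 W W'} hW {n} hn {ξ} hξ {δ} ⟨p, hp, hp'⟩ => ?_⟩
  have hn' : (0 : ℝ) < n := by exact_mod_cast hn
  have hdrive := hW.isDrivingNoise hξ hn hr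
  have hc1 : 0 ≤ 2 ^ r * ((T : ℝ) ^ (α * r) + (T : ℝ) ^ (β * r / 2) * M) := by positivity
  have hcont : ∀ t ∈ Icc (0 : ℝ) T, Continuous (p t) := by
    intro t ht
    refine continuous_iff_continuousAt.2 fun x => ?_
    rw [ContinuousAt, tendsto_iff_norm_sub_tendsto_zero]
    have hlim : Filter.Tendsto (fun y : Vec m => ‖y - x‖ ^ β) (nhds x) (nhds 0) := by
      have : ContinuousAt (fun y : Vec m => ‖y - x‖ ^ β) x :=
        ContinuousAt.rpow_const (by fun_prop) (Or.inr hβ.le)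
      simpa [ContinuousAt, Real.zero_rpow hβ.ne'] using this
    refine squeeze_zero (fun _ => norm_nonneg _) (fun y => ?_) hlim
    simpa [Real.zero_rpow hα.ne'] using hp t ht t ht y x
  have hRmeas : ∀ k < n, Measurable[gridFiltration 𝓕 T n ξ (k + 1)] fun ω =>
      p (grid T n (k + 1)) (W (grid T n (k + 1)) ω) - p (grid T n k) (W (grid T n k) ω) := by
    intro k hk
    have hle := gridFiltration_mono (𝓕 := 𝓕) (T := T) (n := n) (ξ := ξ) (Nat.le_succ k)
    exact measurable_sub_vec
      ((hcont _ (grid_mem_Icc hn hk)).measurable.comp (hW.measurable_grid _))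
      ((hcont _ (grid_mem_Icc hn hk.le)).measurable.comp ((hW.measurable_grid k).mono hle le_rfl))
  refine ⟨fun _ _ => 0, fun k ω => p (grid T n (k + 1)) (W (grid T n (k + 1)) ω)
      - p (grid T n k) (W (grid T n k) ω), fun x => ((T : ℝ) / n) ^ α + ‖x‖ ^ β, ?_,
    fun k _ i j => measurable_const, ?_, hRmeas, ?_, by fun_prop, ?_, ?_⟩
  · intro k hk ω
    have h0 : matVec (0 : Mat m m) (increment T n W k ω) = 0 := by simp [matVec]
    rw [h0, zero_add]
    simp only [increment]
    rw [hp' _ (grid_le hn hk) ω, hp' _ (grid_le hn hk.le) ω, smul_sub]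
    abel
  · intro k hk ω
    rw [norm_zero]
    linarith
  · intro k hk ω
    have h := hp _ (grid_mem_Icc hn hk) _ (grid_mem_Icc hn hk.le) (W (grid T n (k + 1)) ω)
      (W (grid T n k) ω)
    rwa [grid_succ_sub, abs_of_nonneg (by positivity)] at h
  all_goals
    intro k hk
    obtain ⟨hi, hv⟩ := hW.increment_moment T n k (q := β * r) (by positivity)
    have hpt : ∀ ω, (((T : ℝ) / n) ^ α + ‖increment T n W k ω‖ ^ β) ^ r ≤
        2 ^ r * (((T : ℝ) / n) ^ (α * r) + ‖increment T n W k ω‖ ^ (β * r)) := by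
      intro ω
      refine (add_rpow_le_two_rpow_mul hr0.le (by positivity) (by positivity)).trans ?_
      rw [Real.rpow_mul (norm_nonneg _), Real.rpow_mul (by positivity)]
    have hri : Integrable (fun ω => 2 ^ r * (((T : ℝ) / n) ^ (α * r)
        + ‖increment T n W k ω‖ ^ (β * r))) P :=
      ((integrable_const _).add hi).const_mul _
    have hqi : Integrable (fun ω => (((T : ℝ) / n) ^ α + ‖increment T n W k ω‖ ^ β) ^ r) P := by
      refine hri.mono' ?_ (ae_of_all _ fun ω => ?_)
      · have := (hdrive.centred k hk).measurable
        exact (by fun_prop : Measurable fun ω =>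
          (((T : ℝ) / n) ^ α + ‖increment T n W k ω‖ ^ β) ^ r).aestronglyMeasurable
      · rw [Real.norm_of_nonneg (by positivity)]
        exact hpt ω
  · exact hqi
  · refine (integral_mono hqi hri hpt).trans ?_
    rw [integral_const_mul, integral_add (integrable_const _) hi, hv, integral_const,
      probReal_univ, one_smul, ← hM]
    have h1 : ((T : ℝ) / n) ^ (α * r) ≤ (T : ℝ) ^ (α * r) / (n : ℝ) ^ (min α (β / 2) * r) :=
      div_rpow_le_div_rpow hT0 hn (by gcongr; exact min_le_left ..)
    have h2 : ((T : ℝ) / n) ^ (β * r / 2) ≤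
        (T : ℝ) ^ (β * r / 2) / (n : ℝ) ^ (min α (β / 2) * r) := by
      refine div_rpow_le_div_rpow hT0 hn ?_
      calc min α (β / 2) * r ≤ β / 2 * r := by gcongr; exact min_le_right ..
        _ = β * r / 2 := by ring
    calc _ ≤ 2 ^ r * ((T : ℝ) ^ (α * r) / (n : ℝ) ^ (min α (β / 2) * r)
          + (T : ℝ) ^ (β * r / 2) / (n : ℝ) ^ (min α (β / 2) * r) * M) := by gcongr
      _ = 2 ^ r * ((T : ℝ) ^ (α * r) + (T : ℝ) ^ (β * r / 2) * M) /
          (n : ℝ) ^ (min α (β / 2) * r) := by ring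
      _ ≤ _ := by gcongr; linarith

end Perturbation

/-! ### Coefficients of linear growth -/

section Coefficients

variable {d m : ℕ} {T : ℝ≥0}

/-- Coefficients that are measurable and grow at most linearly, with common constant `κ`. -/
structure HasLinearGrowth (T : ℝ≥0) (κ : ℝ) (a : ℝ → Vec d → Vec d) (b : ℝ → Vec d → Mat d m) :
    Prop where
  measurable_drift : Measurable (fun q : Icc (0 : ℝ) T × Vec d => a q.1 q.2)
  drift_le : ∀ t ∈ Icc (0 : ℝ) T, ∀ x, ‖a t x‖ ≤ κ * (1 + ‖x‖)
  measurable_diffusion : ∀ t ∈ Icc (0 : ℝ) T, ∀ i j, Measurable fun x => b t x i j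
  diffusion_le : ∀ t ∈ Icc (0 : ℝ) T, ∀ x, ‖b t x‖ ≤ κ * (1 + ‖x‖)

lemma IsDiffusion.norm_le {ϱ K : ℝ} {b : ℝ → Vec d → Mat d m} (hb : IsDiffusion T ϱ K b)
    (hK : 0 ≤ K) (hϱ : 0 ≤ ϱ) {t : ℝ} (ht : t ∈ Icc (0 : ℝ) T) (x : Vec d) :
    ‖b t x‖ ≤ K * (1 + (T : ℝ) ^ ϱ) * (1 + ‖x‖) := by
  have h0 : (0 : ℝ) ∈ Icc (0 : ℝ) T := ⟨le_rfl, T.coe_nonneg⟩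
  have h1 := hb.lipschitz t ht x 0
  have h2 := hb.holder t ht 0 h0 0
  have h3 := hb.bound
  rw [sub_zero] at h1
  rw [norm_zero, add_zero, mul_one, sub_zero, abs_of_nonneg ht.1] at h2
  have h4 : t ^ ϱ ≤ (T : ℝ) ^ ϱ := Real.rpow_le_rpow ht.1 ht.2 hϱ
  have h5 : ‖b t x‖ ≤ ‖b t x - b t 0‖ + ‖b t 0 - b 0 0‖ + ‖b 0 0‖ := by
    calc ‖b t x‖ = ‖(b t x - b t 0) + (b t 0 - b 0 0) + b 0 0‖ := by congr 1; abel
      _ ≤ _ := norm_add₃_le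
  have h6 : 0 ≤ (T : ℝ) ^ ϱ := Real.rpow_nonneg T.coe_nonneg _
  have h7 := mul_le_mul_of_nonneg_left h4 hK
  nlinarith [mul_nonneg (mul_nonneg hK h6) (norm_nonneg x)]

lemma IsDiffusion.measurable_entry {ϱ K : ℝ} {b : ℝ → Vec d → Mat d m} (hb : IsDiffusion T ϱ K b)
    {t : ℝ} (ht : t ∈ Icc (0 : ℝ) T) (i : Fin d) (j : Fin m) : Measurable fun x => b t x i j := by
  refine (LipschitzWith.of_dist_le_mul (K := K.toNNReal) fun x y => ?_).continuous.measurable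
  rw [Real.dist_eq, dist_eq_norm]
  calc |b t x i j - b t y i j| ≤ ‖b t x - b t y‖ := abs_entry_le_norm (b t x - b t y) i j
    _ ≤ K * ‖x - y‖ := hb.lipschitz t ht x y
    _ ≤ _ := by gcongr; exact Real.le_coe_toNNReal K

lemma IsDrift.norm_le {K : ℝ} {a : ℝ → Vec d → Vec d} (ha : IsDrift T K a) {t : ℝ}
    (ht : t ∈ Icc (0 : ℝ) T) (x : Vec d) : ‖a t x‖ ≤ K * (1 + ‖x‖) := by
  have h1 := ha.lipschitz t ht x 0
  have h2 := ha.bound t ht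
  rw [sub_zero] at h1
  have h3 : ‖a t x‖ ≤ ‖a t x - a t 0‖ + ‖a t 0‖ := by
    simpa using norm_add_le (a t x - a t 0) (a t 0)
  linarith

lemma IsAdmissible.hasLinearGrowth_of_mem {ϱ K δ₁ δ₂ : ℝ} {a a' : ℝ → Vec d → Vec d}
    {b b' : ℝ → Vec d → Mat d m} {η : Vec d} (h : IsAdmissible T ϱ K a b η) (hK : 0 ≤ K)
    (hϱ : 0 ≤ ϱ) (hδ₁ : δ₁ ∈ Icc (0 : ℝ) 1) (hδ₂ : δ₂ ∈ Icc (0 : ℝ) 1) (ha' : a' ∈ VDrift T a δ₁)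
    (hb' : b' ∈ VDiffusion T b δ₂) : HasLinearGrowth T (K * (1 + (T : ℝ) ^ ϱ) + 1) a' b' := by
  obtain ⟨p, hp, hpa⟩ := ha'
  obtain ⟨s, hs, hsb⟩ := hb'
  have hT : 0 ≤ (T : ℝ) ^ ϱ := Real.rpow_nonneg T.coe_nonneg _
  refine ⟨?_, fun t ht x => ?_, fun t ht i j => ?_, fun t ht x => ?_⟩
  · have heq : (fun q : Icc (0 : ℝ) T × Vec d => a' q.1 q.2) =
        fun q : Icc (0 : ℝ) T × Vec d => a q.1 q.2 + δ₁ • p q.1 q.2 := by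
      ext1 q; exact hpa q.1 q.1.2 q.2
    rw [heq]
    exact h.drift.measurable.add (hp.measurable.const_smul δ₁)
  · rw [hpa t ht x]
    have h1 := h.drift.norm_le ht x
    have h2 := hp.growth t ht x
    refine (norm_add_le _ _).trans ?_
    rw [norm_smul, Real.norm_of_nonneg hδ₁.1]
    have h3 : δ₁ * ‖p t x‖ ≤ 1 * (1 + ‖x‖) :=
      mul_le_mul hδ₁.2 h2 (norm_nonneg _) zero_le_one
    nlinarith [mul_nonneg (mul_nonneg hK hT) (norm_nonneg x), mul_nonneg hK hT]
  · have heq : (fun x => b' t x i j) = fun x => b t x i j + δ₂ * s t x i j := by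
      ext1 x; rw [hsb t ht x]; simp
    rw [heq]
    have hm := (hs.measurable i j).comp (measurable_prodMk_left (x := (⟨t, ht⟩ : Icc (0 : ℝ) T)))
    exact (h.diffusion.measurable_entry ht i j).add (hm.const_mul δ₂)
  · rw [hsb t ht x]
    have h1 := h.diffusion.norm_le hK hϱ ht x
    have h2 := hs.growth t ht x
    refine (norm_add_le _ _).trans ?_
    rw [norm_smul, Real.norm_of_nonneg hδ₂.1]
    have h3 : δ₂ * ‖s t x‖ ≤ 1 * (1 + ‖x‖) :=
      mul_le_mul hδ₂.2 h2 (norm_nonneg _) zero_le_one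
    linarith

lemma mem_VDrift_zero {a : ℝ → Vec d → Vec d} : a ∈ VDrift T a 0 :=
  ⟨fun _ _ => 0, ⟨measurable_const, fun t _ y => by rw [norm_zero]; positivity⟩,
    fun t _ y => by simp⟩

lemma mem_VDiffusion_zero {b : ℝ → Vec d → Mat d m} : b ∈ VDiffusion T b 0 :=
  ⟨fun _ _ => 0, ⟨fun _ _ => measurable_const, fun t _ y => by rw [norm_zero]; positivity⟩,
    fun t _ y => by simp⟩

end Coefficients

/-! ### The scheme as a recursion driven by noise -/

section Scheme

variable {d m : ℕ} {T : ℝ≥0} {Ω : Type u} {mΩ : MeasurableSpace Ω} {P : Measure Ω}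
  {𝓕 : Filtration ℝ≥0 mΩ} {n : ℕ} {ξ : ℕ → Ω → ℝ}

lemma HasLinearGrowth.measurable_drift_comp {κ : ℝ} {a : ℝ → Vec d → Vec d}
    {b : ℝ → Vec d → Mat d m} (h : HasLinearGrowth T κ a b) {𝒢 : MeasurableSpace Ω} {τ : Ω → ℝ}
    (hτ : Measurable[𝒢] τ) (hτT : ∀ ω, τ ω ∈ Icc (0 : ℝ) T) {X : Ω → Vec d}
    (hX : Measurable[𝒢] X) : Measurable[𝒢] fun ω => a (τ ω) (X ω) :=
  h.measurable_drift.comp ((hτ.subtype_mk (h := hτT)).prodMk hX)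

/-- The process produced by the scheme. -/
noncomputable def eulerPath (T : ℝ≥0) (n : ℕ) (a : ℝ → Vec d → Vec d)
    (b : ℝ → Vec d → Mat d m) (η : Vec d) (W : ℝ≥0 → Ω → Vec m) (ξ : ℕ → Ω → ℝ) (k : ℕ) (ω : Ω) :
    Vec d :=
  euler T n a b η (fun t => W t ω) (fun i => ξ i ω) k

lemma eulerPath_succ (T : ℝ≥0) (n : ℕ) (a : ℝ → Vec d → Vec d)
    (b : ℝ → Vec d → Mat d m) (η : Vec d) (W : ℝ≥0 → Ω → Vec m) (ξ : ℕ → Ω → ℝ) (k : ℕ) (ω : Ω) :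
    eulerPath T n a b η W ξ (k + 1) ω = eulerPath T n a b η W ξ k ω
      + ((T : ℝ) / n) • a (ξ k ω) (eulerPath T n a b η W ξ k ω)
      + matVec (b (grid T n k) (eulerPath T n a b η W ξ k ω)) (increment T n W k ω) := rfl

lemma HasLinearGrowth.measurable_eulerPath {κ : ℝ} {a : ℝ → Vec d → Vec d}
    {b : ℝ → Vec d → Mat d m} (h : HasLinearGrowth T κ a b) (hξ : IsRandomization P 𝓕 T n ξ)
    (hn : 1 ≤ n) (η : Vec d) {W : ℝ≥0 → Ω → Vec m}
    (hW : ∀ k < n, Measurable[gridFiltration 𝓕 T n ξ (k + 1)] (increment T n W k)) :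
    ∀ k ≤ n, Measurable[gridFiltration 𝓕 T n ξ k] (eulerPath T n a b η W ξ k) := by
  intro k
  induction k with
  | zero => intro _; exact measurable_const
  | succ k ih =>
    intro hk
    have hle := gridFiltration_mono (𝓕 := 𝓕) (T := T) (n := n) (ξ := ξ) (Nat.le_succ k)
    have hX := (ih (by omega)).mono hle le_rfl
    have hξk : Measurable[gridFiltration 𝓕 T n ξ (k + 1)] (ξ k) :=
      (comap_measurable (ξ k)).mono (le_sup_of_le_right
        (le_iSup (fun i : Fin n => MeasurableSpace.comap (ξ i) inferInstance) ⟨k, hk⟩)) le_rfl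
    refine measurable_add_vec (measurable_add_vec hX (measurable_const_smul_vec _
      (h.measurable_drift_comp hξk (hξ.mem k hk) hX))) (EntryMeasurable.matVec (fun i j => ?_)
        (hW k hk))
    exact (h.measurable_diffusion _ (grid_mem_Icc hn (by omega)) i j).comp hX

/-- The `r`-th moment of a drift term: a part of size `1 / n`, and a part carrying the remainder of
the disturbed increments, whose factor `H` is independent of that remainder. -/
lemma IsPerturbedIncrement.drift_moment_le [IsProbabilityMeasure P] {𝒢 : ℕ → MeasurableSpace Ω}
    {r γ c δ v : ℝ} {Δ Δ' : ℕ → Ω → Vec m} {G : ℕ → Ω → Mat m m} {R : ℕ → Ω → Vec m}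
    {q : Vec m → ℝ} (h : IsPerturbedIncrement 𝒢 P n r γ c δ Δ Δ' G R q)
    (hΔ : IsDrivingNoise 𝒢 P n r v Δ) (hr : 2 ≤ r) (hn : 1 ≤ n) (hδ : 0 ≤ δ) {k : ℕ} (hk : k < n)
    {U : Ω → Vec d} (hU : Measurable U) {F H : Ω → ℝ} (hF0 : ∀ ω, 0 ≤ F ω) (hH0 : ∀ ω, 0 ≤ H ω)
    (hH : Measurable[𝒢 k] H) (hFi : Integrable (fun ω => F ω ^ r) P)
    (hHi : Integrable (fun ω => H ω ^ r) P)
    (hle : ∀ ω, ‖U ω‖ ≤ F ω / n + δ * H ω * ‖R k ω‖) :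
    Integrable (fun ω => ‖U ω‖ ^ r) P ∧
      (n : ℝ) ^ r * ∫ ω, ‖U ω‖ ^ r ∂P ≤ 2 ^ r * (∫ ω, F ω ^ r ∂P
        + c * (δ * (n : ℝ) ^ (1 - γ)) ^ r * ∫ ω, H ω ^ r ∂P) := by
  have hr0 : 0 ≤ r := by linarith
  have hn' : (0 : ℝ) < n := by exact_mod_cast hn
  have hq0 : ∀ ω, 0 ≤ q (Δ k ω) := fun ω => (norm_nonneg _).trans (h.remainder_le k hk ω)
  obtain ⟨hi, hv⟩ := integral_mul_comp (hΔ.centred k hk).indep (hH.pow_const r) hHi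
    (φ := fun x => q x ^ r) (h.measurable_bound.pow_const r) (h.integrable k hk)
  have hpt : ∀ ω, ‖U ω‖ ^ r ≤
      2 ^ r * (F ω ^ r / (n : ℝ) ^ r + δ ^ r * (H ω ^ r * q (Δ k ω) ^ r)) := by
    intro ω
    have h1 : ‖U ω‖ ≤ F ω / n + δ * (H ω * q (Δ k ω)) := by
      refine (hle ω).trans ?_
      rw [mul_assoc]
      gcongr
      · exact hH0 ω
      · exact h.remainder_le k hk ω
    have h2 : 0 ≤ H ω * q (Δ k ω) := mul_nonneg (hH0 ω) (hq0 ω)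
    refine (Real.rpow_le_rpow (norm_nonneg _) h1 hr0).trans ?_
    refine (add_rpow_le_two_rpow_mul hr0 (div_nonneg (hF0 ω) hn'.le) (mul_nonneg hδ h2)).trans ?_
    rw [Real.div_rpow (hF0 ω) hn'.le, Real.mul_rpow hδ h2, Real.mul_rpow (hH0 ω) (hq0 ω)]
  have hri : Integrable (fun ω =>
      2 ^ r * (F ω ^ r / (n : ℝ) ^ r + δ ^ r * (H ω ^ r * q (Δ k ω) ^ r))) P :=
    ((hFi.div_const _).add (hi.const_mul _)).const_mul _
  have hUi : Integrable (fun ω => ‖U ω‖ ^ r) P := by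
    refine hri.mono' (hU.norm.pow_const r).aestronglyMeasurable (ae_of_all _ fun ω => ?_)
    rw [Real.norm_of_nonneg (by positivity)]
    exact hpt ω
  refine ⟨hUi, ?_⟩
  have hHr : 0 ≤ ∫ ω, H ω ^ r ∂P := integral_nonneg fun ω => Real.rpow_nonneg (hH0 ω) r
  have hpow : (n : ℝ) ^ r * (1 / (n : ℝ) ^ (γ * r)) = ((n : ℝ) ^ (1 - γ)) ^ r := by
    rw [mul_one_div, ← Real.rpow_sub hn', ← Real.rpow_mul hn'.le]
    congr 1; ring
  calc (n : ℝ) ^ r * ∫ ω, ‖U ω‖ ^ r ∂P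
      ≤ (n : ℝ) ^ r * (2 ^ r * ((∫ ω, F ω ^ r ∂P) / (n : ℝ) ^ r
        + δ ^ r * ((∫ ω, H ω ^ r ∂P) * ∫ ω, q (Δ k ω) ^ r ∂P))) := by
        gcongr
        refine (integral_mono hUi hri hpt).trans (le_of_eq ?_)
        rw [integral_const_mul, integral_add (hFi.div_const _) (hi.const_mul _), integral_div,
          integral_const_mul, hv]
    _ ≤ (n : ℝ) ^ r * (2 ^ r * ((∫ ω, F ω ^ r ∂P) / (n : ℝ) ^ r
        + δ ^ r * ((∫ ω, H ω ^ r ∂P) * (c / (n : ℝ) ^ (γ * r))))) := by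
        have := h.integral_le k hk
        gcongr
    _ = 2 ^ r * (∫ ω, F ω ^ r ∂P
        + c * (δ ^ r * ((n : ℝ) ^ r * (1 / (n : ℝ) ^ (γ * r)))) * ∫ ω, H ω ^ r ∂P) := by
        field_simp
    _ = _ := by rw [hpow, ← Real.mul_rpow hδ (by positivity)]

lemma IsPerturbedIncrement.adapted_increment [IsProbabilityMeasure P]
    {𝒢 : ℕ → MeasurableSpace Ω} {r γ c δ v : ℝ} {Δ Δ' : ℕ → Ω → Vec m} {G : ℕ → Ω → Mat m m}
    {R : ℕ → Ω → Vec m} {q : Vec m → ℝ} (h : IsPerturbedIncrement 𝒢 P n r γ c δ Δ Δ' G R q)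
    (hΔ : IsDrivingNoise 𝒢 P n r v Δ) {k : ℕ} (hk : k < n) : Measurable[𝒢 (k + 1)] (Δ' k) := by
  have heq : Δ' k = fun ω => Δ k ω + δ • (matVec (G k ω) (Δ k ω) + R k ω) := by
    ext1 ω; exact h.eq k hk ω
  rw [heq]
  exact measurable_add_vec (hΔ.adapted k hk) (measurable_const_smul_vec _ (measurable_add_vec
    (((h.predictable k hk).mono (hΔ.mono (Nat.le_succ k))).matVec (hΔ.adapted k hk))
    (h.adapted k hk)))

lemma EntryMeasurable.add_smul_mul {𝒢 : MeasurableSpace Ω} {A : Ω → Mat d m} {G : Ω → Mat m m}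
    (hA : EntryMeasurable 𝒢 A) (hG : EntryMeasurable 𝒢 G) (δ : ℝ) :
    EntryMeasurable 𝒢 fun ω => A ω + δ • (A ω * G ω) := by
  intro i j
  have h1 := fun i j => hA i j
  have h2 := fun i j => hG i j
  simp only [Matrix.add_apply, Matrix.smul_apply, Matrix.mul_apply, smul_eq_mul]
  fun_prop

lemma EntryMeasurable.sub {𝒢 : MeasurableSpace Ω} {A B : Ω → Mat d m}
    (hA : EntryMeasurable 𝒢 A) (hB : EntryMeasurable 𝒢 B) :
    EntryMeasurable 𝒢 fun ω => A ω - B ω := fun i j => (hA i j).sub (hB i j)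

lemma integrable_one_add_norm_rpow [IsProbabilityMeasure P] {r : ℝ} (hr : 0 ≤ r) {X : Ω → Vec d}
    (hX : Measurable X) (hXi : Integrable (fun ω => ‖X ω‖ ^ r) P) :
    Integrable (fun ω => (1 + ‖X ω‖) ^ r) P ∧
      ∫ ω, (1 + ‖X ω‖) ^ r ∂P ≤ 2 ^ r * (1 + ∫ ω, ‖X ω‖ ^ r ∂P) := by
  have hpt : ∀ ω, (1 + ‖X ω‖) ^ r ≤ 2 ^ r * (1 + ‖X ω‖ ^ r) := fun ω => by
    simpa using add_rpow_le_two_rpow_mul hr zero_le_one (norm_nonneg (X ω))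
  have hri : Integrable (fun ω => 2 ^ r * (1 + ‖X ω‖ ^ r)) P :=
    ((integrable_const _).add hXi).const_mul _
  have hi : Integrable (fun ω => (1 + ‖X ω‖) ^ r) P := by
    refine hri.mono' (by fun_prop : Measurable fun ω => (1 + ‖X ω‖) ^ r).aestronglyMeasurable
      (ae_of_all _ fun ω => ?_)
    rw [Real.norm_of_nonneg (by positivity)]
    exact hpt ω
  refine ⟨hi, (integral_mono hi hri hpt).trans (le_of_eq ?_)⟩
  rw [integral_const_mul, integral_add (integrable_const _) hXi, integral_const, probReal_univ,
    one_smul]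

/-- Moments of the scheme run with disturbed data. -/
lemma exists_integral_eulerPath_le (T : ℝ≥0) {r v κ c K γ : ℝ} (hr : 2 ≤ r) (hv : 0 ≤ v)
    (hκ : 0 ≤ κ) (hc : 0 ≤ c) (hK : 0 ≤ K) : ∃ C : ℝ, 0 < C ∧
    ∀ {d m : ℕ} {Ω : Type u} {mΩ : MeasurableSpace Ω} {P : Measure Ω}
      [IsProbabilityMeasure P] {𝓕 : Filtration ℝ≥0 mΩ} {n : ℕ} (_ : 1 ≤ n) {ξ : ℕ → Ω → ℝ}
      (_ : IsRandomization P 𝓕 T n ξ) {Δ : ℕ → Ω → Vec m}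
      (_ : IsDrivingNoise (gridFiltration 𝓕 T n ξ) P n r v Δ) {W' : ℝ≥0 → Ω → Vec m}
      {δ : ℝ} (_ : δ ∈ Icc (0 : ℝ) 1) {G : ℕ → Ω → Mat m m} {R : ℕ → Ω → Vec m} {q : Vec m → ℝ}
      (_ : IsPerturbedIncrement (gridFiltration 𝓕 T n ξ) P n r γ c δ Δ (increment T n W') G R q)
      {a : ℝ → Vec d → Vec d} {b : ℝ → Vec d → Mat d m} (_ : HasLinearGrowth T κ a b)
      {η : Vec d} (_ : ‖η‖ ≤ K),
      ∀ k ≤ n, Integrable (fun ω => ‖eulerPath T n a b η W' ξ k ω‖ ^ r) P ∧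
        ∫ ω, ‖eulerPath T n a b η W' ξ k ω‖ ^ r ∂P ≤
          C * Real.exp (C * (1 + (δ * (n : ℝ) ^ (1 - γ)) ^ r)) := by
  obtain ⟨C₀, hC₀, hmain⟩ := exists_integral_partialSups_le_exp.{u} hr hv
  have hr0 : 0 ≤ r := by linarith
  have hT0 : (0 : ℝ) ≤ T := T.coe_nonneg
  -- The constant in the linear growth, in the `L^r` sense, of the drift and diffusion terms.
  set C₁ := 2 ^ r * (2 ^ r * (T * κ) ^ r + c * (2 ^ r * κ ^ r)) + 2 ^ r * (κ * (1 + c)) ^ r with hC₁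
  have hC₁0 : 0 ≤ C₁ := by positivity
  refine ⟨C₀ * (K ^ r + C₁ + 1) + C₀ * C₁ + 1, by positivity,
    fun {d m Ω mΩ P _ 𝓕 n} hn {ξ} hξ {Δ} hΔ {W' δ} hδ {G R q} hpert {a b} hab {η} hη k hk => ?_⟩
  have hn' : (1 : ℝ) ≤ n := by exact_mod_cast hn
  set X := eulerPath T n a b η W' ξ with hX
  have hXm : ∀ k ≤ n, Measurable[gridFiltration 𝓕 T n ξ k] (X k) :=
    hab.measurable_eulerPath hξ hn η fun k hk => hpert.adapted_increment hΔ hk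
  have hXm' : ∀ k ≤ n, Measurable (X k) := fun k hk => (hXm k hk).mono (hΔ.le k) le_rfl
  have hbm : ∀ k < n, EntryMeasurable (gridFiltration 𝓕 T n ξ k)
      fun ω => b (grid T n k) (X k ω) := fun k hk i j =>
    (hab.measurable_diffusion _ (grid_mem_Icc hn hk.le) i j).comp (hXm k hk.le)
  set ε := δ * (n : ℝ) ^ (1 - γ) with hε
  have hε0 : 0 ≤ ε := mul_nonneg hδ.1 (by positivity)
  have hεr : 0 ≤ ε ^ r := Real.rpow_nonneg hε0 r
  set U : ℕ → Ω → Vec d := fun k ω => ((T : ℝ) / n) • a (ξ k ω) (X k ω)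
    + δ • matVec (b (grid T n k) (X k ω)) (R k ω) with hU
  set B : ℕ → Ω → Mat d m := fun k ω => b (grid T n k) (X k ω)
    + δ • (b (grid T n k) (X k ω) * G k ω) with hB
  have hrec : ∀ k < n, ∀ ω, X (k + 1) ω = X k ω + U k ω + matVec (B k ω) (Δ k ω) := by
    intro k hk ω
    rw [hX, eulerPath_succ, ← hX, hpert.eq k hk ω]
    simp only [hU, hB, matVec_add, matVec_smul, add_matVec, smul_matVec, matVec_mul, smul_add]
    abel
  have hBm : ∀ k < n, EntryMeasurable (gridFiltration 𝓕 T n ξ k) (B k) := fun k hk =>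
    (hbm k hk).add_smul_mul (hpert.predictable k hk) δ
  have hlin : ∀ k < n, Integrable (fun ω => ‖X k ω‖ ^ r) P →
      Integrable (fun ω => ‖U k ω‖ ^ r) P ∧ Integrable (fun ω => ‖B k ω‖ ^ r) P ∧
      (n : ℝ) ^ r * ∫ ω, ‖U k ω‖ ^ r ∂P + ∫ ω, ‖B k ω‖ ^ r ∂P
        ≤ C₁ * (1 + ε ^ r) + C₁ * (1 + ε ^ r) * ∫ ω, ‖X k ω‖ ^ r ∂P := by
    intro k hk hXi
    obtain ⟨hYi, hYle⟩ := integrable_one_add_norm_rpow hr0 (hXm' k hk.le) hXi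
    have hscale : ∀ s : ℝ, 0 ≤ s → Integrable (fun ω => (s * (1 + ‖X k ω‖)) ^ r) P ∧
        ∫ ω, (s * (1 + ‖X k ω‖)) ^ r ∂P = s ^ r * ∫ ω, (1 + ‖X k ω‖) ^ r ∂P := by
      intro s hs
      have : ∀ ω, (s * (1 + ‖X k ω‖)) ^ r = s ^ r * (1 + ‖X k ω‖) ^ r := fun ω =>
        Real.mul_rpow hs (by positivity)
      simp only [this]
      exact ⟨hYi.const_mul _, integral_const_mul _ _⟩
    have hξm : Measurable (ξ k) := hξ.measurable k hk
    have hUm : Measurable (U k) := by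
      have h1 := hab.measurable_drift_comp hξm (hξ.mem k hk) (hXm' k hk.le)
      have h2 := ((hbm k hk).mono (hΔ.le k)).matVec ((hpert.adapted k hk).mono (hΔ.le _) le_rfl)
      exact measurable_add_vec (measurable_const_smul_vec _ h1) (measurable_const_smul_vec _ h2)
    obtain ⟨hUi, hUle⟩ := hpert.drift_moment_le hΔ hr hn hδ.1 hk hUm
      (F := fun ω => T * κ * (1 + ‖X k ω‖)) (H := fun ω => κ * (1 + ‖X k ω‖))
      (fun ω => by positivity) (fun ω => by positivity)
      (((measurable_norm_vec (hXm k hk.le)).const_add 1).const_mul κ)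
      (hscale _ (by positivity)).1 (hscale _ hκ).1 (fun ω => by
        refine (norm_add_le _ _).trans ?_
        rw [norm_smul, norm_smul, Real.norm_of_nonneg (by positivity), Real.norm_of_nonneg hδ.1]
        have h1 := hab.drift_le _ (hξ.mem k hk ω) (X k ω)
        have h2 := hab.diffusion_le _ (grid_mem_Icc hn hk.le) (X k ω)
        have h3 := norm_matVec_le (b (grid T n k) (X k ω)) (R k ω)
        have hδ0 := hδ.1
        calc _ ≤ (T : ℝ) / n * (κ * (1 + ‖X k ω‖)) + δ * ((κ * (1 + ‖X k ω‖)) * ‖R k ω‖) := by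
              gcongr
              exact h3.trans (by gcongr)
          _ = _ := by ring)
    rw [(hscale _ (by positivity)).2, (hscale _ hκ).2] at hUle
    have hBpt : ∀ ω, ‖B k ω‖ ^ r ≤ (κ * (1 + c) * (1 + ‖X k ω‖)) ^ r := by
      intro ω
      refine Real.rpow_le_rpow (norm_nonneg _) ?_ hr0
      have h2 := hab.diffusion_le _ (grid_mem_Icc hn hk.le) (X k ω)
      refine (norm_add_le _ _).trans ?_
      rw [norm_smul, Real.norm_of_nonneg hδ.1]
      have h3 := Matrix.frobenius_norm_mul (b (grid T n k) (X k ω)) (G k ω)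
      have h4 := hpert.norm_le k hk ω
      calc _ ≤ κ * (1 + ‖X k ω‖) + 1 * ((κ * (1 + ‖X k ω‖)) * c) := by
            gcongr
            · exact hδ.2
            · exact h3.trans (by gcongr)
        _ = _ := by ring
    have hs := hscale (κ * (1 + c)) (by positivity)
    have hBi : Integrable (fun ω => ‖B k ω‖ ^ r) P := by
      refine hs.1.mono' (((hBm k hk).mono (hΔ.le k)).norm.pow_const r).aestronglyMeasurable
        (ae_of_all _ fun ω => ?_)
      rw [Real.norm_of_nonneg (by positivity)]
      exact hBpt ω
    refine ⟨hUi, hBi, ?_⟩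
    have hBle := integral_mono hBi hs.1 hBpt
    rw [hs.2] at hBle
    set x := ∫ ω, ‖X k ω‖ ^ r ∂P
    set y := ∫ ω, (1 + ‖X k ω‖) ^ r ∂P
    have hx : 0 ≤ x := integral_nonneg fun ω => by positivity
    calc _ ≤ 2 ^ r * ((T * κ) ^ r * y + c * ε ^ r * (κ ^ r * y)) + (κ * (1 + c)) ^ r * y :=
          add_le_add hUle hBle
      _ ≤ 2 ^ r * ((T * κ) ^ r * (2 ^ r * (1 + x)) + c * ε ^ r * (κ ^ r * (2 ^ r * (1 + x))))
          + (κ * (1 + c)) ^ r * (2 ^ r * (1 + x)) := by gcongr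
      _ = (2 ^ r * (2 ^ r * (T * κ) ^ r) + 2 ^ r * (κ * (1 + c)) ^ r) * (1 + x)
          + 2 ^ r * (c * (2 ^ r * κ ^ r)) * ε ^ r * (1 + x) := by ring
      _ ≤ C₁ * (1 + x) + C₁ * ε ^ r * (1 + x) := by
          have h1 : 0 ≤ 2 ^ r * (c * (2 ^ r * κ ^ r)) := by positivity
          have h2 : 0 ≤ 2 ^ r * (2 ^ r * (T * κ) ^ r) := by positivity
          have h3 : 0 ≤ 2 ^ r * (κ * (1 + c)) ^ r := by positivity
          have h4 : C₁ = 2 ^ r * (2 ^ r * (T * κ) ^ r) + 2 ^ r * (c * (2 ^ r * κ ^ r))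
            + 2 ^ r * (κ * (1 + c)) ^ r := by rw [hC₁]; ring
          gcongr <;> linarith
      _ = _ := by ring
  have hA : 0 ≤ C₁ * (1 + ε ^ r) := by positivity
  obtain ⟨hMi, hXi, hle⟩ := hmain hn hΔ hBm hXm' hrec (ζ := K) (fun ω => hη) hA hA hlin
  refine ⟨hXi k hk, ?_⟩
  have h1 : ∫ ω, ‖X k ω‖ ^ r ∂P ≤ ∫ ω, partialSups (fun i => ‖X i ω‖) n ^ r ∂P :=
    integral_mono (hXi k hk) hMi fun ω => Real.rpow_le_rpow (norm_nonneg _)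
      (le_partialSups_of_le (fun i => ‖X i ω‖) hk) hr0
  refine (h1.trans hle).trans ?_
  -- The factor `1 + ε ^ r` in front is absorbed by the exponential.
  have hexp : 1 + ε ^ r ≤ Real.exp (1 + ε ^ r) := by
    linarith [Real.add_one_le_exp (1 + ε ^ r)]
  have hexp1 : 1 ≤ Real.exp (1 + ε ^ r) := Real.one_le_exp (by positivity)
  have hK0 : 0 ≤ K ^ r := by positivity
  have hpos1 : 0 ≤ C₀ * (K ^ r + C₁ + 1) := by positivity
  have hpos2 : 0 ≤ C₀ * C₁ := by positivity
  calc C₀ * (K ^ r + C₁ * (1 + ε ^ r)) * Real.exp (C₀ * (C₁ * (1 + ε ^ r)))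
      ≤ C₀ * (K ^ r * Real.exp (1 + ε ^ r) + C₁ * Real.exp (1 + ε ^ r))
        * Real.exp (C₀ * (C₁ * (1 + ε ^ r))) := by
        gcongr
        exact le_mul_of_one_le_right hK0 hexp1
    _ = C₀ * (K ^ r + C₁) * Real.exp ((C₀ * C₁ + 1) * (1 + ε ^ r)) := by
        rw [add_one_mul, Real.exp_add (C₀ * C₁ * (1 + ε ^ r)), mul_assoc C₀ C₁]
        generalize Real.exp (C₀ * (C₁ * (1 + ε ^ r))) = x
        generalize Real.exp (1 + ε ^ r) = y
        ring
    _ ≤ _ := by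
        gcongr
        · linarith
        · linarith

end Scheme

/-! ### The error of the scheme -/

section Error

lemma maxGap_eq_partialSups {d m : ℕ} {Ω : Type u} (T : ℝ≥0) (n : ℕ)
    (a : ℝ → Vec d → Vec d) (b : ℝ → Vec d → Mat d m) (W : ℝ≥0 → Ω → Vec m)
    (a' : ℝ → Vec d → Vec d) (b' : ℝ → Vec d → Mat d m) (W' : ℝ≥0 → Ω → Vec m)
    (η : Vec d) (ξ : ℕ → Ω → ℝ) (ω : Ω) :
    maxGap T n a b W a' b' W' η ξ ω =
      partialSups (fun k => ‖eulerPath T n a b η W ξ k ω - eulerPath T n a' b' η W' ξ k ω‖)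
        n := by
  rw [partialSups_eq_sup'_range]
  rfl

/-- The `r`-th moment of the error: `Z = X - X̄` solves a recursion whose coefficients are Lipschitz
in `Z`, with source terms of size `δ₁ + δ₂ + δ n ^ (1 - γ)` times `1 + ‖X̄‖`. -/
lemma exists_integral_maxGap_rpow_le (T : ℝ≥0) {r v κ c K γ : ℝ} (hr : 2 ≤ r) (hv : 0 ≤ v)
    (hκ : 0 ≤ κ) (hc : 0 ≤ c) (hK : 0 ≤ K) (hγ : γ ≤ 1) : ∃ C : ℝ, 0 < C ∧
    ∀ {d m : ℕ} {Ω : Type u} {mΩ : MeasurableSpace Ω} {P : Measure Ω}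
      [IsProbabilityMeasure P] {𝓕 : Filtration ℝ≥0 mΩ} {n : ℕ} (_ : 1 ≤ n) {ξ : ℕ → Ω → ℝ}
      (_ : IsRandomization P 𝓕 T n ξ) {W W' : ℝ≥0 → Ω → Vec m}
      (_ : IsDrivingNoise (gridFiltration 𝓕 T n ξ) P n r v (increment T n W))
      {δ₁ δ₂ δ : ℝ} (_ : δ₁ ∈ Icc (0 : ℝ) 1) (_ : δ₂ ∈ Icc (0 : ℝ) 1) (_ : δ ∈ Icc (0 : ℝ) 1)
      {G : ℕ → Ω → Mat m m} {R : ℕ → Ω → Vec m} {q : Vec m → ℝ}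
      (_ : IsPerturbedIncrement (gridFiltration 𝓕 T n ξ) P n r γ c δ (increment T n W)
        (increment T n W') G R q)
      {ϱ : ℝ} {a a' : ℝ → Vec d → Vec d} {b b' : ℝ → Vec d → Mat d m}
      (_ : HasLinearGrowth T κ a b) (_ : HasLinearGrowth T κ a' b') {η : Vec d}
      (_ : IsAdmissible T ϱ K a b η) (_ : a' ∈ VDrift T a δ₁) (_ : b' ∈ VDiffusion T b δ₂),
      Measurable (maxGap T n a b W a' b' W' η ξ) ∧
      Integrable (fun ω => maxGap T n a b W a' b' W' η ξ ω ^ r) P ∧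
      ∫ ω, maxGap T n a b W a' b' W' η ξ ω ^ r ∂P ≤
        C * (δ₁ + δ₂ + δ * (n : ℝ) ^ (1 - γ)) ^ r
          * Real.exp (C * (1 + (δ * (n : ℝ) ^ (1 - γ)) ^ r)) := by
  obtain ⟨C₀, hC₀, hmain⟩ := exists_integral_partialSups_le_exp.{u} hr hv
  obtain ⟨C₂, hC₂, hmom⟩ := exists_integral_eulerPath_le.{u} T (γ := γ) hr hv hκ hc hK
  have hr0 : 0 ≤ r := by linarith
  have hrpos : r ≠ 0 := by linarith
  have hT0 : (0 : ℝ) ≤ T := T.coe_nonneg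
  -- Coefficients of the propagated error and of the new error in the one-step bound.
  set L := 2 ^ r * (2 ^ r * (T * K) ^ r) + 3 ^ r * K ^ r with hL
  set A := 2 ^ r * (2 ^ r * T ^ r + c * κ ^ r) + 3 ^ r * (1 + (c * κ) ^ r) with hA
  have hL0 : 0 ≤ L := by positivity
  have hA0 : 0 ≤ A := by positivity
  refine ⟨C₀ * (A * (2 ^ r * (1 + C₂))) * Real.exp (C₀ * L) + C₂ + 1, by positivity,
    fun {d m Ω mΩ P _ 𝓕 n} hn {ξ} hξ {W W'} hΔ {δ₁ δ₂ δ} hδ₁ hδ₂ hδ {G R q} hpert {ϱ a a' b b'}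
      hab hab' {η} hadm ha' hb' => ?_⟩
  obtain ⟨p, hp, hpa⟩ := ha'
  obtain ⟨s, hs, hsb⟩ := hb'
  have hn' : (1 : ℝ) ≤ n := by exact_mod_cast hn
  have hn0 : (0 : ℝ) < n := by linarith
  set X := eulerPath T n a b η W ξ with hX
  set Y := eulerPath T n a' b' η W' ξ with hY
  set Δ := increment T n W with hΔdef
  have hXm : ∀ k ≤ n, Measurable[gridFiltration 𝓕 T n ξ k] (X k) :=
    hab.measurable_eulerPath hξ hn η fun k hk => hΔ.adapted k hk
  have hYm : ∀ k ≤ n, Measurable[gridFiltration 𝓕 T n ξ k] (Y k) :=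
    hab'.measurable_eulerPath hξ hn η fun k hk => hpert.adapted_increment hΔ hk
  have hXm' : ∀ k ≤ n, Measurable (X k) := fun k hk => (hXm k hk).mono (hΔ.le k) le_rfl
  have hYm' : ∀ k ≤ n, Measurable (Y k) := fun k hk => (hYm k hk).mono (hΔ.le k) le_rfl
  have hbX : ∀ k < n, EntryMeasurable (gridFiltration 𝓕 T n ξ k)
      fun ω => b (grid T n k) (X k ω) := fun k hk i j =>
    (hab.measurable_diffusion _ (grid_mem_Icc hn hk.le) i j).comp (hXm k hk.le)
  have hbY : ∀ k < n, EntryMeasurable (gridFiltration 𝓕 T n ξ k)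
      fun ω => b' (grid T n k) (Y k ω) := fun k hk i j =>
    (hab'.measurable_diffusion _ (grid_mem_Icc hn hk.le) i j).comp (hYm k hk.le)
  set ε := δ * (n : ℝ) ^ (1 - γ) with hε
  have hε0 : 0 ≤ ε := mul_nonneg hδ.1 (by positivity)
  have hδε : δ ≤ ε := le_mul_of_one_le_right hδ.1 (Real.one_le_rpow hn' (by linarith))
  set D := δ₁ + δ₂ + ε with hD
  have hD0 : 0 ≤ D := by have := hδ₁.1; have := hδ₂.1; positivity
  have h1D : δ₁ ≤ D := by have := hδ₂.1; linarith
  have h2D : δ₂ ≤ D := by have := hδ₁.1; linarith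
  have h3D : ε ≤ D := by have := hδ₁.1; have := hδ₂.1; linarith
  set E := C₂ * Real.exp (C₂ * (1 + ε ^ r)) with hE
  have hE0 : 0 ≤ E := by positivity
  set Z : ℕ → Ω → Vec d := fun k ω => X k ω - Y k ω with hZ
  set U : ℕ → Ω → Vec d := fun k ω => ((T : ℝ) / n) • (a (ξ k ω) (X k ω) - a' (ξ k ω) (Y k ω))
    - δ • matVec (b' (grid T n k) (Y k ω)) (R k ω) with hU
  set B : ℕ → Ω → Mat d m := fun k ω => b (grid T n k) (X k ω)
    - (b' (grid T n k) (Y k ω) + δ • (b' (grid T n k) (Y k ω) * G k ω)) with hB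
  have hZm : ∀ k ≤ n, Measurable (Z k) := fun k hk => (hXm' k hk).sub (hYm' k hk)
  have hrec : ∀ k < n, ∀ ω, Z (k + 1) ω = Z k ω + U k ω + matVec (B k ω) (Δ k ω) := by
    intro k hk ω
    simp only [hZ]
    rw [hX, hY, eulerPath_succ, eulerPath_succ, ← hX, ← hY, ← hΔdef, hpert.eq k hk ω]
    simp only [hU, hB, matVec_add, matVec_smul, add_matVec, sub_matVec, smul_matVec, matVec_mul,
      smul_add, smul_sub]
    abel
  have hBm : ∀ k < n, EntryMeasurable (gridFiltration 𝓕 T n ξ k) (B k) := fun k hk =>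
    (hbX k hk).sub ((hbY k hk).add_smul_mul (hpert.predictable k hk) δ)
  have hlin : ∀ k < n, Integrable (fun ω => ‖Z k ω‖ ^ r) P →
      Integrable (fun ω => ‖U k ω‖ ^ r) P ∧ Integrable (fun ω => ‖B k ω‖ ^ r) P ∧
      (n : ℝ) ^ r * ∫ ω, ‖U k ω‖ ^ r ∂P + ∫ ω, ‖B k ω‖ ^ r ∂P
        ≤ A * (2 ^ r * (1 + E)) * D ^ r + L * ∫ ω, ‖Z k ω‖ ^ r ∂P := by
    intro k hk hZi
    obtain ⟨hYi, hYle⟩ := hmom hn hξ hΔ hδ hpert hab' hadm.initial k hk.le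
    rw [← hY, ← hε, ← hE] at hYle
    obtain ⟨hNi, hNle⟩ := integrable_one_add_norm_rpow hr0 (hYm' k hk.le) hYi
    have htk := grid_mem_Icc (T := T) hn hk.le
    have hZk := hZm k hk.le
    have hYk := hYm' k hk.le
    set z := ∫ ω, ‖Z k ω‖ ^ r ∂P with hz
    set y := ∫ ω, (1 + ‖Y k ω‖) ^ r ∂P with hy
    have hz0 : 0 ≤ z := integral_nonneg fun ω => by positivity
    have hy0 : 0 ≤ y := integral_nonneg fun ω => by positivity
    have hyE : y ≤ 2 ^ r * (1 + E) := hNle.trans (by gcongr)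
    have hξm : Measurable (ξ k) := hξ.measurable k hk
    have hUm : Measurable (U k) := by
      have h1 := hab.measurable_drift_comp hξm (hξ.mem k hk) (hXm' k hk.le)
      have h1' := hab'.measurable_drift_comp hξm (hξ.mem k hk) (hYm' k hk.le)
      have h2 := ((hbY k hk).mono (hΔ.le k)).matVec ((hpert.adapted k hk).mono (hΔ.le _) le_rfl)
      exact measurable_sub_vec (measurable_const_smul_vec _ (measurable_sub_vec h1 h1'))
        (measurable_const_smul_vec _ h2)
    have hFpt : ∀ ω, (T * (K * ‖Z k ω‖ + δ₁ * (1 + ‖Y k ω‖))) ^ r ≤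
        2 ^ r * (T * K) ^ r * ‖Z k ω‖ ^ r + 2 ^ r * T ^ r * D ^ r * (1 + ‖Y k ω‖) ^ r := by
      intro ω
      have hδ0 := hδ₁.1
      calc (T * (K * ‖Z k ω‖ + δ₁ * (1 + ‖Y k ω‖))) ^ r
          ≤ (T * K * ‖Z k ω‖ + T * D * (1 + ‖Y k ω‖)) ^ r := by
            refine Real.rpow_le_rpow (by positivity) ?_ hr0
            have : (T : ℝ) * (δ₁ * (1 + ‖Y k ω‖)) ≤ T * (D * (1 + ‖Y k ω‖)) := by gcongr
            linarith
        _ ≤ 2 ^ r * ((T * K * ‖Z k ω‖) ^ r + (T * D * (1 + ‖Y k ω‖)) ^ r) :=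
            add_rpow_le_two_rpow_mul hr0 (by positivity) (by positivity)
        _ = _ := by
            rw [Real.mul_rpow (by positivity) (norm_nonneg _),
              Real.mul_rpow (x := T * D) (by positivity) (by positivity),
              Real.mul_rpow (x := T) (y := D) hT0 hD0]
            ring
    have hFr : Integrable (fun ω => 2 ^ r * (T * K) ^ r * ‖Z k ω‖ ^ r
        + 2 ^ r * T ^ r * D ^ r * (1 + ‖Y k ω‖) ^ r) P :=
      (hZi.const_mul _).add (hNi.const_mul _)
    have hFi : Integrable (fun ω => (T * (K * ‖Z k ω‖ + δ₁ * (1 + ‖Y k ω‖))) ^ r) P := by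
      refine hFr.mono' (by fun_prop : Measurable fun ω =>
        (T * (K * ‖Z k ω‖ + δ₁ * (1 + ‖Y k ω‖))) ^ r).aestronglyMeasurable
        (ae_of_all _ fun ω => ?_)
      have hδ0 := hδ₁.1
      rw [Real.norm_of_nonneg (by positivity)]
      exact hFpt ω
    have hFle : ∫ ω, (T * (K * ‖Z k ω‖ + δ₁ * (1 + ‖Y k ω‖))) ^ r ∂P ≤
        2 ^ r * (T * K) ^ r * z + 2 ^ r * T ^ r * D ^ r * y := by
      refine (integral_mono hFi hFr hFpt).trans (le_of_eq ?_)
      rw [integral_add (hZi.const_mul _) (hNi.const_mul _), integral_const_mul, integral_const_mul]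
    have hHeq : ∀ ω, (κ * (1 + ‖Y k ω‖)) ^ r = κ ^ r * (1 + ‖Y k ω‖) ^ r := fun ω =>
      Real.mul_rpow hκ (by positivity)
    have hHi : Integrable (fun ω => (κ * (1 + ‖Y k ω‖)) ^ r) P := by
      simp only [hHeq]; exact hNi.const_mul _
    obtain ⟨hUi, hUle⟩ := hpert.drift_moment_le hΔ hr hn hδ.1 hk hUm
      (F := fun ω => T * (K * ‖Z k ω‖ + δ₁ * (1 + ‖Y k ω‖))) (H := fun ω => κ * (1 + ‖Y k ω‖))
      (fun ω => by have := hδ₁.1; positivity) (fun ω => by positivity)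
      (((measurable_norm_vec (hYm k hk.le)).const_add 1).const_mul κ) hFi hHi (fun ω => by
        refine (norm_sub_le _ _).trans ?_
        rw [norm_smul, norm_smul, Real.norm_of_nonneg (by positivity), Real.norm_of_nonneg hδ.1]
        have hξk := hξ.mem k hk ω
        have h1 : ‖a (ξ k ω) (X k ω) - a' (ξ k ω) (Y k ω)‖ ≤
            K * ‖Z k ω‖ + δ₁ * (1 + ‖Y k ω‖) := by
          rw [hpa _ hξk, ← sub_sub]
          refine (norm_sub_le _ _).trans ?_
          rw [norm_smul, Real.norm_of_nonneg hδ₁.1]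
          have := hδ₁.1
          exact add_le_add (hadm.drift.lipschitz _ hξk _ _)
            (mul_le_mul_of_nonneg_left (hp.growth _ hξk _) hδ₁.1)
        have h2 := hab'.diffusion_le _ htk (Y k ω)
        have h3 := norm_matVec_le (b' (grid T n k) (Y k ω)) (R k ω)
        have hδ0 := hδ.1
        calc _ ≤ (T : ℝ) / n * (K * ‖Z k ω‖ + δ₁ * (1 + ‖Y k ω‖))
              + δ * ((κ * (1 + ‖Y k ω‖)) * ‖R k ω‖) := by
              gcongr
              exact h3.trans (by gcongr)
          _ = _ := by ring)
    simp only [hHeq] at hUle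
    rw [integral_const_mul, ← hy, ← hε] at hUle
    have hBpt : ∀ ω, ‖B k ω‖ ^ r ≤
        3 ^ r * K ^ r * ‖Z k ω‖ ^ r + 3 ^ r * (1 + (c * κ) ^ r) * D ^ r * (1 + ‖Y k ω‖) ^ r := by
      intro ω
      have hδ0 := hδ.1
      have hle : ‖B k ω‖ ≤ K * ‖Z k ω‖ + D * (1 + ‖Y k ω‖) + D * (c * κ) * (1 + ‖Y k ω‖) := by
        have h1 : ‖b (grid T n k) (X k ω) - b' (grid T n k) (Y k ω)‖ ≤
            K * ‖Z k ω‖ + D * (1 + ‖Y k ω‖) := by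
          rw [hsb _ htk, ← sub_sub]
          refine (norm_sub_le _ _).trans ?_
          rw [norm_smul, Real.norm_of_nonneg hδ₂.1]
          have h4 := hs.growth _ htk (Y k ω)
          exact add_le_add (hadm.diffusion.lipschitz _ htk _ _)
            (mul_le_mul h2D h4 (norm_nonneg _) hD0)
        have h2 : ‖δ • (b' (grid T n k) (Y k ω) * G k ω)‖ ≤ D * (c * κ) * (1 + ‖Y k ω‖) := by
          rw [norm_smul, Real.norm_of_nonneg hδ.1]
          have h3 := Matrix.frobenius_norm_mul (b' (grid T n k) (Y k ω)) (G k ω)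
          have h4 := hpert.norm_le k hk ω
          have h5 := hab'.diffusion_le _ htk (Y k ω)
          calc _ ≤ D * ((κ * (1 + ‖Y k ω‖)) * c) := by
                gcongr
                · exact hδε.trans h3D
                · exact h3.trans (by gcongr)
            _ = _ := by ring
        simp only [hB]
        rw [← sub_sub]
        exact (norm_sub_le _ _).trans (add_le_add h1 h2)
      refine (Real.rpow_le_rpow (norm_nonneg _) hle hr0).trans ?_
      refine (add_add_rpow_le_three_rpow_mul hr0 (by positivity) (by positivity)
        (by positivity)).trans (le_of_eq ?_)
      rw [Real.mul_rpow hK (norm_nonneg _), Real.mul_rpow (x := D) hD0 (by positivity),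
        Real.mul_rpow (x := D * (c * κ)) (by positivity) (by positivity),
        Real.mul_rpow (x := D) hD0 (by positivity)]
      ring
    have hBr : Integrable (fun ω => 3 ^ r * K ^ r * ‖Z k ω‖ ^ r
        + 3 ^ r * (1 + (c * κ) ^ r) * D ^ r * (1 + ‖Y k ω‖) ^ r) P :=
      (hZi.const_mul _).add (hNi.const_mul _)
    have hBi : Integrable (fun ω => ‖B k ω‖ ^ r) P := by
      refine hBr.mono' (((hBm k hk).mono (hΔ.le k)).norm.pow_const r).aestronglyMeasurable
        (ae_of_all _ fun ω => ?_)
      rw [Real.norm_of_nonneg (by positivity)]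
      exact hBpt ω
    have hBle : ∫ ω, ‖B k ω‖ ^ r ∂P ≤
        3 ^ r * K ^ r * z + 3 ^ r * (1 + (c * κ) ^ r) * D ^ r * y := by
      refine (integral_mono hBi hBr hBpt).trans (le_of_eq ?_)
      rw [integral_add (hZi.const_mul _) (hNi.const_mul _), integral_const_mul, integral_const_mul]
    refine ⟨hUi, hBi, ?_⟩
    have hεD : ε ^ r ≤ D ^ r := Real.rpow_le_rpow hε0 h3D hr0
    calc _ ≤ 2 ^ r * (2 ^ r * (T * K) ^ r * z + 2 ^ r * T ^ r * D ^ r * y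
            + c * D ^ r * (κ ^ r * y))
          + (3 ^ r * K ^ r * z + 3 ^ r * (1 + (c * κ) ^ r) * D ^ r * y) := by
          refine add_le_add (hUle.trans ?_) hBle
          gcongr
      _ = A * y * D ^ r + L * z := by rw [hA, hL]; ring
      _ ≤ _ := by gcongr
  have hZ0 : ∀ ω, ‖Z 0 ω‖ ≤ 0 := fun ω => by simp [hZ, hX, hY, eulerPath, euler]
  obtain ⟨hMi, -, hle⟩ := hmain hn hΔ hBm hZm hrec hZ0 (A := A * (2 ^ r * (1 + E)) * D ^ r)
    (by positivity) hL0 hlin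
  have hgap : maxGap T n a b W a' b' W' η ξ = fun ω => partialSups (fun i => ‖Z i ω‖) n := by
    ext1 ω; exact maxGap_eq_partialSups ..
  rw [hgap]
  refine ⟨measurable_partialSups fun i hi => (hZm i hi).norm, hMi, hle.trans ?_⟩
  have hεr : 0 ≤ ε ^ r := Real.rpow_nonneg hε0 r
  have hexp1 : 1 ≤ Real.exp (C₂ * (1 + ε ^ r)) := Real.one_le_exp (by positivity)
  rw [Real.zero_rpow hrpos, zero_add]
  have hpos : 0 ≤ C₀ * (A * (2 ^ r * (1 + C₂))) * Real.exp (C₀ * L) := by positivity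
  calc C₀ * (A * (2 ^ r * (1 + E)) * D ^ r) * Real.exp (C₀ * L)
      ≤ C₀ * (A * (2 ^ r * (Real.exp (C₂ * (1 + ε ^ r)) + E)) * D ^ r) * Real.exp (C₀ * L) := by
        gcongr
    _ = C₀ * (A * (2 ^ r * (1 + C₂))) * Real.exp (C₀ * L) * D ^ r
        * Real.exp (C₂ * (1 + ε ^ r)) := by rw [hE]; ring
    _ ≤ _ := by
        gcongr
        · linarith
        · linarith

/-- Passing from `r`-th moments to the `L^r` norm. -/
lemma memLp_and_eLpNorm_le_of_integral_rpow_le {Ω : Type u} {mΩ : MeasurableSpace Ω} {P : Measure Ω}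
    {r M : ℝ} (hr : 0 < r) (hM : 0 ≤ M) {f : Ω → ℝ} (hf0 : ∀ ω, 0 ≤ f ω) (hf : Measurable f)
    (hfi : Integrable (fun ω => f ω ^ r) P) (hle : ∫ ω, f ω ^ r ∂P ≤ M ^ r) :
    MemLp f (ENNReal.ofReal r) P ∧ eLpNorm f (ENNReal.ofReal r) P ≤ ENNReal.ofReal M := by
  have hp0 : ENNReal.ofReal r ≠ 0 := by simpa using hr
  have hnorm : ∀ ω, ‖f ω‖ ^ r = f ω ^ r := fun ω => by rw [Real.norm_of_nonneg (hf0 ω)]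
  have hmem : MemLp f (ENNReal.ofReal r) P := by
    rw [← integrable_norm_rpow_iff hf.aestronglyMeasurable hp0 ENNReal.ofReal_ne_top,
      ENNReal.toReal_ofReal hr.le]
    simpa only [hnorm] using hfi
  refine ⟨hmem, ?_⟩
  rw [hmem.eLpNorm_eq_integral_rpow_norm hp0 ENNReal.ofReal_ne_top, ENNReal.toReal_ofReal hr.le]
  simp only [hnorm]
  refine ENNReal.ofReal_le_ofReal ?_
  calc (∫ ω, f ω ^ r ∂P) ^ r⁻¹ ≤ (M ^ r) ^ r⁻¹ := by
        have : 0 ≤ ∫ ω, f ω ^ r ∂P := integral_nonneg fun ω => Real.rpow_nonneg (hf0 ω) r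
        gcongr
    _ = M := Real.rpow_rpow_inv hM hr.ne'

/-- The error bound for any perturbation of the Wiener process with remainder of order `γ`. -/
lemma exists_eLpNorm_maxGap_le (m : ℕ) (T : ℝ≥0) {r c K γ ϱ : ℝ} (hr : 2 ≤ r) (hc : 0 ≤ c)
    (hK : 0 ≤ K) (hϱ : 0 ≤ ϱ) (hγ : γ ≤ 1) : ∃ C : ℝ, 0 < C ∧
    ∀ {d : ℕ} {Ω : Type u} {mΩ : MeasurableSpace Ω} {P : Measure Ω}
      [IsProbabilityMeasure P] {𝓕 : Filtration ℝ≥0 mΩ} {W W' : ℝ≥0 → Ω → Vec m}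
      (_ : IsWiener P 𝓕 W) {n : ℕ} (_ : 1 ≤ n) {ξ : ℕ → Ω → ℝ} (_ : IsRandomization P 𝓕 T n ξ)
      {δ₁ δ₂ δ : ℝ} (_ : δ₁ ∈ Icc (0 : ℝ) 1) (_ : δ₂ ∈ Icc (0 : ℝ) 1) (_ : δ ∈ Icc (0 : ℝ) 1)
      {G : ℕ → Ω → Mat m m} {R : ℕ → Ω → Vec m} {q : Vec m → ℝ}
      (_ : IsPerturbedIncrement (gridFiltration 𝓕 T n ξ) P n r γ c δ (increment T n W)
        (increment T n W') G R q)
      {a a' : ℝ → Vec d → Vec d} {b b' : ℝ → Vec d → Mat d m} {η : Vec d}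
      (_ : IsAdmissible T ϱ K a b η) (_ : a' ∈ VDrift T a δ₁) (_ : b' ∈ VDiffusion T b δ₂),
      MemLp (maxGap T n a b W a' b' W' η ξ) (ENNReal.ofReal r) P ∧
      eLpNorm (maxGap T n a b W a' b' W' η ξ) (ENNReal.ofReal r) P ≤
        ENNReal.ofReal (C * (δ₁ + δ₂ + δ * (n : ℝ) ^ (1 - γ))
          * Real.exp (C * (1 + (δ * (n : ℝ) ^ (1 - γ)) ^ r))) := by
  have hT0 : (0 : ℝ) ≤ T := T.coe_nonneg
  have hv : 0 ≤ T * gaussianMoment m 2 + (T : ℝ) ^ (r / 2) * gaussianMoment m r :=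
    add_nonneg (mul_nonneg hT0 (gaussianMoment_nonneg m 2))
      (mul_nonneg (Real.rpow_nonneg hT0 _) (gaussianMoment_nonneg m r))
  obtain ⟨C, hC, hmain⟩ := exists_integral_maxGap_rpow_le.{u} T (γ := γ) (c := c) (K := K)
    (κ := K * (1 + (T : ℝ) ^ ϱ) + 1) hr hv (by positivity) hc hK hγ
  have hr0 : 0 < r := by linarith
  have hr1 : 1 ≤ r := by linarith
  refine ⟨C + 1, by positivity, fun {d Ω mΩ P _ 𝓕 W W'} hW {n} hn {ξ} hξ {δ₁ δ₂ δ} hδ₁ hδ₂ hδ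
    {G R q} hpert {a a' b b' η} hadm ha' hb' => ?_⟩
  have h0 : (0 : ℝ) ∈ Icc (0 : ℝ) 1 := ⟨le_rfl, zero_le_one⟩
  obtain ⟨hm, hi, hle⟩ := hmain hn hξ (hW.isDrivingNoise hξ hn hr) hδ₁ hδ₂ hδ hpert
    (hadm.hasLinearGrowth_of_mem hK hϱ h0 h0 mem_VDrift_zero mem_VDiffusion_zero)
    (hadm.hasLinearGrowth_of_mem hK hϱ hδ₁ hδ₂ ha' hb') hadm ha' hb'
  set ε := δ * (n : ℝ) ^ (1 - γ)
  have hε0 : 0 ≤ ε := mul_nonneg hδ.1 (by positivity)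
  have hεr : 0 ≤ ε ^ r := Real.rpow_nonneg hε0 r
  have hD0 : 0 ≤ δ₁ + δ₂ + ε := by have := hδ₁.1; have := hδ₂.1; positivity
  refine memLp_and_eLpNorm_le_of_integral_rpow_le hr0 (by positivity) (fun ω => ?_) hm hi
    (hle.trans ?_)
  · rw [maxGap_eq_partialSups]
    exact partialSups_nonneg (fun _ => norm_nonneg _) n
  · have hC1 : 0 ≤ C + 1 := by positivity
    rw [Real.mul_rpow (mul_nonneg hC1 hD0) (Real.exp_nonneg _), Real.mul_rpow hC1 hD0]
    have h1 : C ≤ (C + 1) ^ r := by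
      calc C ≤ C + 1 := by linarith
        _ ≤ (C + 1) ^ r := Real.self_le_rpow_of_one_le (by linarith) hr1
    have h2 : Real.exp (C * (1 + ε ^ r)) ≤ Real.exp ((C + 1) * (1 + ε ^ r)) ^ r := by
      rw [← Real.exp_mul]
      apply Real.exp_le_exp.2
      have h3 : 0 ≤ (C + 1) * (1 + ε ^ r) := by positivity
      nlinarith
    gcongr

end Error

end NoisyEuler

theorem proposition1 (d m : ℕ) (T : ℝ≥0) (hT : 0 < T) (K : ℝ) (hK : 0 < K)
    (ϱ : ℝ) (hϱ : ϱ ∈ Set.Ioc (0 : ℝ) 1) (r : ℝ) (hr : 2 ≤ r) :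
    (∃ C : ℝ, 0 < C ∧
      ∀ (Ω : Type u) (mΩ : MeasurableSpace Ω) (P : Measure Ω) (_ : IsProbabilityMeasure P)
        (𝓕 : Filtration ℝ≥0 mΩ) (W : ℝ≥0 → Ω → NoisyEuler.Vec m)
        (_ : NoisyEuler.IsWiener P 𝓕 W)
        (n : ℕ) (_ : 1 ≤ n) (ξ : ℕ → Ω → ℝ) (_ : NoisyEuler.IsRandomization P 𝓕 T n ξ)
        (δ₁ δ₂ δ₃ : ℝ) (_ : δ₁ ∈ Set.Icc (0 : ℝ) 1) (_ : δ₂ ∈ Set.Icc (0 : ℝ) 1)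
        (_ : δ₃ ∈ Set.Icc (0 : ℝ) 1)
        (a : ℝ → NoisyEuler.Vec d → NoisyEuler.Vec d)
        (b : ℝ → NoisyEuler.Vec d → NoisyEuler.Mat d m) (η : NoisyEuler.Vec d)
        (_ : NoisyEuler.IsAdmissible T ϱ K a b η),
        ∀ a' ∈ NoisyEuler.VDrift T a δ₁, ∀ b' ∈ NoisyEuler.VDiffusion T b δ₂,
        ∀ W' ∈ NoisyEuler.WSmooth T W δ₃,
          MemLp (NoisyEuler.maxGap T n a b W a' b' W' η ξ) (ENNReal.ofReal r) P ∧
          eLpNorm (NoisyEuler.maxGap T n a b W a' b' W' η ξ) (ENNReal.ofReal r) P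
            ≤ ENNReal.ofReal (C * (δ₁ + δ₂ + δ₃))) ∧
    (∀ α ∈ Set.Ioc (0 : ℝ) 1, ∀ β ∈ Set.Ioc (0 : ℝ) 1, ∀ γ : ℝ, γ = min α (β / 2) →
      ∃ C : ℝ, 0 < C ∧
      ∀ (Ω : Type u) (mΩ : MeasurableSpace Ω) (P : Measure Ω) (_ : IsProbabilityMeasure P)
        (𝓕 : Filtration ℝ≥0 mΩ) (W : ℝ≥0 → Ω → NoisyEuler.Vec m)
        (_ : NoisyEuler.IsWiener P 𝓕 W)
        (n : ℕ) (_ : 1 ≤ n) (ξ : ℕ → Ω → ℝ) (_ : NoisyEuler.IsRandomization P 𝓕 T n ξ)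
        (δ₁ δ₂ δ₃ : ℝ) (_ : δ₁ ∈ Set.Icc (0 : ℝ) 1) (_ : δ₂ ∈ Set.Icc (0 : ℝ) 1)
        (_ : δ₃ ∈ Set.Icc (0 : ℝ) 1)
        (a : ℝ → NoisyEuler.Vec d → NoisyEuler.Vec d)
        (b : ℝ → NoisyEuler.Vec d → NoisyEuler.Mat d m) (η : NoisyEuler.Vec d)
        (_ : NoisyEuler.IsAdmissible T ϱ K a b η),
        ∀ a' ∈ NoisyEuler.VDrift T a δ₁, ∀ b' ∈ NoisyEuler.VDiffusion T b δ₂,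
        ∀ W' ∈ NoisyEuler.WHolder T α β W δ₃,
          MemLp (NoisyEuler.maxGap T n a b W a' b' W' η ξ) (ENNReal.ofReal r) P ∧
          eLpNorm (NoisyEuler.maxGap T n a b W a' b' W' η ξ) (ENNReal.ofReal r) P
            ≤ ENNReal.ofReal (C * (δ₁ + δ₂ + δ₃ * (n : ℝ) ^ (1 - γ))
                * (1 + δ₃ * (n : ℝ) ^ (1 - γ))
                * Real.exp (C * (1 + (δ₃ * (n : ℝ) ^ (1 - γ)) ^ r)))) := by
  have hr0 : 0 ≤ r := by linarith
  refine ⟨?_, ?_⟩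
  · obtain ⟨c, hc, hpert⟩ := NoisyEuler.exists_isPerturbedIncrement_smooth.{u} m T hr
    obtain ⟨C, hC, hmain⟩ := NoisyEuler.exists_eLpNorm_maxGap_le.{u} m T (γ := 1) hr hc.le hK.le
      hϱ.1.le le_rfl
    refine ⟨C * Real.exp (C * 2), by positivity, ?_⟩
    intro Ω mΩ P _ 𝓕 W hW n hn ξ hξ δ₁ δ₂ δ₃ h₁ h₂ h₃ a b η hadm a' ha' b' hb' W' hW'
    obtain ⟨G, R, q, hq⟩ := hpert hW hn hξ hW'
    obtain ⟨hmem, hle⟩ := hmain hW hn hξ h₁ h₂ h₃ hq hadm ha' hb'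
    refine ⟨hmem, hle.trans (ENNReal.ofReal_le_ofReal ?_)⟩
    -- With `γ = 1` the quantity in the exponential is at most `1 + δ₃ ^ r ≤ 2`.
    rw [sub_self, Real.rpow_zero, mul_one]
    have hD : 0 ≤ δ₁ + δ₂ + δ₃ := by linarith [h₁.1, h₂.1, h₃.1]
    have hδr : δ₃ ^ r ≤ 1 := Real.rpow_le_one h₃.1 h₃.2 hr0
    calc C * (δ₁ + δ₂ + δ₃) * Real.exp (C * (1 + δ₃ ^ r))
        ≤ C * (δ₁ + δ₂ + δ₃) * Real.exp (C * 2) := by gcongr; linarith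
      _ = _ := by ring
  · rintro α hα β hβ γ rfl
    obtain ⟨c, hc, hpert⟩ := NoisyEuler.exists_isPerturbedIncrement_holder.{u} m T hr hα.1 hβ.1
    obtain ⟨C, hC, hmain⟩ := NoisyEuler.exists_eLpNorm_maxGap_le.{u} m T (γ := min α (β / 2)) hr
      hc.le hK.le hϱ.1.le ((min_le_left _ _).trans hα.2)
    refine ⟨C, hC, ?_⟩
    intro Ω mΩ P _ 𝓕 W hW n hn ξ hξ δ₁ δ₂ δ₃ h₁ h₂ h₃ a b η hadm a' ha' b' hb' W' hW'
    obtain ⟨G, R, q, hq⟩ := hpert hW hn hξ hW'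
    obtain ⟨hmem, hle⟩ := hmain hW hn hξ h₁ h₂ h₃ hq hadm ha' hb'
    refine ⟨hmem, hle.trans (ENNReal.ofReal_le_ofReal ?_)⟩
    have hε : 0 ≤ δ₃ * (n : ℝ) ^ (1 - min α (β / 2)) := mul_nonneg h₃.1 (by positivity)
    have hD : 0 ≤ δ₁ + δ₂ + δ₃ * (n : ℝ) ^ (1 - min α (β / 2)) := by linarith [h₁.1, h₂.1]
    exact mul_le_mul_of_nonneg_right
      (le_mul_of_one_le_right (mul_nonneg hC.le hD) (by linarith)) (Real.exp_nonneg _)
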